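/- **Setting.** Let $T$ be a locally compact metric space. For a class $\mathcal D$ of subsets of $T$ let $\mathcal D(u)$ be the class of finite unions of elements of $\mathcal D$. Let $\mathcal A$ be an *indexing collection* on $T$: a class of compact connected subsets of $T$ with $\emptyset\in\mathcal A$ such that 1. $A^\circ\ne A$ for $A\in\mathcal A\setminus\{\emptyset,T\}$, and there is an increasing sequence $(B_n)$ in $\mathcal A(u)$ with $T=\bigcup_n B_n^\circ$; 2. $\mathcal A$ is closed under arbitrary (nonempty) intersections, nonempty $A,A'\in\mathcal A$ have $A\cap A'\neq\emptyset$, and if $(A_i)$ is an increasing sequence in $\mathcal A$ with $A_i\subseteq B_n$ for all $i$ and some $n$, then $\overline{\bigcup_i A_i}\in\mathcal A$; 3. $\mathcal A$ generates the Borel $\sigma$-algebra of $T$; 4. there are an increasing sequence of finite classes $\mathcal A_n\subseteq\mathcal A$, closed under intersections, with $\emptyset,B_n\in\mathcal A_n(u)$, and maps $g_n:\mathcal A\to\mathcal A_n(u)\cup\{T\}$ that preserve (nonempty) arbitrary intersections and finite unions (if $\bigcup_iA_i=\bigcup_jA'_j$ are finite unions then $\bigcup_ig_n(A_i)=\bigcup_jg_n(A'_j)$),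 with $A\subseteq g_n(A)^\circ$, $g_n(A)\subseteq g_k(A)$ for $n\ge k$, $A=\bigcap_ng_n(A)$, $g_n(A)\cap A'\in\mathcal A$ for $A,A'\in\mathcal A$, $g_n(A)\cap A'\in\mathcal A_n$ for $A\in\mathcal A$, $A'\in\mathcal A_n$, and $g_n(\emptyset)=\emptyset$; 5. every countable intersection of sets of $\mathcal A(u)$ is the closure of a countable union of sets of $\mathcal A$. Put $\emptyset'=\bigcap_{U\in\mathcal A\setminus\{\emptyset\}}U$. Let $m$ be a Radon measure on $T$ with $m(\emptyset')=0$ which is continuous from below on $\mathcal A$: $m\big(\overline{\bigcup_iA_i}\big)=m\big(\bigcup_iA_i\big)$ whenever $(A_i)_{i\in\mathbf N}$ is an increasing sequence in $\mathcal A$ with $\overline{\bigcup_iA_i}\in\mathcal A$. Let $\mathcal C$ be the class of sets $C=U_0\setminus\bigcup_{i=1}^nU_i$ with $n\ge 0$ and $U_0,\dots,U_n\in\mathcal A$. A set-indexed process is a family $X=\{X_U;U\in\mathcal A\}$ of real random variables on a probability space $(\Omega,P)$. It has *definite increments* if for every $C\in\mathcal C$ the variable $$\Delta X_C=X_{U_0}-\sum_{\emptyset\ne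 S\subseteq\{1,\dots,n\}}(-1)^{|S|-1}X_{U_0\cap\bigcap_{i\in S}U_i}$$ does not depend, up to almost sure equality, on the representation of $C$. $X$ is a *set-indexed Lévy process* if it has definite increments and * $X_{\emptyset'}=0$ a.s.; * for pairwise disjoint $C_1,\dots,C_n\in\mathcal C$ the variables $\Delta X_{C_1},\dots,\Delta X_{C_n}$ are independent; * for all $n$, all $V\in\mathcal A$ and all increasing $U_1\subseteq\dots\subseteq U_n$, $A_1\subseteq\dots\subseteq A_n$ in $\mathcal A$ with $m(U_i\setminus V)=m(A_i)$ for every $i$, the vectors $(\Delta X_{U_1\setminus V},\dots,\Delta X_{U_n\setminus V})$ and $(\Delta X_{A_1},\dots,\Delta X_{A_n})$ have the same law; * if $(U_n)$ is a sequence in $\mathcal A$ with $\overline{\bigcup_n\bigcap_{k\ge n}U_k}=\bigcap_n\overline{\bigcup_{k\ge n}U_k}=A\in\mathcal A$, then $X_{U_n}\to X_A$ in probability. $\Delta X$ is an *infinitely divisible independently scattered random measure* on $\mathcal C$ if each $\Delta X_C$ has an infinitely divisible law and, for every sequence $(C_k)$ of pairwise disjoint sets of $\mathcal C$, the variables $\Delta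 X_{C_k}$ are independent and, if $\bigcup_kC_k\in\mathcal C$, $\Delta X_{\bigcup_kC_k}=\sum_k\Delta X_{C_k}$ a.s., the series converging a.s. For an infinitely divisible probability measure $\mu$ on $\mathbf R$ and $t\ge0$, $\mu^t$ is the probability measure with characteristic function $e^{t\psi}$, where $\psi$ is the continuous function with $\psi(0)=0$ and $\hat\mu=e^{\psi}$. For $C_0,\dots,C_n\in\mathcal C$ let $\cap^{(k)}$ be the union of the intersections of $k$ of these sets (so $\cap^{(n+2)}=\emptyset$). Say that $\Delta X$ has the *canonical finite-dimensional distributions of $\mu$* if for all $n\ge0$, $C_0,\dots,C_n\in\mathcal C$ and Borel sets $B_0,\dots,B_n\subseteq\mathbf R$ $$P(\Delta X_{C_0}\in B_0,\dots,\Delta X_{C_n}\in B_n)=\int\ \prod_{\emptyset\ne J\subseteq\{0,\dots,n\}}\mu^{m\left(\bigcap_{j\in J}C_j\,\setminus\,\cap^{(|J|+1)}\right)}(d\xi_J)\ \prod_{i=0}^n\mathbf 1_{B_i}\Big(\sum_{J\ni i}\xi_J\Big).\qquad(*)$$ **Theorem.** (i) Let $X$ be a set-indexed Lévy process and $U_0\in\mathcal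 A$ with $m(U_0)>0$. Then $P_{X_{U_0}}$ and $\mu=(P_{X_{U_0}})^{1/m(U_0)}$ are infinitely divisible, $P_{X_U}=\mu^{m(U)}$ for all $U\in\mathcal A$, and $\Delta X$ has the canonical finite-dimensional distributions $(*)$ of $\mu$. Moreover the law of $X$ on $\mathbf R^{\mathcal A}$ is determined by the law of $X_{U_0}$: any set-indexed Lévy process $X'$ (possibly on another probability space) with $P_{X'_{U_0}}=P_{X_{U_0}}$ has the same law as $X$. (ii) A set-indexed process $X$ is a set-indexed Lévy process if and only if it has definite increments, $\Delta X$ is an infinitely divisible independently scattered random measure on $\mathcal C$, and $\Delta X_{C_1}$ and $\Delta X_{C_2}$ have the same law whenever $C_1,C_2\in\mathcal C$ and $m(C_1)=m(C_2)$. In this case there is an infinitely divisible $\mu$ such that $\Delta X$ has the canonical finite-dimensional distributions $(*)$ of $\mu$. (iii) For every infinitely divisible probability measure $\mu$ on $\mathbf R$ there is a set-indexed Lévy process $X$ with $P_{X_U}=\mu^{m(U)}$ for all $U\in\mathcal A$, and such that $\Delta X$ has the canonical finite-dimensional distributions $(*)$ of $\mu$. -/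

import Mathlib

open MeasureTheory ProbabilityTheory Filter Topology

universe u v w

namespace SetIndexed

/-- `𝒟(u)`: the class of all finite unions of elements of `𝒟`. -/
def finiteUnions {T : Type*} (𝒟 : Set (Set T)) : Set (Set T) :=
  {B | ∃ F : Finset (Set T), (F : Set (Set T)) ⊆ 𝒟 ∧ B = ⋃₀ (F : Set (Set T))}

/-- An indexing collection `𝒜` of compact connected subsets of a topological space `T`. The empty
set belongs to `𝒜`, so connectedness is expressed by `IsPreconnected`; "arbitrary intersections"
are intersections of nonempty subfamilies. -/
structure IndexingCollection (T : Type*) [TopologicalSpace T] where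
  /-- the class `𝒜` -/
  sets : Set (Set T)
  isCompact : ∀ A ∈ sets, IsCompact A
  isPreconnected : ∀ A ∈ sets, IsPreconnected A
  empty_mem : ∅ ∈ sets
  interior_ne : ∀ A ∈ sets, A ≠ ∅ → A ≠ Set.univ → interior A ≠ A
  /-- the exhausting sequence `(Bₙ)` in `𝒜(u)` -/
  B : ℕ → Set T
  B_mem : ∀ n, B n ∈ finiteUnions sets
  B_mono : Monotone B
  iUnion_interior_B : ⋃ n, interior (B n) = Set.univ
  sInter_mem : ∀ S : Set (Set T), S.Nonempty → S ⊆ sets → ⋂₀ S ∈ sets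
  inter_nonempty : ∀ A ∈ sets, ∀ A' ∈ sets, A.Nonempty → A'.Nonempty → (A ∩ A').Nonempty
  closure_iUnion_mem : ∀ A : ℕ → Set T, (∀ i, A i ∈ sets) → Monotone A →
    (∃ n, ∀ i, A i ⊆ B n) → closure (⋃ i, A i) ∈ sets
  generateFrom_eq : MeasurableSpace.generateFrom sets = borel T
  /-- separability from above: finite subclasses `𝒜ₙ` and approximations `gₙ` -/
  separable : ∃ (𝒜n : ℕ → Set (Set T)) (g : ℕ → Set T → Set T),
    (∀ n, (𝒜n n).Finite) ∧ (∀ n, 𝒜n n ⊆ sets) ∧ Monotone 𝒜n ∧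
    (∀ n, ∀ A ∈ 𝒜n n, ∀ A' ∈ 𝒜n n, A ∩ A' ∈ 𝒜n n) ∧
    (∀ n, ∅ ∈ finiteUnions (𝒜n n)) ∧ (∀ n, B n ∈ finiteUnions (𝒜n n)) ∧
    (∀ n, ∀ A ∈ sets, g n A ∈ finiteUnions (𝒜n n) ∨ g n A = Set.univ) ∧
    (∀ n, ∀ S : Set (Set T), S.Nonempty → S ⊆ sets → g n (⋂₀ S) = ⋂ A ∈ S, g n A) ∧
    (∀ n, ∀ F F' : Finset (Set T), (F : Set (Set T)) ⊆ sets → (F' : Set (Set T)) ⊆ sets →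
      ⋃₀ (F : Set (Set T)) = ⋃₀ (F' : Set (Set T)) → ⋃ A ∈ F, g n A = ⋃ A ∈ F', g n A) ∧
    (∀ n, ∀ A ∈ sets, A ⊆ interior (g n A)) ∧
    (∀ n k, k ≤ n → ∀ A ∈ sets, g n A ⊆ g k A) ∧
    (∀ A ∈ sets, A = ⋂ n, g n A) ∧
    (∀ n, ∀ A ∈ sets, ∀ A' ∈ sets, g n A ∩ A' ∈ sets) ∧
    (∀ n, ∀ A ∈ sets, ∀ A' ∈ 𝒜n n, g n A ∩ A' ∈ 𝒜n n) ∧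
    (∀ n, g n ∅ = ∅)
  countable_inter : ∀ D : ℕ → Set T, (∀ n, D n ∈ finiteUnions sets) →
    ∃ E : ℕ → Set T, (∀ n, E n ∈ sets) ∧ ⋂ n, D n = closure (⋃ n, E n)

namespace IndexingCollection

variable {T : Type u} [TopologicalSpace T] (𝒜 : IndexingCollection T)

/-- The minimal set `∅'`, the intersection of all nonempty elements of `𝒜`. -/
def minimalSet : Set T := ⋂₀ (𝒜.sets \ {∅})

theorem minimalSet_mem : 𝒜.minimalSet ∈ 𝒜.sets := by
  by_cases h : (𝒜.sets \ {∅}).Nonempty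
  · exact 𝒜.sInter_mem _ h Set.sdiff_subset
  · have h' : ∀ A ∈ 𝒜.sets, A = ∅ := fun A hA => by
      by_contra hne
      exact h ⟨A, hA, hne⟩
    have hT : IsEmpty T := by
      refine ⟨fun x => ?_⟩
      have hx : x ∈ ⋃ n, interior (𝒜.B n) := by rw [𝒜.iUnion_interior_B]; trivial
      obtain ⟨n, hn⟩ := Set.mem_iUnion.1 hx
      obtain ⟨F, hF, hB⟩ := 𝒜.B_mem n
      have hxB := interior_subset hn
      rw [hB] at hxB
      obtain ⟨A, hA, hxA⟩ := hxB
      rw [h' A (hF hA)] at hxA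
      exact hxA
    rw [Set.eq_empty_of_isEmpty 𝒜.minimalSet]
    exact 𝒜.empty_mem

theorem inter_biInter_mem (U₀ : 𝒜.sets) {n : ℕ} (U : Fin n → 𝒜.sets) (S : Finset (Fin n)) :
    ((U₀ : Set T) ∩ ⋂ i ∈ S, (U i : Set T)) ∈ 𝒜.sets := by
  have h := 𝒜.sInter_mem (insert (U₀ : Set T) ((fun i => (U i : Set T)) '' (S : Set (Fin n))))
    ⟨_, Set.mem_insert _ _⟩ (by
      rintro A (rfl | ⟨i, -, rfl⟩)
      · exact U₀.2
      · exact (U i).2)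
  rw [Set.sInter_insert, Set.sInter_image] at h
  exact h

/-- `U₀ ∩ ⋂_{i ∈ S} U i` as an element of `𝒜`. -/
def interOn (U₀ : 𝒜.sets) {n : ℕ} (U : Fin n → 𝒜.sets) (S : Finset (Fin n)) : 𝒜.sets :=
  ⟨(U₀ : Set T) ∩ ⋂ i ∈ S, (U i : Set T), 𝒜.inter_biInter_mem U₀ U S⟩

/-- The class `𝒞` of all sets `U₀ \ ⋃_{i=1}^n U_i` with `U₀, …, U_n ∈ 𝒜`. -/
def increments : Set (Set T) :=
  {C | ∃ (U₀ : 𝒜.sets) (n : ℕ) (U : Fin n → 𝒜.sets), C = (U₀ : Set T) \ ⋃ i, (U i : Set T)}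

/-- `U \ V`, for `U, V ∈ 𝒜`, as an element of `𝒞` (these sets form the class `𝒞₀`). -/
def sdiff (U V : 𝒜.sets) : 𝒜.increments :=
  ⟨(U : Set T) \ V, U, 1, fun _ => V, by simp [Set.iUnion_const]⟩

/-- An element of `𝒜` as an element of `𝒞`. -/
def toIncrement (U : 𝒜.sets) : 𝒜.increments :=
  ⟨(U : Set T), U, 0, Fin.elim0, by simp⟩

end IndexingCollection

variable {T : Type u} [TopologicalSpace T] {𝒜 : IndexingCollection T} {Ω : Type v}

/-- The inclusion-exclusion value attached to the representation `U₀ \ ⋃ i, U i`: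
`X_{U₀} - ∑_{∅ ≠ S} (-1)^{|S|-1} X_{U₀ ∩ ⋂_{i ∈ S} U_i}`. -/
def inclExcl (X : 𝒜.sets → Ω → ℝ) (U₀ : 𝒜.sets) {n : ℕ} (U : Fin n → 𝒜.sets) (ω : Ω) : ℝ :=
  X U₀ ω - ∑ S : Finset (Fin n) with S.Nonempty,
    (-1 : ℝ) ^ (S.card - 1) * X (𝒜.interOn U₀ U S) ω

/-- The increment process `ΔX`, computed from a chosen representation of `C ∈ 𝒞`; under
`HasDefiniteIncrements` the choice is immaterial. -/
noncomputable def increment (X : 𝒜.sets → Ω → ℝ) (C : 𝒜.increments) : Ω → ℝ :=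
  inclExcl X C.2.choose C.2.choose_spec.choose_spec.choose

/-- The increment process exists: the inclusion-exclusion value does not depend (almost surely)
on the representation of the set. In particular `X_∅ = 0` almost surely, on comparing the
representations of `∅` as `∅` and as `∅ \ ∅`. -/
def HasDefiniteIncrements [MeasurableSpace Ω] (P : Measure Ω) (X : 𝒜.sets → Ω → ℝ) : Prop :=
  ∀ (U₀ : 𝒜.sets) (n : ℕ) (U : Fin n → 𝒜.sets) (V₀ : 𝒜.sets) (k : ℕ) (V : Fin k → 𝒜.sets),
    (U₀ : Set T) \ ⋃ i, (U i : Set T) = (V₀ : Set T) \ ⋃ i, (V i : Set T) →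
      inclExcl X U₀ U =ᵐ[P] inclExcl X V₀ V

/-- Set-indexed Lévy processes on `(T, 𝒜, m)`. -/
structure IsLevy [MeasurableSpace T] (m : Measure T) [MeasurableSpace Ω] (P : Measure Ω)
    (X : 𝒜.sets → Ω → ℝ) : Prop where
  definite : HasDefiniteIncrements P X
  zero : X ⟨𝒜.minimalSet, 𝒜.minimalSet_mem⟩ =ᵐ[P] 0
  indep : ∀ (n : ℕ) (C : Fin n → 𝒜.increments),
    Pairwise (fun i j => Disjoint (C i : Set T) (C j : Set T)) →
      iIndepFun (fun i => increment X (C i)) P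
  stationary : ∀ (n : ℕ) (V : 𝒜.sets) (U A : Fin n → 𝒜.sets),
    Monotone (fun i => (U i : Set T)) → Monotone (fun i => (A i : Set T)) →
    (∀ i, m ((U i : Set T) \ V) = m (A i : Set T)) →
      IdentDistrib (fun ω i => increment X (𝒜.sdiff (U i) V) ω)
        (fun ω i => increment X (𝒜.toIncrement (A i)) ω) P P
  continuous : ∀ (U : ℕ → 𝒜.sets) (A : 𝒜.sets),
    closure (⋃ n, ⋂ k ≥ n, (U k : Set T)) = A → ⋂ n, closure (⋃ k ≥ n, (U k : Set T)) = A →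
      TendstoInMeasure P (fun n => X (U n)) atTop (X A)

/-- `n`-fold convolution power of a measure on `ℝ`. -/
noncomputable def convNPow (ν : Measure ℝ) : ℕ → Measure ℝ
  | 0 => Measure.dirac 0
  | n + 1 => Measure.conv (convNPow ν n) ν

/-- Infinitely divisible probability measures on `ℝ`. -/
def IsInfinitelyDivisible (μ : Measure ℝ) : Prop :=
  IsProbabilityMeasure μ ∧
    ∀ n : ℕ, 0 < n → ∃ ν : Measure ℝ, IsProbabilityMeasure ν ∧ convNPow ν n = μ

/-- `ν` is the convolution power `μ^t`: it is a probability measure with characteristic function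
`exp (t * ψ)`, where `ψ` is the distinguished logarithm of the characteristic function of `μ`
(the unique continuous `ψ` with `ψ 0 = 0` and `exp ψ` equal to that characteristic function).
Such a `ν` is unique, and exists for all `t ≥ 0` if `μ` is infinitely divisible. -/
def IsConvRPow (μ : Measure ℝ) (t : ℝ) (ν : Measure ℝ) : Prop :=
  IsProbabilityMeasure ν ∧ ∃ ψ : ℝ → ℂ, Continuous ψ ∧ ψ 0 = 0 ∧
    (∀ z, charFun μ z = Complex.exp (ψ z)) ∧ ∀ z, charFun ν z = Complex.exp (t * ψ z)

open Classical in
/-- The convolution power `μ^t` (the zero measure, which is not a probability measure, where it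
does not exist). -/
noncomputable def convRPow (μ : Measure ℝ) (t : ℝ) : Measure ℝ :=
  if h : ∃ ν, IsConvRPow μ t ν then h.choose else 0

/-- The increment process `ΔX` is an infinitely divisible independently scattered random measure
on `𝒞`: for disjoint `C₀, C₁, …` in `𝒞` the variables `ΔX_{C_k}` are independent, and if their
union `C` is in `𝒞` then `ΔX_C = ∑ ΔX_{C_k}` almost surely, the series converging almost surely;
each `ΔX_C` has an infinitely divisible law. -/
structure IsIDScatteredMeasure [MeasurableSpace Ω] (P : Measure Ω) (X : 𝒜.sets → Ω → ℝ) :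
    Prop where
  indep : ∀ C : ℕ → 𝒜.increments,
    Pairwise (fun i j => Disjoint (C i : Set T) (C j : Set T)) →
      iIndepFun (fun i => increment X (C i)) P
  additive : ∀ (C : ℕ → 𝒜.increments) (D : 𝒜.increments),
    Pairwise (fun i j => Disjoint (C i : Set T) (C j : Set T)) →
    (D : Set T) = ⋃ i, (C i : Set T) →
      ∀ᵐ ω ∂P, Tendsto (fun n => ∑ i ∈ Finset.range n, increment X (C i) ω) atTop
        (𝓝 (increment X D ω))
  infDiv : ∀ C : 𝒜.increments, IsInfinitelyDivisible (P.map (increment X C))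

/-- `∩^{(k)}`: the union of all intersections of `k` of the sets `C i`. -/
def overlap {ι : Type*} (C : ι → Set T) (k : ℕ) : Set T :=
  ⋃ K : Finset ι, ⋃ _ : K.card = k, ⋂ j ∈ K, C j

/-- The finite-dimensional distributions of `ΔX` are
`P(∀ i, ΔX_{C_i} ∈ B_i) = ∫ ∏_{∅ ≠ J} μ^{m(⋂_{j ∈ J} C_j \ ∩^{(|J|+1)})}(dξ_J)
  ∏_i 1_{B_i}(∑_{J ∋ i} ξ_J)`. -/
def HasCanonicalFDD [MeasurableSpace T] (m : Measure T) [MeasurableSpace Ω] (P : Measure Ω)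
    (X : 𝒜.sets → Ω → ℝ) (μ : Measure ℝ) : Prop :=
  ∀ (n : ℕ) (C : Fin (n + 1) → 𝒜.increments) (B : Fin (n + 1) → Set ℝ),
    (∀ i, MeasurableSet (B i)) →
    P {ω | ∀ i, increment X (C i) ω ∈ B i} =
      ∫⁻ ξ : {J : Finset (Fin (n + 1)) // J.Nonempty} → ℝ,
        ∏ i, (B i).indicator (1 : ℝ → ENNReal)
          (∑ J : {J : Finset (Fin (n + 1)) // J.Nonempty} with i ∈ J.1, ξ J)
        ∂(Measure.pi fun J : {J : Finset (Fin (n + 1)) // J.Nonempty} =>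
          convRPow μ (m.real ((⋂ j ∈ J.1, (C j : Set T)) \
            overlap (fun i => (C i : Set T)) (J.1.card + 1))))

end SetIndexed

/-!
The whole theorem rests on one description of the processes in question. Extend `X` linearly to
finite combinations, `∑ c_U X_U`; then a set-indexed Lévy process is a process for which

  `E exp (i ∑ c_U X_U) = exp (∫ ψ (∑ c_U 1_U) dm)`   (`HasExponent`)

for some function `ψ` whose multiples `t ψ`, `t ≥ 0`, are the logarithms of characteristic
functions (`IsExponent`).

*From the formula to the conclusions.* `ΔX_C` is the linear extension at a combination with
indicator sum `1_C`, so the formula gives the joint characteristic function of all increments.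
It vanishes only through indicators, whence definite increments; it factorises over disjoint sets,
whence independence; for monotone families of sets it telescopes into a function of the measures,
whence stationarity of vectors; it is continuous in `m`-measure of symmetric differences, whence
stochastic continuity; and splitting the space into the atoms of `C_0, …, C_n` turns the
integral into the sum which is the exponent of the canonical law. Almost sure convergence of the
series in the scattering property comes from convergence in probability through Ottaviani's
inequality (`ae_tendsto_of_tendstoInMeasure_of_iIndepFun`).

*From the process to the formula.* Definite increments say that `∑ c_U X_U` depends only on
`∑ c_U 1_U` (`HasDefiniteIncrements.linearExtension_ae_eq`), so it suffices to know the laws of the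
increments over disjoint sets, and by peeling off the removed sets those of `X_U`. Sets of `𝒜`
take all intermediate measures inside a given one (`IndexingCollection.exists_subset_measure_eq`:
a maximal set of measure at most `t` and a minimal larger set of measure at least `t` could
otherwise be separated by an approximation `g_n`, or else a connected set would split). Hence the
characteristic function of `X_U` is multiplicative in `m U`; its roots make `P_{X_U}` infinitely
divisible, and continuity along decreasing sequences makes it `exp (m U · ψ)`. This needs only a
weak part of the hypotheses, common to Lévy processes and to homogeneous scattered measures, which
is collected in `IsHomogeneous`.

*Existence.* The laws prescribed by the formula are consistent, so Kolmogorov's extension theorem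
(`exists_isProjectiveLimit`) provides the process.
-/

namespace SetIndexed

/-! ### Infinitely divisible laws and their exponents -/

theorem exists_continuous_log {f : ℝ → ℂ} (hf : Continuous f) (h0 : ∀ x, f x ≠ 0)
    (h1 : f 0 = 1) : ∃ ψ : ℝ → ℂ, Continuous ψ ∧ ψ 0 = 0 ∧ ∀ x, f x = Complex.exp (ψ x) := by
  obtain ⟨F, ⟨hF0, hF⟩, -⟩ := Complex.isCoveringMapOn_exp.existsUnique_continuousMap_lifts
    (⟨f, hf⟩ : C(ℝ, ℂ)) (a₀ := 0) (e₀ := 0) (by simp [h1]) (by simpa using h0)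
  exact ⟨F, F.continuous, hF0, fun x => (congr_fun hF x).symm⟩

theorem eq_of_exp_eq {ψ χ : ℝ → ℂ} (hψ : Continuous ψ) (hχ : Continuous χ) (h0 : ψ 0 = χ 0)
    (h : ∀ x, Complex.exp (ψ x) = Complex.exp (χ x)) : ψ = χ := by
  obtain ⟨F, -, hF⟩ := Complex.isCoveringMapOn_exp.existsUnique_continuousMap_lifts
    (⟨fun x => Complex.exp (χ x), by fun_prop⟩ : C(ℝ, ℂ)) (a₀ := 0) (e₀ := χ 0) rfl
    (by simp)
  have h1 := hF ⟨ψ, hψ⟩ ⟨h0, funext h⟩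
  have h2 := hF ⟨χ, hχ⟩ ⟨rfl, rfl⟩
  exact congrArg DFunLike.coe (h1.trans h2.symm)

instance isProbabilityMeasure_convNPow (ν : Measure ℝ) [IsProbabilityMeasure ν] (n : ℕ) :
    IsProbabilityMeasure (convNPow ν n) := by
  induction n with
  | zero => rw [convNPow]; infer_instance
  | succ n ih => rw [convNPow]; infer_instance

theorem charFun_convNPow (ν : Measure ℝ) [IsProbabilityMeasure ν] (n : ℕ) (z : ℝ) :
    charFun (convNPow ν n) z = charFun ν z ^ n := by
  induction n with
  | zero => simp [convNPow, charFun_dirac]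
  | succ n ih => rw [convNPow, charFun_conv, ih, pow_succ]

/-- Symmetrising `ν` turns this into the integral of `1 - cos 2y ≤ 4 (1 - cos y)`. -/
theorem one_sub_norm_charFun_two_mul_le (ν : Measure ℝ) [IsProbabilityMeasure ν] (z : ℝ) :
    1 - ‖charFun ν (2 * z)‖ ^ 2 ≤ 4 * (1 - ‖charFun ν z‖ ^ 2) := by
  have : IsProbabilityMeasure (ν.map ((-1 : ℝ) * ·)) :=
    Measure.isProbabilityMeasure_map (by fun_prop)
  let ρ := Measure.conv ν (ν.map ((-1 : ℝ) * ·))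
  have hρ : ∀ y, ‖charFun ν y‖ ^ 2 = ∫ x, Real.cos (y * x) ∂ρ := by
    intro y
    have h1 : charFun ρ y = ((‖charFun ν y‖ ^ 2 : ℝ) : ℂ) := by
      rw [charFun_conv, charFun_map_mul, neg_one_mul, charFun_neg, Complex.mul_conj,
        Complex.normSq_eq_norm_sq]
    have h2 := congrArg Complex.re h1
    rw [Complex.ofReal_re, charFun_apply_real] at h2
    rw [← h2, ← Complex.reCLM_apply, ← ContinuousLinearMap.integral_comp_comm]
    · congr 1
      ext x
      have : (y : ℂ) * x * Complex.I = ((y * x : ℝ) : ℂ) * Complex.I := by push_cast; ring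
      rw [this, Complex.reCLM_apply, Complex.exp_ofReal_mul_I_re]
    · refine Integrable.of_bound (by fun_prop) 1 (ae_of_all _ fun x => ?_)
      have : (y : ℂ) * x * Complex.I = ((y * x : ℝ) : ℂ) * Complex.I := by push_cast; ring
      rw [this, Complex.norm_exp_ofReal_mul_I]
  have hi : ∀ y, Integrable (fun x => Real.cos (y * x)) ρ := fun y =>
    Integrable.of_bound (by fun_prop) 1 (ae_of_all _ fun x => by
      simpa using Real.abs_cos_le_one _)
  have hone : ∀ y, 1 - ‖charFun ν y‖ ^ 2 = ∫ x, (1 - Real.cos (y * x)) ∂ρ := by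
    intro y
    rw [integral_sub (integrable_const _) (hi y), hρ]
    simp
  rw [hone, hone, ← integral_const_mul]
  refine integral_mono ((integrable_const _).sub (hi _))
    (((integrable_const _).sub (hi _)).const_mul _) fun x => ?_
  have : (2 * z) * x = 2 * (z * x) := by ring
  simp only [this, Real.cos_two_mul]
  nlinarith [Real.cos_le_one (z * x), Real.neg_one_le_cos (z * x)]

theorem IsInfinitelyDivisible.charFun_two_mul_ne_zero {μ : Measure ℝ}
    (hμ : IsInfinitelyDivisible μ) {z : ℝ} (hz : charFun μ z ≠ 0) : charFun μ (2 * z) ≠ 0 := by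
  obtain ⟨n, hn⟩ := exists_pow_lt_of_lt_one (show 0 < ‖charFun μ z‖ ^ 2 by positivity)
    (show (3 / 4 : ℝ) < 1 by norm_num)
  obtain ⟨ν, hν, h⟩ := hμ.2 (n + 1) n.succ_pos
  have h1 : 3 / 4 < ‖charFun ν z‖ ^ 2 := by
    by_contra! hle
    have h2 : ‖charFun μ z‖ ^ 2 = (‖charFun ν z‖ ^ 2) ^ (n + 1) := by
      rw [← h, charFun_convNPow, norm_pow]; ring
    have h3 : (‖charFun ν z‖ ^ 2) ^ (n + 1) ≤ (3 / 4 : ℝ) ^ (n + 1) := by gcongr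
    have h4 : (3 / 4 : ℝ) ^ (n + 1) ≤ (3 / 4 : ℝ) ^ n :=
      pow_le_pow_of_le_one (by norm_num) (by norm_num) n.le_succ
    linarith
  have h2 := one_sub_norm_charFun_two_mul_le ν z
  rw [← h, charFun_convNPow]
  refine pow_ne_zero _ fun h0 => ?_
  rw [h0] at h2
  simp at h2
  linarith

theorem IsInfinitelyDivisible.charFun_ne_zero {μ : Measure ℝ}
    (hμ : IsInfinitelyDivisible μ) (z : ℝ) : charFun μ z ≠ 0 := by
  have := hμ.1
  have hcont : Tendsto (fun n : ℕ => charFun μ ((1 / 2) ^ n * z)) atTop (𝓝 1) := by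
    have h1 : Tendsto (fun n : ℕ => (1 / 2 : ℝ) ^ n * z) atTop (𝓝 0) := by
      simpa using (tendsto_pow_atTop_nhds_zero_of_lt_one (by norm_num : (0 : ℝ) ≤ 1 / 2)
        (by norm_num)).mul_const z
    have h2 : Continuous (charFun μ) := by fun_prop
    have h3 := (h2.tendsto 0).comp h1
    simpa [Function.comp_def] using h3
  obtain ⟨n, hn⟩ := (hcont.eventually_ne one_ne_zero).exists
  have key : ∀ n : ℕ, ∀ y : ℝ, charFun μ ((1 / 2) ^ n * y) ≠ 0 → charFun μ y ≠ 0 := by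
    intro n
    induction n with
    | zero => intro y; simp
    | succ n ih =>
      intro y hy
      have h1 := ih (1 / 2 * y) (by rwa [pow_succ, mul_assoc] at hy)
      have h2 := hμ.charFun_two_mul_ne_zero h1
      rwa [show 2 * (1 / 2 * y) = y by ring] at h2
  exact key n z hn

/-- Lévy's continuity theorem for sequences, in the form that provides the limit law. -/
theorem exists_charFun_eq_of_tendsto {ν : ℕ → Measure ℝ} [∀ n, IsProbabilityMeasure (ν n)]
    {f : ℝ → ℂ} (hf : ContinuousAt f 0)
    (h : ∀ z, Tendsto (fun n => charFun (ν n) z) atTop (𝓝 (f z))) :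
    ∃ ρ : Measure ℝ, IsProbabilityMeasure ρ ∧ ∀ z, charFun ρ z = f z := by
  have ht := isTightMeasureSet_of_tendsto_charFun hf h
  let ν' : ℕ → ProbabilityMeasure ℝ := fun n => ⟨ν n, inferInstance⟩
  have hc : IsCompact (closure (Set.range ν')) := by
    refine isCompact_closure_of_isTightMeasureSet ?_
    convert! ht using 1
    ext ρ
    constructor
    · rintro ⟨_, ⟨n, rfl⟩, rfl⟩
      exact ⟨n, rfl⟩
    · rintro ⟨n, rfl⟩
      exact ⟨ν' n, ⟨n, rfl⟩, rfl⟩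
  obtain ⟨ρ, -, φ, hφ, hlim⟩ := hc.tendsto_subseq (fun n => subset_closure (Set.mem_range_self n))
  refine ⟨ρ, inferInstance, fun z => ?_⟩
  have h1 := ProbabilityMeasure.tendsto_iff_tendsto_charFun.1 hlim z
  exact tendsto_nhds_unique h1 ((h z).comp hφ.tendsto_atTop)

/-- `ψ` is the exponent of a continuous convolution semigroup `(μ^t)_{t ≥ 0}` of probability
measures on `ℝ`: each `exp (t ψ)` is a characteristic function. -/
structure IsExponent (ψ : ℝ → ℂ) : Prop where
  cont : Continuous ψ
  zero : ψ 0 = 0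
  exists_law : ∀ t : ℝ, 0 ≤ t →
    ∃ ν : Measure ℝ, IsProbabilityMeasure ν ∧ ∀ z, charFun ν z = Complex.exp (t * ψ z)

/-- The continuous `n`-th root with value `1` at `0` of `exp ψ` is unique. -/
theorem charFun_eq_exp_div {ψ : ℝ → ℂ} (hψ : Continuous ψ) (h0 : ψ 0 = 0) {ν : Measure ℝ}
    [IsProbabilityMeasure ν] {n : ℕ} (hn : n ≠ 0)
    (hpow : ∀ z, charFun ν z ^ n = Complex.exp (ψ z)) (z : ℝ) :
    charFun ν z = Complex.exp (ψ z / (n : ℂ)) := by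
  obtain ⟨χ, hχ, hχ0, hχe⟩ := exists_continuous_log (f := charFun ν) (by fun_prop)
    (fun z hz => by
      have := hpow z
      rw [hz, zero_pow hn] at this
      exact Complex.exp_ne_zero _ this.symm) (by simp)
  have heq : (fun z => (n : ℂ) * χ z) = ψ := by
    refine eq_of_exp_eq (by fun_prop) hψ (by simp [hχ0, h0]) fun z => ?_
    rw [Complex.exp_nat_mul, ← hχe, hpow]
  rw [hχe, ← heq]
  congr 1
  have : (n : ℂ) ≠ 0 := by exact_mod_cast hn
  field_simp

/-- A continuous function which is the logarithm of the characteristic function of an infinitely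
divisible law is an exponent: `exp (t ψ)` is a limit of powers of the characteristic functions of
the convolution roots. -/
theorem IsInfinitelyDivisible.isExponent {μ : Measure ℝ} (hμ : IsInfinitelyDivisible μ)
    {ψ : ℝ → ℂ} (hψ : Continuous ψ) (h0 : ψ 0 = 0) (h : ∀ z, charFun μ z = Complex.exp (ψ z)) :
    IsExponent ψ := by
  have hroot : ∀ n : ℕ, ∃ ν : Measure ℝ, IsProbabilityMeasure ν ∧
      ∀ z, charFun ν z = Complex.exp (ψ z / ((n + 1 : ℕ) : ℂ)) := by
    intro n
    obtain ⟨ν, hν, hn⟩ := hμ.2 (n + 1) n.succ_pos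
    exact ⟨ν, hν, charFun_eq_exp_div hψ h0 n.succ_ne_zero fun z => by
      rw [← charFun_convNPow, hn, h]⟩
  choose ν hν hνe using hroot
  refine ⟨hψ, h0, fun t ht => ?_⟩
  refine exists_charFun_eq_of_tendsto
    (ν := fun n => convNPow (ν n) ⌊t * ((n + 1 : ℕ) : ℝ)⌋₊) (by fun_prop) fun z => ?_
  have hlim : Tendsto (fun n : ℕ => ((⌊t * ((n + 1 : ℕ) : ℝ)⌋₊ : ℝ) / ((n + 1 : ℕ) : ℝ)))
      atTop (𝓝 t) :=
    (tendsto_nat_floor_mul_div_atTop ht).comp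
      (tendsto_natCast_atTop_atTop.comp (tendsto_add_atTop_nat 1))
  have hlim' := ((Complex.continuous_ofReal.tendsto t).comp hlim).mul_const (ψ z)
  refine ((Complex.continuous_exp.tendsto _).comp hlim').congr fun n => ?_
  rw [charFun_convNPow, hνe, ← Complex.exp_nat_mul]
  simp only [Function.comp_apply]
  congr 1
  push_cast
  ring

theorem IsInfinitelyDivisible.exists_isExponent {μ : Measure ℝ} (hμ : IsInfinitelyDivisible μ) :
    ∃ ψ : ℝ → ℂ, IsExponent ψ ∧ ∀ z, charFun μ z = Complex.exp (ψ z) := by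
  have := hμ.1
  obtain ⟨ψ, hψ, h0, h⟩ := exists_continuous_log (f := charFun μ) (by fun_prop)
    hμ.charFun_ne_zero (by simp)
  exact ⟨ψ, hμ.isExponent hψ h0 h, h⟩

theorem IsExponent.isInfinitelyDivisible {ψ : ℝ → ℂ} (hψ : IsExponent ψ) {t : ℝ} (ht : 0 ≤ t)
    {μ : Measure ℝ} [IsProbabilityMeasure μ] (h : ∀ z, charFun μ z = Complex.exp (t * ψ z)) :
    IsInfinitelyDivisible μ := by
  refine ⟨inferInstance, fun n hn => ?_⟩
  obtain ⟨ν, hν, hνe⟩ := hψ.exists_law (t / n) (by positivity)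
  refine ⟨ν, hν, Measure.ext_of_charFun (funext fun z => ?_)⟩
  rw [charFun_convNPow, hνe, h, ← Complex.exp_nat_mul]
  congr 1
  have : (n : ℂ) ≠ 0 := by exact_mod_cast hn.ne'
  push_cast
  field_simp

theorem IsExponent.smul {ψ : ℝ → ℂ} (hψ : IsExponent ψ) {s : ℝ} (hs : 0 ≤ s) :
    IsExponent (fun z => s * ψ z) := by
  refine ⟨continuous_const.mul hψ.cont, by simp [hψ.zero], fun t ht => ?_⟩
  obtain ⟨ν, hν, h⟩ := hψ.exists_law (t * s) (by positivity)
  exact ⟨ν, hν, fun z => by rw [h]; push_cast; ring_nf⟩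

theorem isExponent_zero : IsExponent 0 :=
  ⟨continuous_const, rfl, fun _ _ => ⟨Measure.dirac 0, inferInstance, fun z => by
    simp [charFun_dirac]⟩⟩

theorem IsExponent.convRPow_spec {ψ : ℝ → ℂ} (hψ : IsExponent ψ) {μ : Measure ℝ}
    (h : ∀ z, charFun μ z = Complex.exp (ψ z)) {t : ℝ} (ht : 0 ≤ t) :
    IsProbabilityMeasure (convRPow μ t) ∧
      ∀ z, charFun (convRPow μ t) z = Complex.exp (t * ψ z) := by
  have hex : ∃ ν, IsConvRPow μ t ν := by
    obtain ⟨ν, hν, hνe⟩ := hψ.exists_law t ht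
    exact ⟨ν, hν, ψ, hψ.cont, hψ.zero, h, hνe⟩
  obtain ⟨hp, χ, hχ, hχ0, hχ1, hχ2⟩ := hex.choose_spec
  have heq : χ = ψ :=
    eq_of_exp_eq hχ hψ.cont (hχ0.trans hψ.zero.symm) fun z => by rw [← hχ1, h]
  rw [convRPow, dif_pos hex]
  subst heq
  exact ⟨hp, hχ2⟩

/-! ### Kolmogorov's extension theorem -/

section Kolmogorov

variable {ι : Type*} {α : ι → Type*}

/-- A sequence of closed compact cylinders with the finite intersection property has nonempty
intersection. A point of a finite intersection can be moved, in the coordinates which the cylinders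
do not see, into a fixed product of compact sets; then Tychonoff's theorem applies. -/
theorem nonempty_iInter_cylinder [∀ i, TopologicalSpace (α i)] [∀ i, T2Space (α i)]
    (I : ℕ → Finset ι) (K : ∀ n, Set (∀ i : I n, α i)) (hK : ∀ n, IsCompact (K n))
    (hne : ∀ n, (⋂ k ≤ n, cylinder (I k) (K k)).Nonempty) :
    (⋂ n, cylinder (I n) (K n)).Nonempty := by
  classical
  choose x hx using hne
  have hx' : ∀ n k, k ≤ n → (I k).restrict (x n) ∈ K k := fun n k hk =>
    (mem_cylinder _ _ _).1 (Set.mem_iInter₂.1 (hx n) k hk)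
  let Q : ∀ i, Set (α i) := fun i =>
    if h : ∃ n, i ∈ I n then (fun y => y ⟨i, Nat.find_spec h⟩) '' K (Nat.find h)
    else {x 0 i}
  have hQ : ∀ i, IsCompact (Q i) := by
    intro i
    by_cases h : ∃ n, i ∈ I n
    · simp only [Q, dif_pos h]
      exact (hK _).image (continuous_apply _)
    · simp only [Q, dif_neg h]
      exact isCompact_singleton
  have hmem : ∀ n i, (∀ h : ∃ k, i ∈ I k, Nat.find h ≤ n) → (∃ k, i ∈ I k) → x n i ∈ Q i := by
    intro n i hn h
    simp only [Q, dif_pos h]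
    exact ⟨(I (Nat.find h)).restrict (x n), hx' n _ (hn h), rfl⟩
  have hQne : ∀ i, (Q i).Nonempty := by
    intro i
    by_cases h : ∃ n, i ∈ I n
    · exact ⟨_, hmem (Nat.find h) i (fun _ => le_rfl) h⟩
    · exact ⟨x 0 i, by simp [Q, dif_neg h]⟩
  choose q hq using hQne
  let y : ℕ → ∀ i, α i := fun n i => if ∃ k ≤ n, i ∈ I k then x n i else q i
  have hyQ : ∀ n, y n ∈ Set.univ.pi Q := by
    intro n i _
    by_cases h : ∃ k ≤ n, i ∈ I k
    · simp only [y, if_pos h]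
      obtain ⟨k, hk, hi⟩ := h
      exact hmem n i (fun h => (Nat.find_min' h hi).trans hk) ⟨k, hi⟩
    · simp only [y, if_neg h]
      exact hq i
  have hyC : ∀ n k, k ≤ n → y n ∈ cylinder (I k) (K k) := by
    intro n k hk
    rw [mem_cylinder]
    convert! hx' n k hk using 1
    ext i
    exact if_pos ⟨k, hk, i.2⟩
  have hcl : ∀ n, IsClosed (cylinder (I n) (K n)) := fun n =>
    (hK n).isClosed.preimage (by fun_prop)
  have hcomp : IsCompact (Set.univ.pi Q) := isCompact_univ_pi hQ
  have hfin : ∀ n, (Set.univ.pi Q ∩ ⋂ k ≤ n, cylinder (I k) (K k)).Nonempty := fun n =>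
    ⟨y n, hyQ n, Set.mem_iInter₂.2 fun k hk => hyC n k hk⟩
  have := hcomp.inter_iInter_nonempty (fun n => cylinder (I n) (K n)) hcl (by
    intro u
    obtain ⟨N, hN⟩ := u.exists_nat_subset_range
    refine (hfin N).mono (Set.inter_subset_inter_right _ ?_)
    exact Set.subset_iInter₂ fun n hn => Set.iInter₂_subset n
      (Finset.mem_range.1 (hN hn)).le)
  exact this.mono Set.inter_subset_right

variable [∀ i, TopologicalSpace (α i)] [∀ i, PolishSpace (α i)] [∀ i, MeasurableSpace (α i)]
  [∀ i, BorelSpace (α i)] {P : ∀ J : Finset ι, Measure (∀ j : J, α j)}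
  [∀ J, IsFiniteMeasure (P J)]

theorem tendsto_projectiveFamilyContent_zero (hP : IsProjectiveMeasureFamily P)
    ⦃s : ℕ → Set (∀ i, α i)⦄ (hs : ∀ n, s n ∈ measurableCylinders α) (hanti : Antitone s)
    (hinter : ⋂ n, s n = ∅) :
    Tendsto (fun n => projectiveFamilyContent hP (s n)) atTop (𝓝 0) := by
  have hmono : Antitone fun n => projectiveFamilyContent hP (s n) := fun i j hij =>
    projectiveFamilyContent_mono hP (hs j) (hs i) (hanti hij)
  have hlim := tendsto_atTop_iInf hmono
  suffices h : ⨅ n, projectiveFamilyContent hP (s n) = 0 by rwa [h] at hlim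
  by_contra h0
  obtain ⟨δ, hδ0, hδ⟩ := ENNReal.exists_pos_sum_of_countable h0 ℕ
  choose I S hS hsS using fun n => (mem_measurableCylinders _).1 (hs n)
  have hKex : ∀ n, ∃ K ⊆ S n, IsCompact K ∧ P (I n) (S n \ K) < δ n := fun n =>
    (hS n).exists_isCompact_sdiff_lt (measure_ne_top _ _)
      (ENNReal.coe_ne_zero.2 (hδ0 n).ne')
  choose K hKS hK hKlt using hKex
  have hKm : ∀ n, MeasurableSet (K n) := fun n => (hK n).measurableSet
  have hC : ∀ n, cylinder (I n) (K n) ∈ measurableCylinders α := fun n =>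
    cylinder_mem_measurableCylinders _ _ (hKm n)
  have hdiff : ∀ n, s n \ cylinder (I n) (K n) = cylinder (I n) (S n \ K n) := fun n => by
    rw [hsS n, sdiff_cylinder_same]
  have hne : ∀ n, (⋂ k ≤ n, cylinder (I k) (K k)).Nonempty := by
    intro n
    by_contra hempty
    rw [Set.not_nonempty_iff_eq_empty] at hempty
    have hsub : s n ⊆ ⋃ k ≤ n, (s k \ cylinder (I k) (K k)) := by
      intro x hx
      by_contra hx'
      have : x ∈ ⋂ k ≤ n, cylinder (I k) (K k) := by
        refine Set.mem_iInter₂.2 fun k hk => ?_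
        by_contra hxk
        exact hx' (Set.mem_iUnion₂.2 ⟨k, hk, hanti hk hx, hxk⟩)
      rw [hempty] at this
      exact this
    have hd : ∀ k, s k \ cylinder (I k) (K k) ∈ measurableCylinders α := fun k =>
      sdiff_mem_measurableCylinders (hs k) (hC k)
    have hU : (⋃ k ≤ n, (s k \ cylinder (I k) (K k))) ∈ measurableCylinders α := by
      have : (⋃ k ≤ n, (s k \ cylinder (I k) (K k))) =
          ⋃ k ∈ Finset.range (n + 1), (s k \ cylinder (I k) (K k)) := by
        simp
      rw [this]
      exact isSetRing_measurableCylinders.biUnion_mem _ fun k _ => hd k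
    have h1 := (projectiveFamilyContent_mono hP (hs n) hU hsub).trans
      (projectiveFamilyContent_iUnion_le hP hd n)
    have h2 : ∑ k ∈ Finset.range (n + 1),
        projectiveFamilyContent hP (s k \ cylinder (I k) (K k)) ≤ ∑' k, (δ k : ENNReal) := by
      refine (Finset.sum_le_sum fun k _ => ?_).trans (ENNReal.sum_le_tsum (Finset.range (n + 1)))
      rw [hdiff, projectiveFamilyContent_cylinder hP ((hS k).diff (hKm k))]
      exact (hKlt k).le
    exact absurd ((iInf_le _ n).trans (h1.trans h2)) (not_le.2 hδ)
  obtain ⟨x, hx⟩ := nonempty_iInter_cylinder I K hK hne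
  have : x ∈ ⋂ n, s n := by
    refine Set.mem_iInter.2 fun n => ?_
    rw [hsS n, mem_cylinder]
    exact hKS n ((mem_cylinder _ _ _).1 (Set.mem_iInter.1 hx n))
  rw [hinter] at this
  exact this

/-- **Kolmogorov's extension theorem**: a projective family of finite measures on finite products
of Polish spaces has a projective limit. -/
theorem exists_isProjectiveLimit (hP : IsProjectiveMeasureFamily P) :
    ∃ Q : Measure (∀ i, α i), IsProjectiveLimit Q P := by
  have hσ : (projectiveFamilyContent hP).IsSigmaSubadditive := by
    refine isSigmaSubadditive_of_addContent_iUnion_eq_tsum isSetRing_measurableCylinders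
      fun f hf hf_Union hf' => ?_
    exact addContent_iUnion_eq_sum_of_tendsto_zero isSetRing_measurableCylinders _
      (fun s _ => projectiveFamilyContent_ne_top hP)
      (tendsto_projectiveFamilyContent_zero hP) hf hf_Union hf'
  refine ⟨(projectiveFamilyContent hP).measure isSetSemiring_measurableCylinders
    generateFrom_measurableCylinders.ge hσ, fun J => ?_⟩
  ext s hs
  rw [Measure.map_apply (Finset.measurable_restrict J) hs, AddContent.measure_eq, ← cylinder,
    projectiveFamilyContent_cylinder hP hs]
  · exact generateFrom_measurableCylinders.symm
  · exact cylinder_mem_measurableCylinders _ _ hs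

end Kolmogorov

/-! ### Convergence in probability and series of independent variables -/

section Convergence

variable {Ω : Type*} [MeasurableSpace Ω] {P : Measure Ω} [IsProbabilityMeasure P]

theorem tendstoInMeasure_zero_of_tendsto_charFun {Y : ℕ → Ω → ℝ} (hY : ∀ n, Measurable (Y n))
    (h : ∀ z, Tendsto (fun n => charFun (P.map (Y n)) z) atTop (𝓝 1)) :
    TendstoInMeasure P Y atTop (fun _ => 0) := by
  have hp : ∀ n, IsProbabilityMeasure (P.map (Y n)) := fun n =>
    Measure.isProbabilityMeasure_map (hY n).aemeasurable
  rw [tendstoInMeasure_iff_measureReal_norm]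
  intro ε hε
  have hr : 0 < ε / 2 := by positivity
  have hint : Tendsto (fun n => ∫ t in (-2 * (ε / 2)⁻¹)..(2 * (ε / 2)⁻¹),
      1 - charFun (P.map (Y n)) t) atTop
      (𝓝 (∫ t in (-2 * (ε / 2)⁻¹)..(2 * (ε / 2)⁻¹), (0 : ℂ))) := by
    refine intervalIntegral.tendsto_integral_filter_of_dominated_convergence (fun _ => 2)
      (.of_forall fun n => ?_) (.of_forall fun n => ae_of_all _ fun t _ => ?_)
      (by simp) (ae_of_all _ fun t _ => ?_)
    · exact (Continuous.aestronglyMeasurable (by fun_prop))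
    · exact norm_one_sub_charFun_le_two
    · simpa using (h t).const_sub 1
  rw [intervalIntegral.integral_zero] at hint
  have hb := (hint.norm).const_mul (2⁻¹ * (ε / 2))
  rw [norm_zero, mul_zero] at hb
  refine squeeze_zero (fun n => measureReal_nonneg) (fun n => ?_) hb
  refine le_trans ?_ (measureReal_abs_gt_le_integral_charFun (μ := P.map (Y n)) hr)
  rw [map_measureReal_apply (hY n) (measurableSet_lt measurable_const (by fun_prop))]
  refine measureReal_mono fun ω hω => ?_
  simp only [Set.mem_ofPred_eq, sub_zero, Real.norm_eq_abs] at hω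
  simp only [Set.mem_preimage, Set.mem_ofPred_eq]
  linarith

theorem tendsto_charFun_of_tendstoInMeasure {Y : ℕ → Ω → ℝ} {Y' : Ω → ℝ}
    (hY : ∀ n, Measurable (Y n)) (h : TendstoInMeasure P Y atTop Y')
    (z : ℝ) : Tendsto (fun n => charFun (P.map (Y n)) z) atTop (𝓝 (charFun (P.map Y') z)) :=
  ProbabilityMeasure.tendsto_iff_tendsto_charFun.1
    (h.tendstoInDistribution (fun n => (hY n).aemeasurable) ).tendsto z

/-- **Ottaviani's inequality** for partial sums of independent variables. -/
theorem ottaviani {X : ℕ → Ω → ℝ} (hX : ∀ n, Measurable (X n)) (hind : iIndepFun X P)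
    {a δ : ℝ} (N : ℕ)
    (hδ : ∀ k ≤ N, P.real {ω | a < |∑ i ∈ Finset.Ico k N, X i ω|} ≤ δ) :
    (1 - δ) * P.real {ω | ∃ k ≤ N, 2 * a < |∑ i ∈ Finset.range k, X i ω|} ≤ δ := by
  let S : ℕ → Ω → ℝ := fun k ω => ∑ i ∈ Finset.range k, X i ω
  have hS : ∀ k, Measurable (S k) := fun k => Finset.measurable_sum _ fun i _ => hX i
  -- the event that `2 a` is first exceeded at time `k`
  let A : ℕ → Set Ω := fun k => {ω | 2 * a < |S k ω| ∧ ∀ j < k, |S j ω| ≤ 2 * a}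
  let D : ℕ → Set Ω := fun k => {ω | |∑ i ∈ Finset.Ico k N, X i ω| ≤ a}
  have hA : ∀ k, MeasurableSet (A k) := by
    intro k
    have : A k = {ω | 2 * a < |S k ω|} ∩ ⋂ j ∈ Finset.range k, {ω | |S j ω| ≤ 2 * a} := by
      ext ω; simp [A]
    rw [this]
    exact (measurableSet_lt measurable_const (hS k).norm).inter
      (Finset.measurableSet_biInter _ fun j _ => measurableSet_le (hS j).norm measurable_const)
  have hD : ∀ k, MeasurableSet (D k) := fun k => measurableSet_le
    (Finset.measurable_sum _ fun i _ => hX i).norm measurable_const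
  have hdisj : ∀ i j, i < j → Disjoint (A i) (A j) := by
    intro i j hij
    rw [Set.disjoint_left]
    rintro ω ⟨h1, -⟩ ⟨-, h2⟩
    exact absurd (h2 i hij) (not_le.2 h1)
  have hdisj' : Pairwise (Function.onFun Disjoint A) := by
    intro i j hij
    rcases lt_or_gt_of_ne hij with h | h
    · exact hdisj i j h
    · exact (hdisj j i h).symm
  have hunion : {ω | ∃ k ≤ N, 2 * a < |∑ i ∈ Finset.range k, X i ω|} =
      ⋃ k ∈ Finset.range (N + 1), A k := by
    ext ω
    simp only [Set.mem_ofPred_eq, Set.mem_iUnion, Finset.mem_range]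
    constructor
    · rintro ⟨k, hk, hlt⟩
      classical
      have hex : ∃ k, 2 * a < |S k ω| := ⟨k, hlt⟩
      refine ⟨Nat.find hex, ?_, Nat.find_spec hex, fun j hj => not_lt.1 (Nat.find_min hex hj)⟩
      exact Nat.lt_succ_of_le ((Nat.find_min' hex hlt).trans hk)
    · rintro ⟨k, hk, h, -⟩
      exact ⟨k, Nat.le_of_lt_succ hk, h⟩
  have hindep : ∀ k, P.real (A k ∩ D k) = P.real (A k) * P.real (D k) := by
    intro k
    have hi := hind.indepFun_finset (Finset.range k) (Finset.Ico k N)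
      (Finset.disjoint_left.2 fun i h1 h2 => by
        have := Finset.mem_range.1 h1
        have := (Finset.mem_Ico.1 h2).1
        omega) hX
    let s : ℕ → (Finset.range k → ℝ) → ℝ := fun j y => ∑ i, if i.1 < j then y i else 0
    have hs : ∀ j, Measurable (s j) := fun j => Finset.measurable_sum _ fun i _ => by
      by_cases h : i.1 < j
      · simpa [h] using measurable_pi_apply i
      · simp [h]
    have hsS : ∀ j ≤ k, ∀ ω, s j (fun i => X i ω) = S j ω := by
      intro j hj ω
      simp only [s, S]
      rw [Finset.sum_coe_sort (Finset.range k) (fun i => if i < j then X i ω else 0),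
        ← Finset.sum_filter]
      refine Finset.sum_congr ?_ fun _ _ => rfl
      ext i
      simp only [Finset.mem_filter, Finset.mem_range]
      omega
    let B : Set (Finset.range k → ℝ) :=
      {y | 2 * a < |s k y|} ∩ ⋂ j ∈ Finset.range k, {y | |s j y| ≤ 2 * a}
    have hB : MeasurableSet B := (measurableSet_lt measurable_const (hs k).norm).inter
      (Finset.measurableSet_biInter _ fun j _ => measurableSet_le (hs j).norm measurable_const)
    let E : Set (Finset.Ico k N → ℝ) := {y | |∑ i, y i| ≤ a}
    have hE : MeasurableSet E := measurableSet_le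
      (Finset.measurable_sum _ fun i _ => measurable_pi_apply i).norm measurable_const
    have hAB : A k = (fun ω (i : Finset.range k) => X i ω) ⁻¹' B := by
      ext ω
      simp only [A, B, Set.mem_ofPred_eq, Set.mem_preimage, Set.mem_inter_iff, Set.mem_iInter,
        Finset.mem_range]
      rw [hsS k le_rfl]
      exact and_congr_right fun _ => forall₂_congr fun j hj => by rw [hsS j hj.le]
    have hDE : D k = (fun ω (i : Finset.Ico k N) => X i ω) ⁻¹' E := by
      ext ω
      simp only [D, E, Set.mem_ofPred_eq, Set.mem_preimage]
      rw [Finset.sum_coe_sort (Finset.Ico k N) (fun i => X i ω)]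
    rw [hAB, hDE]
    simp only [measureReal_def]
    rw [hi.measure_inter_preimage_eq_mul _ _ hB hE, ENNReal.toReal_mul]
  have hDge : ∀ k ≤ N, 1 - δ ≤ P.real (D k) := by
    intro k hk
    have hc : (D k)ᶜ = {ω | a < |∑ i ∈ Finset.Ico k N, X i ω|} := by
      ext ω; simp [D]
    have := probReal_compl_eq_one_sub (μ := P) (hD k)
    rw [hc] at this
    linarith [hδ k hk]
  have hsub : (⋃ k ∈ Finset.range (N + 1), (A k ∩ D k)) ⊆
      {ω | a < |∑ i ∈ Finset.Ico 0 N, X i ω|} := by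
    intro ω hω
    simp only [Set.mem_iUnion, Finset.mem_range] at hω
    obtain ⟨k, hk, ⟨h1, -⟩, h2⟩ := hω
    have h3 : S k ω + ∑ i ∈ Finset.Ico k N, X i ω = ∑ i ∈ Finset.range N, X i ω :=
      Finset.sum_range_add_sum_Ico _ (Nat.le_of_lt_succ hk)
    simp only [Set.mem_ofPred_eq] at h2 ⊢
    rw [← Finset.range_eq_Ico, ← h3]
    have h2' : |∑ i ∈ Finset.Ico k N, X i ω| ≤ a := h2
    have := abs_sub_abs_le_abs_sub (S k ω) (-∑ i ∈ Finset.Ico k N, X i ω)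
    rw [abs_neg, sub_neg_eq_add] at this
    linarith
  calc (1 - δ) * P.real {ω | ∃ k ≤ N, 2 * a < |∑ i ∈ Finset.range k, X i ω|}
      = ∑ k ∈ Finset.range (N + 1), (1 - δ) * P.real (A k) := by
        rw [hunion, measureReal_biUnion_finset (fun i _ j _ h => hdisj' h) (fun k _ => hA k),
          Finset.mul_sum]
    _ ≤ ∑ k ∈ Finset.range (N + 1), P.real (A k ∩ D k) := by
        refine Finset.sum_le_sum fun k hk => ?_
        rw [hindep, mul_comm]
        exact mul_le_mul_of_nonneg_left
          (hDge k (Nat.le_of_lt_succ (Finset.mem_range.1 hk))) measureReal_nonneg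
    _ = P.real (⋃ k ∈ Finset.range (N + 1), (A k ∩ D k)) := by
        rw [measureReal_biUnion_finset (fun i _ j _ h =>
          (hdisj' h).mono Set.inter_subset_left Set.inter_subset_left)
          (fun k _ => (hA k).inter (hD k))]
    _ ≤ P.real {ω | a < |∑ i ∈ Finset.Ico 0 N, X i ω|} := measureReal_mono hsub
    _ ≤ δ := hδ 0 (Nat.zero_le _)

/-- A series of independent variables which converges in probability converges almost surely. -/
theorem ae_tendsto_of_tendstoInMeasure_of_iIndepFun {X : ℕ → Ω → ℝ} {Y : Ω → ℝ}
    (hX : ∀ n, Measurable (X n)) (hind : iIndepFun X P)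
    (h : TendstoInMeasure P (fun n ω => ∑ i ∈ Finset.range n, X i ω) atTop Y) :
    ∀ᵐ ω ∂P, Tendsto (fun n => ∑ i ∈ Finset.range n, X i ω) atTop (𝓝 (Y ω)) := by
  let S : ℕ → Ω → ℝ := fun k ω => ∑ i ∈ Finset.range k, X i ω
  have hS : ∀ k, Measurable (S k) := fun k => Finset.measurable_sum _ fun i _ => hX i
  have hcauchy : ∀ ε > 0, ∀ δ > 0, ∃ M, ∀ k ≥ M, ∀ n ≥ M,
      P.real {ω | ε < |S n ω - S k ω|} ≤ δ := by
    intro ε hε δ hδ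
    have h1 := tendstoInMeasure_iff_measureReal_norm.1 h (ε / 2) (by positivity)
    obtain ⟨M, hM⟩ := eventually_atTop.1 (h1.eventually (gt_mem_nhds (half_pos hδ)))
    refine ⟨M, fun k hk n hn => ?_⟩
    have hsub : {ω | ε < |S n ω - S k ω|} ⊆
        {ω | ε / 2 ≤ ‖S n ω - Y ω‖} ∪ {ω | ε / 2 ≤ ‖S k ω - Y ω‖} := by
      intro ω hω
      by_contra hc
      simp only [Set.mem_union, Set.mem_ofPred_eq, not_or, not_le, Real.norm_eq_abs] at hc hω
      have := abs_sub_le (S n ω) (Y ω) (S k ω)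
      rw [abs_sub_comm (Y ω)] at this
      linarith [hc.1, hc.2]
    have h2 := (measureReal_mono (μ := P) hsub).trans (measureReal_union_le _ _)
    linarith [hM k hk, hM n hn]
  have hbad : ∀ ε > 0, ∀ᵐ ω ∂P, ∃ M, ∀ k, |S (M + k) ω - S M ω| ≤ 2 * ε := by
    intro ε hε
    have hle : ∀ δ > 0, δ ≤ 1 / 2 →
        P {ω | ¬ ∃ M, ∀ k, |S (M + k) ω - S M ω| ≤ 2 * ε} ≤ ENNReal.ofReal (2 * δ) := by
      intro δ hδ hδ2
      obtain ⟨M, hM⟩ := hcauchy ε hε δ hδ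
      have hsum : ∀ k ω, S (M + k) ω - S M ω = ∑ i ∈ Finset.range k, X (M + i) ω := by
        intro k ω
        simp only [S]
        rw [Finset.sum_range_add, add_sub_cancel_left]
      let E : ℕ → Set Ω := fun N =>
        {ω | ∃ k ≤ N, 2 * ε < |∑ i ∈ Finset.range k, X (M + i) ω|}
      have hE : ∀ N, P (E N) ≤ ENNReal.ofReal (2 * δ) := by
        intro N
        have hO := ottaviani (P := P) (X := fun i => X (M + i)) (fun i => hX _)
          (hind.precomp (fun _ _ h => Nat.add_left_cancel h)) (a := ε) (δ := δ) N (by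
            intro k hk
            refine le_trans (le_of_eq ?_) (hM (M + k) (by omega) (M + N) (by omega))
            congr 1
            ext ω
            have : S (M + N) ω - S (M + k) ω = ∑ i ∈ Finset.Ico k N, X (M + i) ω := by
              rw [Finset.sum_Ico_eq_sub _ hk, ← hsum, ← hsum]; ring
            simp only [Set.mem_ofPred_eq, this])
        rw [← ofReal_measureReal]
        refine ENNReal.ofReal_le_ofReal ?_
        have h0 : (0 : ℝ) ≤ P.real (E N) := measureReal_nonneg
        have hO' : (1 - δ) * P.real (E N) ≤ δ := hO
        nlinarith
      have hmono : Monotone E := fun N N' hN ω ⟨k, hk, hlt⟩ => ⟨k, hk.trans hN, hlt⟩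
      have hsub : {ω | ¬ ∃ M, ∀ k, |S (M + k) ω - S M ω| ≤ 2 * ε} ⊆ ⋃ N, E N := by
        intro ω hω
        simp only [Set.mem_ofPred_eq, not_exists, not_forall, not_le] at hω
        obtain ⟨k, hk⟩ := hω M
        rw [hsum] at hk
        exact Set.mem_iUnion.2 ⟨k, k, le_rfl, hk⟩
      refine (measure_mono hsub).trans ?_
      rw [hmono.measure_iUnion]
      exact iSup_le hE
    rw [ae_iff]
    refine le_antisymm (ENNReal.le_of_forall_pos_le_add fun η hη _ => ?_) zero_le
    rw [zero_add]
    refine (hle (min (η / 2) (1 / 2)) (by positivity) (min_le_right _ _)).trans ?_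
    rw [← ENNReal.ofReal_coe_nnreal]
    refine ENNReal.ofReal_le_ofReal ?_
    have := min_le_left ((η : ℝ) / 2) (1 / 2)
    linarith
  have hall : ∀ᵐ ω ∂P, ∀ n : ℕ, ∃ M, ∀ k, |S (M + k) ω - S M ω| ≤ 2 * (1 / ((n : ℝ) + 1)) :=
    ae_all_iff.2 fun n => hbad _ (by positivity)
  obtain ⟨ns, hns, hsub⟩ := h.exists_seq_tendsto_ae
  filter_upwards [hall, hsub] with ω h1 h2
  have hc : CauchySeq fun n => S n ω := by
    rw [Metric.cauchySeq_iff']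
    intro ε hε
    obtain ⟨n, hn⟩ := exists_nat_one_div_lt (show 0 < ε / 2 by positivity)
    obtain ⟨M, hM⟩ := h1 n
    refine ⟨M, fun k hk => ?_⟩
    obtain ⟨j, rfl⟩ := Nat.exists_eq_add_of_le hk
    rw [Real.dist_eq]
    linarith [hM j]
  obtain ⟨l, hl⟩ := cauchySeq_tendsto_of_complete hc
  rwa [tendsto_nhds_unique h2 (hl.comp hns.tendsto_atTop)]

end Convergence

/-! ### The geometry of an indexing collection -/

namespace IndexingCollection

section Topological

variable {T : Type u} [TopologicalSpace T] (𝒜 : IndexingCollection T)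

theorem inter_mem {A A' : Set T} (hA : A ∈ 𝒜.sets) (hA' : A' ∈ 𝒜.sets) : A ∩ A' ∈ 𝒜.sets := by
  have := 𝒜.sInter_mem {A, A'} ⟨A, by simp⟩ (by
    rintro B (rfl | rfl)
    · exact hA
    · exact hA')
  rwa [Set.sInter_pair] at this

theorem isCompact_B (n : ℕ) : IsCompact (𝒜.B n) := by
  obtain ⟨F, hF, hB⟩ := 𝒜.B_mem n
  rw [hB]
  exact F.finite_toSet.isCompact_sUnion fun A hA => 𝒜.isCompact A (hF hA)

theorem exists_subset_B {K : Set T} (hK : IsCompact K) : ∃ n, K ⊆ 𝒜.B n := by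
  obtain ⟨n, hn⟩ := hK.elim_directed_cover (fun n => interior (𝒜.B n))
    (fun n => isOpen_interior) (by rw [𝒜.iUnion_interior_B]; exact Set.subset_univ _)
    (Monotone.directed_le fun i j hij => interior_mono (𝒜.B_mono hij))
  exact ⟨n, hn.trans interior_subset⟩

theorem sigmaCompactSpace {T : Type*} [TopologicalSpace T] (𝒜 : IndexingCollection T) :
    SigmaCompactSpace T := by
  refine ⟨⟨𝒜.B, 𝒜.isCompact_B, Set.eq_univ_of_univ_subset ?_⟩⟩
  rw [← 𝒜.iUnion_interior_B]
  exact Set.iUnion_mono fun n => interior_subset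

theorem minimalSet_subset {A : Set T} (hA : A ∈ 𝒜.sets) (hne : A.Nonempty) :
    𝒜.minimalSet ⊆ A :=
  Set.sInter_subset_of_mem ⟨hA, hne.ne_empty⟩

theorem minimalSet_nonempty [T2Space T] [Nonempty T] : 𝒜.minimalSet.Nonempty := by
  obtain ⟨x⟩ := ‹Nonempty T›
  have hx : x ∈ ⋃ n, interior (𝒜.B n) := by rw [𝒜.iUnion_interior_B]; trivial
  obtain ⟨n, hn⟩ := Set.mem_iUnion.1 hx
  obtain ⟨F, hF, hB⟩ := 𝒜.B_mem n
  have hxB := interior_subset hn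
  rw [hB] at hxB
  obtain ⟨A₀, hA₀, hxA₀⟩ := hxB
  have : Nonempty ↥(𝒜.sets \ {∅}) := ⟨⟨A₀, hF hA₀, (Set.nonempty_of_mem hxA₀).ne_empty⟩⟩
  rw [minimalSet, Set.sInter_eq_iInter]
  refine IsCompact.nonempty_iInter_of_directed_nonempty_isCompact_isClosed _ ?_
    (fun A => Set.nonempty_iff_ne_empty.2 A.2.2) (fun A => 𝒜.isCompact A A.2.1)
    (fun A => (𝒜.isCompact A A.2.1).isClosed)
  rintro ⟨A, hA, hAne⟩ ⟨A', hA', hAne'⟩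
  exact ⟨⟨A ∩ A', 𝒜.inter_mem hA hA', (𝒜.inter_nonempty A hA A' hA'
    (Set.nonempty_iff_ne_empty.2 hAne) (Set.nonempty_iff_ne_empty.2 hAne')).ne_empty⟩,
    Set.inter_subset_left, Set.inter_subset_right⟩

/-- There are no gaps in `𝒜`: otherwise the approximations `gₙ(A)` from above would show that `A`
is relatively open in the connected set `A'`. -/
theorem exists_between [T2Space T] {A A' : Set T} (hA : A ∈ 𝒜.sets) (hA' : A' ∈ 𝒜.sets)
    (hne : A.Nonempty) (hss : A ⊂ A') : ∃ C ∈ 𝒜.sets, A ⊂ C ∧ C ⊂ A' := by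
  obtain ⟨𝒜n, g, -, -, -, -, -, -, -, -, -, hint, hanti, hInter, hmem, -, -⟩ := 𝒜.separable
  by_contra! hno
  obtain ⟨x, hxA', hxA⟩ := Set.exists_of_ssubset hss
  have hxg : ∃ n, x ∉ g n A := by
    by_contra! h
    rw [hInter A hA] at hxA
    exact hxA (Set.mem_iInter.2 h)
  obtain ⟨n, hn⟩ := hxg
  have hsub : A ⊆ g n A ∩ A' :=
    Set.subset_inter ((hint n A hA).trans interior_subset) hss.subset
  have hssub : g n A ∩ A' ⊂ A' :=
    ⟨Set.inter_subset_right, fun h => hn (h hxA').1⟩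
  have heq : g n A ∩ A' = A := by
    by_contra hne'
    exact hno _ (hmem n A hA A' hA')
      ⟨hsub, fun h => hne' (Set.Subset.antisymm h hsub)⟩ hssub
  have hpre := 𝒜.isPreconnected A' hA'
  obtain ⟨y, hyA', h1, h2⟩ := hpre (interior (g n A)) Aᶜ isOpen_interior
    (𝒜.isCompact A hA).isClosed.isOpen_compl (by
      intro y _
      by_cases hy : y ∈ A
      · exact Or.inl (hint n A hA hy)
      · exact Or.inr hy)
    (by
      obtain ⟨y, hy⟩ := hne
      exact ⟨y, hss.subset hy, hint n A hA hy⟩)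
    ⟨x, hxA', hxA⟩
  have : y ∈ g n A ∩ A' := ⟨interior_subset h1, hyA'⟩
  rw [heq] at this
  exact h2 this

/-- If `(U k)` converges to `A` then it is eventually contained in any compact neighbourhood `K` of
`A`: a connected set that meets `A` and leaves `K` meets the frontier of `K`, which does not
intersect the upper limit `A`. -/
theorem eventually_subset_of_limit [T2Space T] [LocallyCompactSpace T] (U : ℕ → 𝒜.sets)
    (A : 𝒜.sets) (hAne : (A : Set T).Nonempty)
    (h1 : closure (⋃ n, ⋂ k ≥ n, (U k : Set T)) = A)
    (h2 : ⋂ n, closure (⋃ k ≥ n, (U k : Set T)) = A) :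
    ∃ K : Set T, IsCompact K ∧ ∀ᶠ n in atTop, (U n : Set T) ⊆ K := by
  obtain ⟨K, hK, hAK⟩ := exists_compact_superset (𝒜.isCompact A A.2)
  refine ⟨K, hK, ?_⟩
  have hne : (⋃ n, ⋂ k ≥ n, (U k : Set T)).Nonempty := by
    rw [← closure_nonempty_iff, h1]; exact hAne
  obtain ⟨x, hx⟩ := hne
  obtain ⟨N, hxN⟩ := Set.mem_iUnion.1 hx
  have hxA : x ∈ (A : Set T) := h1 ▸ subset_closure hx
  by_contra hcon
  have hfreq : ∃ᶠ n in atTop, ¬ (U n : Set T) ⊆ K := not_eventually.1 hcon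
  have hfr : ∀ n, (frontier K ∩ closure (⋃ k ≥ n, (U k : Set T))).Nonempty := by
    intro n
    obtain ⟨k, hk, hkK⟩ := frequently_atTop.1 hfreq (max n N)
    obtain ⟨y, hyU, hyK⟩ := Set.not_subset.1 hkK
    have hxU : x ∈ (U k : Set T) := Set.mem_iInter₂.1 hxN k (le_trans (le_max_right _ _) hk)
    obtain ⟨z, hzU, hzf⟩ : ((U k : Set T) ∩ frontier K).Nonempty := by
      by_contra hempty
      rw [Set.not_nonempty_iff_eq_empty] at hempty
      obtain ⟨z, hz, hz1, hz2⟩ := 𝒜.isPreconnected _ (U k).2 (interior K) Kᶜ isOpen_interior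
        hK.isClosed.isOpen_compl (by
          intro z hz
          by_cases hzi : z ∈ interior K
          · exact Or.inl hzi
          · refine Or.inr fun hzK => ?_
            have : z ∈ (U k : Set T) ∩ frontier K := ⟨hz, subset_closure hzK, hzi⟩
            rw [hempty] at this
            exact this)
        ⟨x, hxU, hAK hxA⟩ ⟨y, hyU, hyK⟩
      exact hz2 (interior_subset hz1)
    exact ⟨z, hzf, subset_closure (Set.mem_iUnion₂.2 ⟨k, (le_max_left _ _).trans hk, hzU⟩)⟩
  have hfc : IsCompact (frontier K) := hK.of_isClosed_subset isClosed_frontier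
    hK.isClosed.frontier_subset
  obtain ⟨z, hz⟩ := IsCompact.nonempty_iInter_of_sequence_nonempty_isCompact_isClosed
    (fun n => frontier K ∩ closure (⋃ k ≥ n, (U k : Set T)))
    (fun n => Set.inter_subset_inter_right _ (closure_mono (Set.iUnion₂_subset fun k hk =>
      Set.subset_iUnion₂_of_subset k (by omega) subset_rfl)))
    hfr (hfc.inter_right isClosed_closure) (fun n => isClosed_frontier.inter isClosed_closure)
  have hzf : z ∈ frontier K := (Set.mem_iInter.1 hz 0).1
  have hzA : z ∈ (A : Set T) := by
    rw [← h2]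
    exact Set.mem_iInter.2 fun n => (Set.mem_iInter.1 hz n).2
  exact hzf.2 (hAK hzA)

theorem measure_lt_top [MeasurableSpace T] (m : Measure T) [IsFiniteMeasureOnCompacts m]
    (U : 𝒜.sets) : m (U : Set T) < ⊤ := (𝒜.isCompact U U.2).measure_lt_top

theorem measure_increment_lt_top [MeasurableSpace T] (m : Measure T)
    [IsFiniteMeasureOnCompacts m] (C : 𝒜.increments) : m (C : Set T) < ⊤ := by
  obtain ⟨C, U₀, n, U, rfl⟩ := C
  exact (measure_mono Set.sdiff_subset).trans_lt (𝒜.measure_lt_top m U₀)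

end Topological

section Measure

/-- `𝒜` is closed under closures of unions of chains bounded by an element of `𝒜`; separability of
`T` reduces the chain to a sequence, along which `m` is continuous. -/
theorem closure_sUnion_chain {T : Type u} [MetricSpace T] [MeasurableSpace T]
    (𝒜 : IndexingCollection T) (m : Measure T)
    (hm : ∀ A : ℕ → Set T, (∀ i, A i ∈ 𝒜.sets) → Monotone A →
      closure (⋃ i, A i) ∈ 𝒜.sets → m (closure (⋃ i, A i)) = m (⋃ i, A i))
    {U : Set T} (hU : U ∈ 𝒜.sets) {S : Set (Set T)} (hS : S ⊆ 𝒜.sets) (hchain : IsChain (· ⊆ ·) S)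
    (hne : ∃ A ∈ S, A.Nonempty) (hSU : ∀ A ∈ S, A ⊆ U) {t : ENNReal} (ht : ∀ A ∈ S, m A ≤ t) :
    closure (⋃₀ S) ∈ 𝒜.sets ∧ m (closure (⋃₀ S)) ≤ t := by
  have := 𝒜.sigmaCompactSpace
  have : SecondCountableTopology T := inferInstance
  obtain ⟨D, hDS, hDc, hD⟩ :=
    (TopologicalSpace.IsSeparable.of_separableSpace (⋃₀ S)).exists_countable_dense_subset
  obtain ⟨A₀, hA₀, x₀, hx₀⟩ := hne
  have hDne : D.Nonempty := by
    rcases D.eq_empty_or_nonempty with rfl | h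
    · simp only [closure_empty] at hD
      exact absurd (hD ⟨A₀, hA₀, hx₀⟩) (Set.notMem_empty _)
    · exact h
  obtain ⟨x, rfl⟩ := hDc.exists_eq_range hDne
  choose A hAS hxA using fun i => hDS (Set.mem_range_self i)
  -- the running maximum of the sets `A i`
  let E : ℕ → Set T := fun n => ⋃ i ∈ Finset.range (n + 1), A i
  have hES : ∀ n, E n ∈ S := by
    intro n
    induction n with
    | zero => simpa [E] using hAS 0
    | succ n ih =>
      have : E (n + 1) = A (n + 1) ∪ E n := by
        simp only [E]
        rw [Finset.range_add_one, Finset.set_biUnion_insert]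
      rw [this]
      rcases hchain.total (hAS (n + 1)) ih with h | h
      · rwa [Set.union_eq_right.2 h]
      · rw [Set.union_eq_left.2 h]; exact hAS _
  have hEmono : Monotone E := fun i j hij => Set.biUnion_subset_biUnion_left fun k hk =>
    Finset.mem_coe.2 (Finset.mem_range.2 ((Finset.mem_range.1 hk).trans_le (by omega)))
  have hcl : closure (⋃ n, E n) = closure (⋃₀ S) := by
    refine Set.Subset.antisymm
      (closure_mono (Set.iUnion_subset fun n => Set.subset_sUnion_of_mem (hES n))) ?_
    refine closure_minimal (hD.trans (closure_mono ?_)) isClosed_closure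
    rintro _ ⟨i, rfl⟩
    exact Set.mem_iUnion.2 ⟨i, Set.mem_biUnion (Finset.self_mem_range_succ i) (hxA i)⟩
  obtain ⟨n, hn⟩ := 𝒜.exists_subset_B (𝒜.isCompact U hU)
  have hmem := 𝒜.closure_iUnion_mem E (fun i => hS (hES i)) hEmono
    ⟨n, fun i => (hSU _ (hES i)).trans hn⟩
  have hmeas := hm E (fun i => hS (hES i)) hEmono hmem
  rw [← hcl]
  refine ⟨hmem, ?_⟩
  rw [hmeas, hEmono.measure_iUnion]
  exact iSup_le fun i => ht _ (hES i)

variable {T : Type u} [MetricSpace T] [MeasurableSpace T]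
  (𝒜 : IndexingCollection T) (m : Measure T) [m.Regular]

/-- `m` takes on subsets `A ∈ 𝒜` of `U` all values between `0` and `m U`. Zorn's lemma gives a
maximal `A₁ ⊆ U` with `m A₁ ≤ t` and then a minimal `A₂` with `A₁ ⊆ A₂ ⊆ U` and `t ≤ m A₂`; they
are equal, since nothing in `𝒜` lies strictly between them. -/
theorem exists_subset_measure_eq (hm₀ : m 𝒜.minimalSet = 0)
    (hm : ∀ A : ℕ → Set T, (∀ i, A i ∈ 𝒜.sets) → Monotone A →
      closure (⋃ i, A i) ∈ 𝒜.sets → m (closure (⋃ i, A i)) = m (⋃ i, A i))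
    (U : 𝒜.sets) {t : ENNReal} (ht : t ≤ m (U : Set T)) :
    ∃ A : 𝒜.sets, (A : Set T) ⊆ U ∧ m (A : Set T) = t := by
  rcases (U : Set T).eq_empty_or_nonempty with hUe | hUne
  · refine ⟨U, subset_rfl, ?_⟩
    rw [hUe, measure_empty] at ht ⊢
    exact (le_antisymm ht zero_le).symm
  have : Nonempty T := ⟨hUne.some⟩
  have hV := 𝒜.minimalSet_nonempty
  let S₁ : Set (Set T) := {A | A ∈ 𝒜.sets ∧ 𝒜.minimalSet ⊆ A ∧ A ⊆ U ∧ m A ≤ t}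
  obtain ⟨A₁, hVA₁, hmax⟩ := zorn_subset_nonempty S₁ (by
    intro c hc hchain hcne
    have h := 𝒜.closure_sUnion_chain m hm U.2 (fun A hA => (hc hA).1) hchain
      (by
        obtain ⟨A, hA⟩ := hcne
        exact ⟨A, hA, hV.mono (hc hA).2.1⟩) (fun A hA => (hc hA).2.2.1)
      (fun A hA => (hc hA).2.2.2)
    refine ⟨closure (⋃₀ c), ⟨h.1, ?_, ?_, h.2⟩, fun A hA =>
      (Set.subset_sUnion_of_mem hA).trans subset_closure⟩
    · obtain ⟨A, hA⟩ := hcne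
      exact (hc hA).2.1.trans ((Set.subset_sUnion_of_mem hA).trans subset_closure)
    · exact closure_minimal (Set.sUnion_subset fun A hA => (hc hA).2.2.1)
        (𝒜.isCompact U U.2).isClosed) 𝒜.minimalSet
    ⟨𝒜.minimalSet_mem, subset_rfl, 𝒜.minimalSet_subset U.2 hUne, by rw [hm₀]; exact zero_le⟩
  have hA₁ := hmax.prop
  let S₂ : Set (Set T) := {A | A ∈ 𝒜.sets ∧ A₁ ⊆ A ∧ A ⊆ U ∧ t ≤ m A}
  obtain ⟨A₂, hA₂U, hmin⟩ := zorn_superset_nonempty S₂ (by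
    intro c hc hchain hcne
    refine ⟨⋂₀ c, ⟨𝒜.sInter_mem c hcne fun A hA => (hc hA).1,
      Set.subset_sInter fun A hA => (hc hA).2.1, ?_, ?_⟩, fun A hA => Set.sInter_subset_of_mem hA⟩
    · obtain ⟨A, hA⟩ := hcne
      exact (Set.sInter_subset_of_mem hA).trans (hc hA).2.2.1
    · by_contra! hlt
      obtain ⟨W, hcW, hWo, hW⟩ := Set.exists_isOpen_lt_of_lt _ _ hlt
      have : Nonempty c := hcne.to_subtype
      obtain ⟨A, hA⟩ := exists_subset_nhds_of_isCompact (V := fun A : c => (A : Set T))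
        (fun A B => by
          rcases hchain.total A.2 B.2 with h | h
          · exact ⟨A, subset_rfl, h⟩
          · exact ⟨B, h, subset_rfl⟩)
        (fun A => 𝒜.isCompact A (hc A.2).1) (U := W)
        (fun x hx => hWo.mem_nhds (hcW (by rwa [Set.sInter_eq_iInter])))
      exact absurd ((hc A.2).2.2.2.trans (measure_mono hA)) (not_le.2 hW)) (U : Set T)
    ⟨U.2, hA₁.2.2.1, subset_rfl, ht⟩
  have hA₂ := hmin.prop
  have heq : A₁ = A₂ := by
    by_contra hne
    obtain ⟨C, hC, h1, h2⟩ := 𝒜.exists_between hA₁.1 hA₂.1 (hV.mono hA₁.2.1)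
      ⟨hA₂.2.1, fun h => hne (Set.Subset.antisymm hA₂.2.1 h)⟩
    rcases le_total (m C) t with h | h
    · exact h1.2 (hmax.le_of_ge ⟨hC, hA₁.2.1.trans h1.1, h2.1.trans hA₂.2.2.1, h⟩ h1.1)
    · exact h2.2 (hmin.le_of_le ⟨hC, h1.1, h2.1.trans hA₂.2.2.1, h⟩ h2.1)
  refine ⟨⟨A₁, hA₁.1⟩, hA₁.2.2.1, le_antisymm hA₁.2.2.2 ?_⟩
  have := hA₂.2.2.2
  rwa [← heq] at this

variable [BorelSpace T]

theorem measurableSet (U : 𝒜.sets) : MeasurableSet (U : Set T) :=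
  (𝒜.isCompact U U.2).measurableSet

theorem measurableSet_increment (C : 𝒜.increments) : MeasurableSet (C : Set T) := by
  obtain ⟨C, U₀, n, U, rfl⟩ := C
  exact (𝒜.measurableSet U₀).diff (MeasurableSet.iUnion fun i => 𝒜.measurableSet (U i))

variable [LocallyCompactSpace T]

/-- Convergence of a sequence in `𝒜` entails convergence in `m`-measure. -/
theorem tendsto_measure_symmDiff
    (hm : ∀ A : ℕ → Set T, (∀ i, A i ∈ 𝒜.sets) → Monotone A →
      closure (⋃ i, A i) ∈ 𝒜.sets → m (closure (⋃ i, A i)) = m (⋃ i, A i))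
    (U : ℕ → 𝒜.sets) (A : 𝒜.sets)
    (h1 : closure (⋃ n, ⋂ k ≥ n, (U k : Set T)) = A)
    (h2 : ⋂ n, closure (⋃ k ≥ n, (U k : Set T)) = A) :
    Tendsto (fun n => m ((U n : Set T) \ A)) atTop (𝓝 0) ∧
      Tendsto (fun n => m ((A : Set T) \ U n)) atTop (𝓝 0) := by
  rcases (A : Set T).eq_empty_or_nonempty with hAe | hAne
  · have hev : ∀ᶠ n in atTop, (U n : Set T) = ∅ := by
      by_contra hcon
      have hfreq : ∃ᶠ n in atTop, ¬ (U n : Set T) = ∅ := not_eventually.1 hcon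
      obtain ⟨n₀, hn₀⟩ := hfreq.exists
      have : Nonempty T := ⟨(Set.nonempty_iff_ne_empty.2 hn₀).some⟩
      obtain ⟨x, hx⟩ := 𝒜.minimalSet_nonempty
      have : x ∈ (A : Set T) := by
        rw [← h2]
        refine Set.mem_iInter.2 fun n => subset_closure ?_
        obtain ⟨k, hk, hke⟩ := frequently_atTop.1 hfreq n
        exact Set.mem_iUnion₂.2 ⟨k, hk, 𝒜.minimalSet_subset (U k).2
          (Set.nonempty_iff_ne_empty.2 hke) hx⟩
      rw [hAe] at this
      exact this
    refine ⟨tendsto_const_nhds.congr' ?_, tendsto_const_nhds.congr' ?_⟩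
    · filter_upwards [hev] with n hn
      simp [hn]
    · simp [hAe]
  · obtain ⟨K, hK, hKev⟩ := 𝒜.eventually_subset_of_limit U A hAne h1 h2
    constructor
    · let E : ℕ → Set T := fun n => (closure (⋃ k ≥ n, (U k : Set T)) ∩ K) \ A
      have hE : Antitone E := fun i j hij => Set.sdiff_subset_sdiff_left
        (Set.inter_subset_inter_left _ (closure_mono (Set.iUnion₂_subset fun k hk =>
          Set.subset_iUnion₂_of_subset k (le_trans hij hk) subset_rfl)))
      have hlim := tendsto_measure_iInter_atTop (μ := m) (s := E)
        (fun n => ((isClosed_closure.measurableSet.inter hK.measurableSet).diff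
          (𝒜.measurableSet A)).nullMeasurableSet) hE
        ⟨0, ((measure_mono (Set.sdiff_subset.trans Set.inter_subset_right)).trans_lt
          hK.measure_lt_top).ne⟩
      have hemp : ⋂ n, E n = ∅ := by
        rw [Set.eq_empty_iff_forall_notMem]
        intro x hx
        rw [Set.mem_iInter] at hx
        refine (hx 0).2 ?_
        rw [← h2]
        exact Set.mem_iInter.2 fun n => (hx n).1.1
      rw [hemp, measure_empty] at hlim
      refine tendsto_of_tendsto_of_tendsto_of_le_of_le' tendsto_const_nhds hlim
        (.of_forall fun _ => zero_le) ?_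
      filter_upwards [hKev] with n hn
      refine measure_mono (Set.sdiff_subset_sdiff_left (Set.subset_inter ?_ hn))
      exact subset_closure.trans' (Set.subset_iUnion₂_of_subset n le_rfl subset_rfl)
    · let D : ℕ → Set T := fun n => ⋂ k ≥ n, (U k : Set T)
      have hD : Monotone D := fun i j hij => Set.subset_iInter₂ fun k hk =>
        Set.iInter₂_subset k (le_trans hij hk)
      have hDm : ∀ n, D n ∈ 𝒜.sets := by
        intro n
        have := 𝒜.sInter_mem ((fun k => (U k : Set T)) '' Set.Ici n) ⟨_, n, Set.self_mem_Ici, rfl⟩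
          (by rintro _ ⟨k, -, rfl⟩; exact (U k).2)
        rw [Set.sInter_image] at this
        exact this
      have hDA : closure (⋃ n, D n) = A := h1
      have hmD := hm D hDm hD (hDA ▸ A.2)
      have hDmeas : ∀ n, MeasurableSet (D n) := fun n => 𝒜.measurableSet ⟨D n, hDm n⟩
      have hnull : m ((A : Set T) \ ⋃ n, D n) = 0 := by
        rw [measure_sdiff (hDA ▸ subset_closure)
          (MeasurableSet.iUnion hDmeas).nullMeasurableSet
          ((measure_mono (hDA ▸ subset_closure)).trans_lt (𝒜.measure_lt_top m A)).ne, ← hDA, hmD,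
          tsub_self]
      have hlim := tendsto_measure_iInter_atTop (μ := m) (s := fun n => (A : Set T) \ D n)
        (fun n => ((𝒜.measurableSet A).diff (hDmeas n)).nullMeasurableSet)
        (fun i j hij => Set.sdiff_subset_sdiff_right (hD hij))
        ⟨0, ((measure_mono Set.sdiff_subset).trans_lt (𝒜.measure_lt_top m A)).ne⟩
      rw [← Set.sdiff_iUnion, hnull] at hlim
      refine tendsto_of_tendsto_of_tendsto_of_le_of_le tendsto_const_nhds hlim
        (fun _ => zero_le) fun n => ?_
      exact measure_mono (Set.sdiff_subset_sdiff_right (Set.iInter₂_subset n le_rfl))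

end Measure

end IndexingCollection

/-! ### Linear extension of a set-indexed process -/

section Linear

variable {T : Type u} [TopologicalSpace T] {𝒜 : IndexingCollection T} {Ω : Type v}

noncomputable instance : SemilatticeInf 𝒜.sets :=
  Subtype.semilatticeInf fun _ _ hA hB => 𝒜.inter_mem hA hB

variable (𝒜) in
/-- The simple function `∑ c_U 1_U` on `T` attached to a finitely supported family `c` of
coefficients. -/
noncomputable def indicatorSum : (𝒜.sets →₀ ℝ) →ₗ[ℝ] (T → ℝ) :=
  Finsupp.linearCombination ℝ fun U : 𝒜.sets => (U : Set T).indicator 1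

/-- The random variable `∑ c_U X_U`. For a process with definite increments it depends, up to
almost sure equality, only on `∑ c_U 1_U`. -/
noncomputable def linearExtension (X : 𝒜.sets → Ω → ℝ) : (𝒜.sets →₀ ℝ) →ₗ[ℝ] (Ω → ℝ) :=
  Finsupp.linearCombination ℝ X

theorem indicatorSum_apply (c : 𝒜.sets →₀ ℝ) (x : T) :
    indicatorSum 𝒜 c x = c.sum fun U a => a * (U : Set T).indicator 1 x := by
  simp [indicatorSum, Finsupp.linearCombination_apply, Finsupp.sum, Finset.sum_apply]

theorem linearExtension_apply (X : 𝒜.sets → Ω → ℝ) (c : 𝒜.sets →₀ ℝ) (ω : Ω) :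
    linearExtension X c ω = c.sum fun U a => a * X U ω := by
  simp [linearExtension, Finsupp.linearCombination_apply, Finsupp.sum, Finset.sum_apply]

@[simp] theorem indicatorSum_single (U : 𝒜.sets) (a : ℝ) :
    indicatorSum 𝒜 (Finsupp.single U a) = a • (U : Set T).indicator 1 :=
  Finsupp.linearCombination_single _ _ _

@[simp] theorem linearExtension_single (X : 𝒜.sets → Ω → ℝ) (U : 𝒜.sets) (a : ℝ) :
    linearExtension X (Finsupp.single U a) = a • X U :=
  Finsupp.linearCombination_single _ _ _

/-- The coefficients of the inclusion-exclusion value of `U₀ \ ⋃ i, U i`. -/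
noncomputable def inclExclCoeff (U₀ : 𝒜.sets) {n : ℕ} (U : Fin n → 𝒜.sets) : 𝒜.sets →₀ ℝ :=
  Finsupp.single U₀ 1 - ∑ S : Finset (Fin n) with S.Nonempty,
    (-1 : ℝ) ^ (S.card - 1) • Finsupp.single (𝒜.interOn U₀ U S) 1

theorem linearExtension_inclExclCoeff (X : 𝒜.sets → Ω → ℝ) (U₀ : 𝒜.sets) {n : ℕ}
    (U : Fin n → 𝒜.sets) : linearExtension X (inclExclCoeff U₀ U) = inclExcl X U₀ U := by
  ext ω
  simp [inclExclCoeff, inclExcl, map_sub, map_sum, Finset.sum_apply]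

theorem indicatorSum_inclExclCoeff (U₀ : 𝒜.sets) {n : ℕ} (U : Fin n → 𝒜.sets) :
    indicatorSum 𝒜 (inclExclCoeff U₀ U) = ((U₀ : Set T) \ ⋃ i, (U i : Set T)).indicator 1 := by
  classical
  ext x
  have h1 : ∏ i, (1 - (U i : Set T).indicator (1 : T → ℝ) x) =
      ∑ S : Finset (Fin n), (-1 : ℝ) ^ S.card * ∏ i ∈ S, (U i : Set T).indicator (1 : T → ℝ) x := by
    rw [Finset.prod_sub]
    simp
  have h2 : ∑ S : Finset (Fin n), (-1 : ℝ) ^ S.card *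
        ∏ i ∈ S, (U i : Set T).indicator (1 : T → ℝ) x =
      1 - ∑ S : Finset (Fin n) with S.Nonempty, (-1 : ℝ) ^ (S.card - 1) *
        ∏ i ∈ S, (U i : Set T).indicator (1 : T → ℝ) x := by
    rw [← Finset.sum_filter_add_sum_filter_not Finset.univ (fun S => S.Nonempty), add_comm,
      sub_eq_add_neg, ← Finset.sum_neg_distrib]
    congr 1
    · have : (Finset.univ.filter fun S : Finset (Fin n) => ¬ S.Nonempty) = {∅} := by
        ext S; simp [Finset.not_nonempty_iff_eq_empty]
      rw [this]; simp
    · refine Finset.sum_congr rfl fun S hS => ?_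
      obtain ⟨k, hk⟩ := Nat.exists_eq_succ_of_ne_zero
        (Finset.card_pos.2 (Finset.mem_filter.1 hS).2).ne'
      rw [hk, Nat.succ_eq_add_one, pow_succ, Nat.add_sub_cancel]
      ring
  have h3 : ∀ S : Finset (Fin n), ((𝒜.interOn U₀ U S : 𝒜.sets) : Set T).indicator (1 : T → ℝ) x =
      (U₀ : Set T).indicator 1 x * ∏ i ∈ S, (U i : Set T).indicator (1 : T → ℝ) x := by
    intro S
    rw [IndexingCollection.interOn]
    by_cases hx : x ∈ (U₀ : Set T)
    · by_cases hS : ∀ i ∈ S, x ∈ (U i : Set T)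
      · rw [Finset.prod_congr rfl fun i hi => Set.indicator_of_mem (hS i hi) 1]
        rw [Set.indicator_of_mem (show x ∈ (U₀ : Set T) ∩ ⋂ i ∈ S, (U i : Set T) from
          ⟨hx, Set.mem_iInter₂.2 hS⟩)]
        simp [hx]
      · obtain ⟨i, hi, hxi⟩ := by simpa using hS
        rw [Finset.prod_eq_zero hi (by simp [hxi]), mul_zero, Set.indicator_of_notMem]
        rintro ⟨-, h⟩
        exact hxi (Set.mem_iInter₂.1 h i hi)
    · simp [hx]
  have h4 : ((U₀ : Set T) \ ⋃ i, (U i : Set T)).indicator (1 : T → ℝ) x =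
      (U₀ : Set T).indicator 1 x * ∏ i, (1 - (U i : Set T).indicator (1 : T → ℝ) x) := by
    by_cases hx : x ∈ (U₀ : Set T)
    · by_cases hU : ∃ i, x ∈ (U i : Set T)
      · obtain ⟨i, hi⟩ := hU
        rw [Finset.prod_eq_zero (Finset.mem_univ i) (by simp [hi]), mul_zero,
          Set.indicator_of_notMem]
        exact fun h => h.2 (Set.mem_iUnion.2 ⟨i, hi⟩)
      · push Not at hU
        rw [Finset.prod_eq_one fun i _ => by simp [hU i], mul_one]
        simp [hx, hU]
    · simp [hx]
  rw [h4, h1, h2, mul_sub, mul_one, Finset.mul_sum]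
  simp only [inclExclCoeff, map_sub, map_sum, map_smul, indicatorSum_single, Pi.sub_apply,
    Finset.sum_apply, Pi.smul_apply, smul_eq_mul, one_mul, h3]
  congr 1
  exact Finset.sum_congr rfl fun S _ => by ring

/-- The coefficients of the representation by which `increment` is computed. -/
noncomputable def incrementCoeff (C : 𝒜.increments) : 𝒜.sets →₀ ℝ :=
  inclExclCoeff C.2.choose C.2.choose_spec.choose_spec.choose

theorem linearExtension_incrementCoeff (X : 𝒜.sets → Ω → ℝ) (C : 𝒜.increments) :
    linearExtension X (incrementCoeff C) = increment X C :=
  linearExtension_inclExclCoeff X _ _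

theorem indicatorSum_incrementCoeff (C : 𝒜.increments) :
    indicatorSum 𝒜 (incrementCoeff C) = (C : Set T).indicator 1 := by
  rw [incrementCoeff, indicatorSum_inclExclCoeff,
    ← C.2.choose_spec.choose_spec.choose_spec]

variable [MeasurableSpace Ω]

theorem measurable_linearExtension {X : 𝒜.sets → Ω → ℝ} (hX : ∀ U, Measurable (X U))
    (c : 𝒜.sets →₀ ℝ) : Measurable (linearExtension X c) := by
  have : linearExtension X c = fun ω => c.sum fun U a => a * X U ω :=
    funext (linearExtension_apply X c)
  rw [this]
  exact Finset.measurable_sum _ fun U _ => (hX U).const_mul _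

theorem measurable_increment {X : 𝒜.sets → Ω → ℝ} (hX : ∀ U, Measurable (X U))
    (C : 𝒜.increments) : Measurable (increment X C) := by
  rw [← linearExtension_incrementCoeff]
  exact measurable_linearExtension hX _

/-- Definite increments mean that linear relations between the indicators of elements of `𝒜` are
inherited by the process. For the support of `c` in an intersection-closed finite class, either
the coefficient of a maximal element `U` vanishes, or `U` is covered by the smaller ones and
inclusion-exclusion removes it from the relation. -/
theorem HasDefiniteIncrements.linearExtension_ae_eq_zero {P : Measure Ω} {X : 𝒜.sets → Ω → ℝ}
    (hX : HasDefiniteIncrements P X) {c : 𝒜.sets →₀ ℝ} (hc : indicatorSum 𝒜 c = 0) :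
    linearExtension X c =ᵐ[P] 0 := by
  classical
  have key : ∀ (F : Finset 𝒜.sets), (∀ U ∈ F, ∀ V ∈ F, U ⊓ V ∈ F) → ∀ c : 𝒜.sets →₀ ℝ,
      (∀ V ∉ F, c V = 0) → indicatorSum 𝒜 c = 0 → linearExtension X c =ᵐ[P] 0 := by
    intro F
    induction F using Finset.strongInduction with
    | H F ih =>
      intro hF c hcF hc
      rcases F.eq_empty_or_nonempty with rfl | hne
      · have : c = 0 := Finsupp.ext fun V => hcF V (Finset.notMem_empty _)
        rw [this, map_zero]
      obtain ⟨U, hUmax⟩ := F.exists_maximal hne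
      have hUF : U ∈ F := hUmax.prop
      let G := F.erase U
      let W : Fin G.card → 𝒜.sets := fun i => (G.equivFin.symm i : 𝒜.sets)
      have hWG : ∀ i, W i ∈ G := fun i => (G.equivFin.symm i).2
      have hWsurj : ∀ V ∈ G, ∃ i, W i = V := fun V hV =>
        ⟨G.equivFin ⟨V, hV⟩, by simp [W]⟩
      have hne : ∀ V ∈ G, ¬ U ≤ V := fun V hV hUV =>
        (Finset.ne_of_mem_erase hV) (le_antisymm (hUmax.le_of_ge (Finset.mem_of_mem_erase hV) hUV)
          hUV)
      have hinter : ∀ S : Finset (Fin G.card), 𝒜.interOn U W S ∈ F := by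
        intro S
        induction S using Finset.induction_on with
        | empty =>
          have : 𝒜.interOn U W ∅ = U := by
            apply Subtype.ext; simp [IndexingCollection.interOn]
          rwa [this]
        | insert i S _ ihS =>
          have : 𝒜.interOn U W (insert i S) = 𝒜.interOn U W S ⊓ W i := by
            apply Subtype.ext
            simp only [IndexingCollection.interOn, Finset.set_biInter_insert]
            change _ = (((U : Set T) ∩ ⋂ i ∈ S, (W i : Set T)) ∩ (W i : Set T))
            rw [Set.inter_comm (W i : Set T), ← Set.inter_assoc]
          rw [this]
          exact hF _ ihS _ (Finset.mem_of_mem_erase (hWG i))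
      have hinterG : ∀ S : Finset (Fin G.card), S.Nonempty → 𝒜.interOn U W S ∈ G := by
        rintro S ⟨i, hi⟩
        refine Finset.mem_erase.2 ⟨fun h => hne (W i) (hWG i) ?_, hinter S⟩
        have : (𝒜.interOn U W S : Set T) ⊆ W i :=
          Set.inter_subset_right.trans (Set.iInter₂_subset i hi)
        rw [h] at this
        exact this
      have hG : ∀ V ∈ G, ∀ V' ∈ G, V ⊓ V' ∈ G := by
        intro V hV V' hV'
        refine Finset.mem_erase.2 ⟨fun h => hne V hV ?_,
          hF V (Finset.mem_of_mem_erase hV) V' (Finset.mem_of_mem_erase hV')⟩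
        rw [← h]; exact inf_le_left
      have hGF : G ⊂ F := Finset.erase_ssubset hUF
      by_cases hcov : (U : Set T) \ ⋃ i, (W i : Set T) = ∅
      · have he : linearExtension X (inclExclCoeff U W) =ᵐ[P] 0 := by
          let E : 𝒜.sets := ⟨∅, 𝒜.empty_mem⟩
          have h1 := hX U _ W E 1 (fun _ => E) (by rw [hcov]; simp [E])
          rw [linearExtension_inclExclCoeff]
          refine h1.trans (ae_of_all _ fun ω => ?_)
          have hEE : ∀ S : Finset (Fin 1), 𝒜.interOn E (fun _ => E) S = E := fun S =>
            Subtype.ext (by simp [IndexingCollection.interOn, E])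
          have hfil : (Finset.univ.filter fun S : Finset (Fin 1) => S.Nonempty) = {{0}} := by
            decide
          simp [inclExcl, hEE, hfil]
        have heV : ∀ V ∉ G, inclExclCoeff U W V = if U = V then 1 else 0 := by
          intro V hV
          rw [inclExclCoeff, Finsupp.sub_apply, Finsupp.finsetSum_apply, Finset.sum_eq_zero,
            sub_zero, Finsupp.single_apply]
          intro S hS
          rw [Finsupp.smul_apply, Finsupp.single_apply, if_neg, smul_zero]
          rintro rfl
          exact hV (hinterG S (Finset.mem_filter.1 hS).2)
        have hc' := ih G hGF hG (c - c U • inclExclCoeff U W) (by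
          intro V hV
          rw [Finsupp.sub_apply, Finsupp.smul_apply, heV V hV]
          by_cases hUV : U = V
          · subst hUV; simp
          · rw [hcF V fun hVF => hV (Finset.mem_erase.2 ⟨Ne.symm hUV, hVF⟩)]
            simp [hUV])
          (by rw [map_sub, map_smul, hc, indicatorSum_inclExclCoeff, hcov,
            Set.indicator_empty']; simp)
        filter_upwards [hc', he] with ω h1 h2
        rw [map_sub, map_smul] at h1
        simp only [Pi.sub_apply, Pi.smul_apply, h2, Pi.zero_apply, smul_zero, sub_zero] at h1
        exact h1
      · obtain ⟨x, hxU, hxW⟩ := Set.nonempty_iff_ne_empty.2 hcov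
        have hcU : c U = 0 := by
          have h1 := congr_fun hc x
          rw [indicatorSum_apply, Finsupp.sum_of_support_subset (s := F) _ (fun V hV => by
            by_contra hVF
            exact (Finsupp.mem_support_iff.1 hV) (hcF V hVF)) _ (by simp),
            Finset.sum_eq_single_of_mem U hUF] at h1
          · simpa [hxU] using h1
          · intro V hV hVU
            obtain ⟨i, rfl⟩ := hWsurj V (Finset.mem_erase.2 ⟨hVU, hV⟩)
            have : x ∉ (W i : Set T) := fun h => hxW (Set.mem_iUnion.2 ⟨i, h⟩)
            simp [this]
        refine ih G hGF hG c (fun V hV => ?_) hc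
        by_cases hUV : V = U
        · rw [hUV, hcU]
        · exact hcF V fun hVF => hV (Finset.mem_erase.2 ⟨hUV, hVF⟩)
  have hfin : (infClosure (c.support : Set 𝒜.sets)).Finite := c.support.finite_toSet.infClosure
  refine key hfin.toFinset (fun U hU V hV => ?_) c (fun V hV => ?_) hc
  · rw [Set.Finite.mem_toFinset] at hU hV ⊢
    exact infClosed_infClosure hU hV
  · by_contra h
    exact hV (hfin.mem_toFinset.2 (subset_infClosure (Finsupp.mem_support_iff.2 h)))

theorem HasDefiniteIncrements.linearExtension_ae_eq {P : Measure Ω} {X : 𝒜.sets → Ω → ℝ}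
    (hX : HasDefiniteIncrements P X) {c d : 𝒜.sets →₀ ℝ}
    (h : indicatorSum 𝒜 c = indicatorSum 𝒜 d) : linearExtension X c =ᵐ[P] linearExtension X d := by
  have := hX.linearExtension_ae_eq_zero (c := c - d) (by rw [map_sub, h, sub_self])
  filter_upwards [this] with ω hω
  rw [map_sub] at hω
  exact sub_eq_zero.1 hω

theorem hasDefiniteIncrements_of_linearExtension {P : Measure Ω} {X : 𝒜.sets → Ω → ℝ}
    (h : ∀ c : 𝒜.sets →₀ ℝ, indicatorSum 𝒜 c = 0 → linearExtension X c =ᵐ[P] 0) :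
    HasDefiniteIncrements P X := by
  intro U₀ n U V₀ k V hUV
  have := h (inclExclCoeff U₀ U - inclExclCoeff V₀ V) (by
    rw [map_sub, indicatorSum_inclExclCoeff, indicatorSum_inclExclCoeff, hUV, sub_self])
  filter_upwards [this] with ω hω
  rw [map_sub, linearExtension_inclExclCoeff, linearExtension_inclExclCoeff] at hω
  exact sub_eq_zero.1 hω

end Linear

/-! ### Integrals of functions of indicator sums -/

section Integral

variable {T : Type*} {ι : Type*} [Fintype ι]

open Classical in
theorem mem_overlap_iff {E : ι → Set T} {k : ℕ} {x : T} :
    x ∈ overlap E k ↔ k ≤ (Finset.univ.filter fun i => x ∈ E i).card := by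
  simp only [overlap, Set.mem_iUnion, Set.mem_iInter]
  constructor
  · rintro ⟨K, rfl, hK⟩
    exact Finset.card_le_card fun i hi => by simpa using hK i hi
  · intro h
    obtain ⟨K, hK, hk⟩ := Finset.exists_subset_card_eq h
    exact ⟨K, hk, fun i hi => by simpa using hK hi⟩

open Classical in
/-- The set `⋂_{j ∈ J} E j \ ∩^{(|J|+1)}` consists of the points for which `J` is precisely the set
of indices `i` with `x ∈ E i`. -/
theorem mem_iInter_sdiff_overlap_iff {E : ι → Set T} {J : Finset ι} {x : T} :
    x ∈ (⋂ j ∈ J, E j) \ overlap E (J.card + 1) ↔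
      J = Finset.univ.filter fun i => x ∈ E i := by
  rw [Set.mem_sdiff, mem_overlap_iff, Set.mem_iInter₂, not_le, Nat.lt_succ_iff]
  constructor
  · rintro ⟨h1, h2⟩
    exact Finset.eq_of_subset_of_card_le (fun i hi => by simpa using h1 i hi) h2
  · intro h
    refine ⟨fun i hi => ?_, h ▸ le_rfl⟩
    rw [h] at hi
    simpa using hi

theorem comp_sum_indicator {M : Type*} [AddCommMonoid M] {ψ : ℝ → M} (h0 : ψ 0 = 0)
    (E : ι → Set T) (z : ι → ℝ) (x : T) :
    ψ (∑ i, z i * (E i).indicator 1 x) =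
      ∑ J : {J : Finset ι // J.Nonempty},
        ((⋂ j ∈ J.1, E j) \ overlap E (J.1.card + 1)).indicator
          (fun _ => ψ (∑ i ∈ J.1, z i)) x := by
  classical
  set K := Finset.univ.filter fun i => x ∈ E i with hK
  have hsum : ∑ i, z i * (E i).indicator 1 x = ∑ i ∈ K, z i := by
    rw [hK, Finset.sum_filter]
    exact Finset.sum_congr rfl fun i _ => by by_cases h : x ∈ E i <;> simp [h]
  rw [hsum]
  by_cases hne : K.Nonempty
  · rw [Finset.sum_eq_single_of_mem ⟨K, hne⟩ (Finset.mem_univ _)]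
    · rw [Set.indicator_of_mem (mem_iInter_sdiff_overlap_iff.2 hK)]
    · intro J _ hJ
      refine Set.indicator_of_notMem (fun h => hJ (Subtype.ext ?_)) _
      rw [mem_iInter_sdiff_overlap_iff.1 h]
  · rw [Finset.not_nonempty_iff_eq_empty.1 hne, Finset.sum_empty, h0]
    refine (Finset.sum_eq_zero ?_).symm
    · intro J _
      refine Set.indicator_of_notMem (fun h => hne ?_) _
      rw [hK, ← mem_iInter_sdiff_overlap_iff.1 h]
      exact J.2

variable [MeasurableSpace T] {m : Measure T}

theorem measurableSet_iInter_sdiff_overlap {E : ι → Set T} (hE : ∀ i, MeasurableSet (E i))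
    (J : Finset ι) (k : ℕ) : MeasurableSet ((⋂ j ∈ J, E j) \ overlap E k) := by
  refine (Finset.measurableSet_biInter _ fun i _ => hE i).diff ?_
  exact MeasurableSet.iUnion fun K => MeasurableSet.iUnion fun _ =>
    Finset.measurableSet_biInter _ fun i _ => hE i

theorem measure_iInter_sdiff_overlap_lt_top {ι : Type*} {E : ι → Set T} (hE : ∀ i, m (E i) < ⊤)
    {J : Finset ι} (hJ : J.Nonempty) (k : ℕ) : m ((⋂ j ∈ J, E j) \ overlap E k) < ⊤ := by
  obtain ⟨i, hi⟩ := hJ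
  exact (measure_mono (Set.sdiff_subset.trans (Set.iInter₂_subset i hi))).trans_lt (hE i)

theorem integral_comp_sum_indicator {ψ : ℝ → ℂ} (h0 : ψ 0 = 0) {E : ι → Set T}
    (hE : ∀ i, MeasurableSet (E i)) (hfin : ∀ i, m (E i) < ⊤) (z : ι → ℝ) :
    ∫ x, ψ (∑ i, z i * (E i).indicator 1 x) ∂m = ∑ J : {J : Finset ι // J.Nonempty},
      (m.real ((⋂ j ∈ J.1, E j) \ overlap E (J.1.card + 1)) : ℂ) * ψ (∑ i ∈ J.1, z i) := by
  simp_rw [comp_sum_indicator h0]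
  rw [integral_finsetSum]
  · refine Finset.sum_congr rfl fun J _ => ?_
    rw [integral_indicator_const _ (measurableSet_iInter_sdiff_overlap hE _ _), Complex.real_smul]
  · intro J _
    exact (integrable_indicator_iff (measurableSet_iInter_sdiff_overlap hE _ _)).2
      (integrableOn_const (measure_iInter_sdiff_overlap_lt_top hfin J.2 _).ne)

theorem integral_comp_indicator {ψ : ℝ → ℂ} (h0 : ψ 0 = 0) {E : Set T} (hE : MeasurableSet E)
    (z : ℝ) : ∫ x, ψ (z * E.indicator 1 x) ∂m = m.real E * ψ z := by
  have : ∀ x, ψ (z * E.indicator 1 x) = E.indicator (fun _ => ψ z) x := fun x => by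
    by_cases h : x ∈ E <;> simp [h, h0]
  simp_rw [this]
  rw [integral_indicator_const _ hE, Complex.real_smul]

theorem integral_comp_sum_indicator_of_disjoint {ψ : ℝ → ℂ} (h0 : ψ 0 = 0) {E : ι → Set T}
    (hE : ∀ i, MeasurableSet (E i)) (hfin : ∀ i, m (E i) < ⊤)
    (hd : Pairwise fun i j => Disjoint (E i) (E j)) (z : ι → ℝ) :
    ∫ x, ψ (∑ i, z i * (E i).indicator 1 x) ∂m = ∑ i, (m.real (E i) : ℂ) * ψ (z i) := by
  have hpt : ∀ x, ψ (∑ i, z i * (E i).indicator 1 x) =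
      ∑ i, (E i).indicator (fun _ => ψ (z i)) x := by
    intro x
    by_cases hx : ∃ i, x ∈ E i
    · obtain ⟨i, hi⟩ := hx
      have hne : ∀ j, j ≠ i → x ∉ E j := fun j hj hxj => Set.disjoint_left.1 (hd hj) hxj hi
      rw [Finset.sum_eq_single i (fun j _ hj => by simp [hne j hj]) (by simp),
        Finset.sum_eq_single i (fun j _ hj => by simp [hne j hj]) (by simp)]
      simp [hi]
    · push Not at hx
      simp [hx, h0]
  simp_rw [hpt]
  rw [integral_finsetSum]
  · refine Finset.sum_congr rfl fun i _ => ?_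
    rw [integral_indicator_const _ (hE i), Complex.real_smul]
  · intro i _
    exact (integrable_indicator_iff (hE i)).2 (integrableOn_const (hfin i).ne)

/-- On an upward closed set of indices, `ψ (∑ z i)` telescopes. -/
theorem exists_telescope {ψ : ℝ → ℂ} (h0 : ψ 0 = 0) {n : ℕ} (z : Fin n → ℝ) :
    ∃ a : Fin n → ℂ, ∀ s : Set (Fin n), IsUpperSet s →
      ψ (∑ i, z i * s.indicator 1 i) = ∑ i, a i * s.indicator 1 i := by
  induction n with
  | zero => exact ⟨0, fun s _ => by simp [h0]⟩
  | succ n ih =>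
    obtain ⟨a, ha⟩ := ih (fun i => z i.succ)
    refine ⟨Fin.cons (ψ (∑ i, z i) - ψ (∑ i : Fin n, z i.succ)) a, fun s hs => ?_⟩
    have hind : ∀ i : Fin n, s.indicator (1 : Fin (n + 1) → ℝ) i.succ =
        (Fin.succ ⁻¹' s).indicator 1 i := fun i => rfl
    have hind' : ∀ i : Fin n, s.indicator (1 : Fin (n + 1) → ℂ) i.succ =
        (Fin.succ ⁻¹' s).indicator 1 i := fun i => rfl
    by_cases h : (0 : Fin (n + 1)) ∈ s
    · have hu : ∀ i, i ∈ s := fun i => hs (Fin.zero_le i) h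
      have hall := ha Set.univ isUpperSet_univ
      simp only [Set.indicator_univ, Pi.one_apply, mul_one] at hall
      have h1 : ∀ i, s.indicator (1 : Fin (n + 1) → ℝ) i = 1 := fun i => by simp [hu i]
      have h2 : ∀ i, s.indicator (1 : Fin (n + 1) → ℂ) i = 1 := fun i => by simp [hu i]
      simp only [h1, h2, mul_one]
      rw [Fin.sum_univ_succ (fun i => (Fin.cons _ a : Fin (n + 1) → ℂ) i)]
      simp only [Fin.cons_zero, Fin.cons_succ]
      rw [← hall]
      ring
    · rw [Fin.sum_univ_succ, Fin.sum_univ_succ]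
      simp only [Set.indicator_of_notMem h, mul_zero, zero_add, Fin.cons_succ, hind, hind']
      exact ha _ (hs.preimage fun i j hij => Fin.succ_le_succ_iff.2 hij)

/-- For increasing sets `E i` the integral depends only on the measures of the `E i`. -/
theorem exists_integral_comp_sum_indicator_of_monotone {ψ : ℝ → ℂ} (h0 : ψ 0 = 0) {n : ℕ}
    (z : Fin n → ℝ) : ∃ a : Fin n → ℂ, ∀ E : Fin n → Set T, (∀ i, MeasurableSet (E i)) →
      (∀ i, m (E i) < ⊤) → Monotone E →
        ∫ x, ψ (∑ i, z i * (E i).indicator 1 x) ∂m = ∑ i, a i * m.real (E i) := by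
  obtain ⟨a, ha⟩ := exists_telescope h0 z
  refine ⟨a, fun E hE hfin hmono => ?_⟩
  have hpt : ∀ x, ψ (∑ i, z i * (E i).indicator 1 x) =
      ∑ i, (E i).indicator (fun _ => a i) x := by
    intro x
    have h1 := ha {i | x ∈ E i} fun i j hij hi => hmono hij hi
    have h2 : ∀ i, ({i | x ∈ E i} : Set (Fin n)).indicator (1 : Fin n → ℝ) i =
        (E i).indicator 1 x := fun i => rfl
    simp only [h2] at h1
    rw [h1]
    refine Finset.sum_congr rfl fun i _ => ?_
    by_cases h : x ∈ E i <;> simp [h]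
  simp_rw [hpt]
  rw [integral_finsetSum]
  · refine Finset.sum_congr rfl fun i _ => ?_
    rw [integral_indicator_const _ (hE i), Complex.real_smul, mul_comm]
  · intro i _
    exact (integrable_indicator_iff (hE i)).2 (integrableOn_const (hfin i).ne)

end Integral

/-! ### Joint laws through characteristic functions -/

section JointLaw

variable {Ω : Type*} [MeasurableSpace Ω] {P : Measure Ω}

theorem charFun_map_const_mul {Y : Ω → ℝ} (hY : Measurable Y) (z : ℝ) :
    charFun (P.map fun ω => z * Y ω) 1 = charFun (P.map Y) z := by
  rw [charFun_map_mul_comp hY.aemeasurable, mul_one]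

theorem charFun_map_one (Y : Ω → ℝ) (hY : Measurable Y) :
    charFun (P.map Y) 1 = ∫ ω, Complex.exp (Y ω * Complex.I) ∂P := by
  rw [charFun_apply_real, integral_map hY.aemeasurable (by fun_prop)]
  simp

theorem map_eq_of_charFun_sum_eq {Ω' : Type*} [MeasurableSpace Ω'] {P' : Measure Ω'}
    [IsFiniteMeasure P] [IsFiniteMeasure P'] {ι : Type*} [Fintype ι] {Y : Ω → ι → ℝ}
    {Y' : Ω' → ι → ℝ} (hY : Measurable Y) (hY' : Measurable Y')
    (h : ∀ z : ι → ℝ, charFun (P.map fun ω => ∑ i, z i * Y ω i) 1 =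
      charFun (P'.map fun ω => ∑ i, z i * Y' ω i) 1) :
    P.map Y = P'.map Y' := by
  classical
  refine Measure.ext_of_charFunDual (funext fun L => ?_)
  have hL : ∀ y : ι → ℝ, L y = ∑ i, L (Pi.single i 1) * y i := by
    intro y
    conv_lhs => rw [← Finset.univ_sum_single y, map_sum]
    refine Finset.sum_congr rfl fun i _ => ?_
    have : (Pi.single i (y i) : ι → ℝ) = y i • Pi.single i 1 := by
      rw [← Pi.single_smul, smul_eq_mul, mul_one]
    rw [this, map_smul, smul_eq_mul, mul_comm]
  rw [charFunDual_eq_charFun_map_one, charFunDual_eq_charFun_map_one,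
    Measure.map_map L.measurable hY, Measure.map_map L.measurable hY']
  have h1 : (L ∘ Y) = fun ω => ∑ i, L (Pi.single i 1) * Y ω i := funext fun ω => hL _
  have h2 : (L ∘ Y') = fun ω => ∑ i, L (Pi.single i 1) * Y' ω i := funext fun ω => hL _
  rw [h1, h2]
  exact h _

theorem ae_eq_zero_of_charFun_eq_one [IsProbabilityMeasure P] {Y : Ω → ℝ} (hY : Measurable Y)
    (h : ∀ z, charFun (P.map Y) z = 1) : Y =ᵐ[P] 0 := by
  have : IsProbabilityMeasure (P.map Y) := Measure.isProbabilityMeasure_map hY.aemeasurable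
  have hd : P.map Y = Measure.dirac 0 :=
    Measure.ext_of_charFun (funext fun z => by rw [h]; simp [charFun_dirac])
  have h1 : ∀ᵐ y ∂(P.map Y), y = 0 := by
    rw [hd]
    simp
  exact ae_of_ae_map hY.aemeasurable h1

theorem charFun_map_sum_eq {ι : Type*} [Fintype ι] {Y : ι → Ω → ℝ} (hY : ∀ i, Measurable (Y i))
    (z : EuclideanSpace ℝ ι) : charFun (P.map fun ω => ∑ i, z i * Y i ω) 1 =
      charFun (P.map fun ω => WithLp.toLp 2 fun i => Y i ω) z := by
  rw [charFun_map_one _ (Finset.measurable_sum _ fun i _ => (hY i).const_mul _), charFun_apply,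
    integral_map (by fun_prop) (by fun_prop)]
  refine integral_congr_ae (ae_of_all _ fun ω => ?_)
  simp [PiLp.inner_apply]

theorem iIndepFun_of_charFun_sum [IsProbabilityMeasure P] {ι : Type*} [Fintype ι]
    {Y : ι → Ω → ℝ} (hY : ∀ i, Measurable (Y i))
    (h : ∀ z : ι → ℝ, charFun (P.map fun ω => ∑ i, z i * Y i ω) 1 =
      ∏ i, charFun (P.map (Y i)) (z i)) : iIndepFun Y P :=
  (iIndepFun_iff_charFun_pi fun i => (hY i).aemeasurable).2 fun t =>
    (charFun_map_sum_eq hY t).symm.trans (h t)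

theorem charFun_sum_of_iIndepFun [IsProbabilityMeasure P] {ι : Type*} [Fintype ι]
    {Y : ι → Ω → ℝ} (hY : ∀ i, Measurable (Y i)) (h : iIndepFun Y P) (z : ι → ℝ) :
    charFun (P.map fun ω => ∑ i, z i * Y i ω) 1 = ∏ i, charFun (P.map (Y i)) (z i) :=
  (charFun_map_sum_eq hY (WithLp.toLp 2 z)).trans
    ((iIndepFun_iff_charFun_pi fun i => (hY i).aemeasurable).1 h (WithLp.toLp 2 z))

end JointLaw

/-- Independent variables attached to the atoms `⋂_{j ∈ J} E j \ ∩^{(|J|+1)}`, with laws of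
exponents `m(atom) ψ`, have sums with joint exponent `∫ ψ (∑ z_i 1_{E i}) dm`. -/
theorem charFun_sum_pi_atoms {T : Type*} [MeasurableSpace T] {m : Measure T}
    {ψ : ℝ → ℂ} (h0 : ψ 0 = 0) {ι : Type*} [Fintype ι] [DecidableEq ι]
    {E : ι → Set T} (hE : ∀ i, MeasurableSet (E i)) (hfin : ∀ i, m (E i) < ⊤)
    {ν : {J : Finset ι // J.Nonempty} → Measure ℝ} [∀ J, IsProbabilityMeasure (ν J)]
    (hν : ∀ J z, charFun (ν J) z =
      Complex.exp (m.real ((⋂ j ∈ J.1, E j) \ overlap E (J.1.card + 1)) * ψ z)) (z : ι → ℝ) :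
    charFun ((Measure.pi ν).map fun ξ =>
        ∑ i, z i * ∑ J : {J : Finset ι // J.Nonempty} with i ∈ J.1, ξ J) 1 =
      Complex.exp (∫ x, ψ (∑ i, z i * (E i).indicator 1 x) ∂m) := by
  rw [integral_comp_sum_indicator h0 hE hfin, Complex.exp_sum]
  have hsum : ∀ ξ : {J : Finset ι // J.Nonempty} → ℝ,
      ∑ i, z i * ∑ J : {J : Finset ι // J.Nonempty} with i ∈ J.1, ξ J =
        ∑ J, (∑ i ∈ J.1, z i) * ξ J := by
    intro ξ
    simp only [Finset.mul_sum, Finset.sum_mul, Finset.sum_filter]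
    rw [Finset.sum_comm]
    refine Finset.sum_congr rfl fun J _ => ?_
    simp only [mul_ite, mul_zero]
    rw [Finset.sum_ite_mem, Finset.univ_inter]
  simp_rw [hsum]
  rw [charFun_map_sum_eq (Y := fun J (ξ : {J : Finset ι // J.Nonempty} → ℝ) => ξ J)
    (fun J => measurable_pi_apply J) (WithLp.toLp 2 fun J => ∑ i ∈ J.1, z i), charFun_pi]
  exact Finset.prod_congr rfl fun J _ => hν J _

/-! ### Processes with a Lévy exponent -/

section Exponent

variable {T : Type u} [MetricSpace T] [MeasurableSpace T] {𝒜 : IndexingCollection T}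
  {Ω : Type v} [MeasurableSpace Ω]

/-- The finite-dimensional laws of `X` are those of the set-indexed Lévy process with exponent `ψ`:
`E exp (i ∑ c_U X_U) = exp (∫ ψ (∑ c_U 1_U) dm)` for all finitely supported real `c`. -/
def HasExponent (m : Measure T) (P : Measure Ω) (X : 𝒜.sets → Ω → ℝ) (ψ : ℝ → ℂ) : Prop :=
  ∀ c : 𝒜.sets →₀ ℝ,
    charFun (P.map (linearExtension X c)) 1 = Complex.exp (∫ x, ψ (indicatorSum 𝒜 c x) ∂m)

variable {m : Measure T} {P : Measure Ω} {X : 𝒜.sets → Ω → ℝ} {ψ : ℝ → ℂ}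

namespace HasExponent

theorem charFun_linearExtension (h : HasExponent m P X ψ) (hX : ∀ U, Measurable (X U))
    (c : 𝒜.sets →₀ ℝ) (z : ℝ) :
    charFun (P.map (linearExtension X c)) z =
      Complex.exp (∫ x, ψ (z * indicatorSum 𝒜 c x) ∂m) := by
  have := h (z • c)
  rw [map_smul, map_smul] at this
  rw [← charFun_map_const_mul (measurable_linearExtension hX c)]
  exact this

theorem charFun_sum_increment (h : HasExponent m P X ψ) {ι : Type*} [Fintype ι]
    (C : ι → 𝒜.increments) (z : ι → ℝ) :
    charFun (P.map fun ω => ∑ i, z i * increment X (C i) ω) 1 =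
      Complex.exp (∫ x, ψ (∑ i, z i * (C i : Set T).indicator 1 x) ∂m) := by
  have := h (∑ i, z i • incrementCoeff (C i))
  simp only [map_sum, map_smul, linearExtension_incrementCoeff, indicatorSum_incrementCoeff] at this
  convert! this using 3
  · ext ω
    simp
  · ext x
    simp

theorem charFun_increment [BorelSpace T] (h : HasExponent m P X ψ)
    (hX : ∀ U, Measurable (X U)) (hψ : IsExponent ψ) (C : 𝒜.increments) (z : ℝ) :
    charFun (P.map (increment X C)) z = Complex.exp (m.real (C : Set T) * ψ z) := by
  rw [← linearExtension_incrementCoeff, h.charFun_linearExtension hX, indicatorSum_incrementCoeff,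
    integral_comp_indicator hψ.zero (𝒜.measurableSet_increment C)]

theorem charFun_apply [BorelSpace T] (h : HasExponent m P X ψ)
    (hX : ∀ U, Measurable (X U)) (hψ : IsExponent ψ) (U : 𝒜.sets) (z : ℝ) :
    charFun (P.map (X U)) z = Complex.exp (m.real (U : Set T) * ψ z) := by
  have := h.charFun_linearExtension hX (Finsupp.single U 1) z
  rw [linearExtension_single, indicatorSum_single, one_smul, one_smul,
    integral_comp_indicator hψ.zero (𝒜.measurableSet U)] at this
  exact this

variable [IsProbabilityMeasure P]

theorem hasDefiniteIncrements (h : HasExponent m P X ψ) (hX : ∀ U, Measurable (X U))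
    (hψ : IsExponent ψ) : HasDefiniteIncrements P X := by
  refine hasDefiniteIncrements_of_linearExtension fun c hc => ?_
  refine ae_eq_zero_of_charFun_eq_one (measurable_linearExtension hX c) fun z => ?_
  rw [h.charFun_linearExtension hX, hc]
  simp [hψ.zero]

theorem map_increment_eq [BorelSpace T] (h : HasExponent m P X ψ) (hX : ∀ U, Measurable (X U))
    (hψ : IsExponent ψ) {C₁ C₂ : 𝒜.increments} (hC : m (C₁ : Set T) = m (C₂ : Set T)) :
    IdentDistrib (increment X C₁) (increment X C₂) P P := by
  refine ⟨(measurable_increment hX _).aemeasurable, (measurable_increment hX _).aemeasurable, ?_⟩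
  refine Measure.ext_of_charFun (funext fun z => ?_)
  rw [h.charFun_increment hX hψ, h.charFun_increment hX hψ, measureReal_def, measureReal_def, hC]

theorem map_eq_convRPow [BorelSpace T] (h : HasExponent m P X ψ) (hX : ∀ U, Measurable (X U))
    (hψ : IsExponent ψ) {μ : Measure ℝ} (hμ : ∀ z, charFun μ z = Complex.exp (ψ z))
    (U : 𝒜.sets) : P.map (X U) = convRPow μ (m.real (U : Set T)) := by
  obtain ⟨hp, hc⟩ := hψ.convRPow_spec hμ (t := m.real (U : Set T)) measureReal_nonneg
  have : IsProbabilityMeasure (P.map (X U)) :=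
    Measure.isProbabilityMeasure_map (hX U).aemeasurable
  exact Measure.ext_of_charFun (funext fun z => by rw [hc, h.charFun_apply hX hψ])

/-- The exponent determines the law of the whole process. -/
theorem map_eq {Ω' : Type w} [MeasurableSpace Ω'] {P' : Measure Ω'} [IsProbabilityMeasure P']
    {X' : 𝒜.sets → Ω' → ℝ} (h : HasExponent m P X ψ) (hX : ∀ U, Measurable (X U))
    (h' : HasExponent m P' X' ψ) (hX' : ∀ U, Measurable (X' U)) :
    P'.map (fun ω U => X' U ω) = P.map (fun ω U => X U ω) := by
  have hXm : Measurable fun ω U => X U ω := measurable_pi_lambda _ hX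
  have hXm' : Measurable fun ω U => X' U ω := measurable_pi_lambda _ hX'
  have h1 := isProjectiveLimit_map (X := X') (P := P') hXm'.aemeasurable
  have h2 := isProjectiveLimit_map (X := X) (P := P) hXm.aemeasurable
  have heq : (fun I : Finset 𝒜.sets => P'.map fun ω => I.restrict fun U => X' U ω) =
      fun I : Finset 𝒜.sets => P.map fun ω => I.restrict fun U => X U ω := by
    funext I
    refine map_eq_of_charFun_sum_eq ((Finset.measurable_restrict I).comp hXm')
      ((Finset.measurable_restrict I).comp hXm) fun z => ?_
    have e := h (∑ i : I, z i • Finsupp.single (i : 𝒜.sets) 1)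
    have e' := h' (∑ i : I, z i • Finsupp.single (i : 𝒜.sets) 1)
    rw [← e] at e'
    simp only [map_sum, map_smul, linearExtension_single, one_smul] at e'
    convert! e' using 3
    · ext ω; simp
    · ext ω; simp
  rw [heq] at h1
  exact h1.unique h2

variable [BorelSpace T] [m.Regular]

theorem iIndepFun_increment_of_fintype (h : HasExponent m P X ψ) (hX : ∀ U, Measurable (X U))
    (hψ : IsExponent ψ) {ι : Type*} [Fintype ι] (C : ι → 𝒜.increments)
    (hC : Pairwise fun i j => Disjoint (C i : Set T) (C j : Set T)) :
    iIndepFun (fun i => increment X (C i)) P := by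
  refine iIndepFun_of_charFun_sum (fun i => measurable_increment hX _) fun z => ?_
  rw [h.charFun_sum_increment, integral_comp_sum_indicator_of_disjoint hψ.zero
    (fun i => 𝒜.measurableSet_increment _) (fun i => 𝒜.measure_increment_lt_top m _) hC,
    Complex.exp_sum]
  exact Finset.prod_congr rfl fun i _ => (h.charFun_increment hX hψ _ _).symm

theorem iIndepFun_increment (h : HasExponent m P X ψ) (hX : ∀ U, Measurable (X U))
    (hψ : IsExponent ψ) {ι : Type*} (C : ι → 𝒜.increments)
    (hC : Pairwise fun i j => Disjoint (C i : Set T) (C j : Set T)) :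
    iIndepFun (fun i => increment X (C i)) P := by
  rw [iIndepFun_iff_finset]
  intro s
  exact h.iIndepFun_increment_of_fintype hX hψ (fun i : s => C i)
    fun i j hij => hC fun hij' => hij (Subtype.ext hij')

theorem stationary (h : HasExponent m P X ψ) (hX : ∀ U, Measurable (X U))
    (hψ : IsExponent ψ) (n : ℕ) (V : 𝒜.sets) (U A : Fin n → 𝒜.sets)
    (hU : Monotone (fun i => (U i : Set T))) (hA : Monotone (fun i => (A i : Set T)))
    (hUA : ∀ i, m ((U i : Set T) \ V) = m (A i : Set T)) :
    IdentDistrib (fun ω i => increment X (𝒜.sdiff (U i) V) ω)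
      (fun ω i => increment X (𝒜.toIncrement (A i)) ω) P P := by
  have h1 : Measurable fun ω i => increment X (𝒜.sdiff (U i) V) ω :=
    measurable_pi_lambda _ fun i => measurable_increment hX _
  have h2 : Measurable fun ω i => increment X (𝒜.toIncrement (A i)) ω :=
    measurable_pi_lambda _ fun i => measurable_increment hX _
  refine ⟨h1.aemeasurable, h2.aemeasurable, map_eq_of_charFun_sum_eq h1 h2 fun z => ?_⟩
  rw [h.charFun_sum_increment, h.charFun_sum_increment]
  obtain ⟨a, ha⟩ := exists_integral_comp_sum_indicator_of_monotone (m := m) hψ.zero z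
  rw [ha _ (fun i => 𝒜.measurableSet_increment _) (fun i => 𝒜.measure_increment_lt_top m _)
      (fun i j hij => Set.sdiff_subset_sdiff_left (hU hij)),
    ha _ (fun i => 𝒜.measurableSet_increment _) (fun i => 𝒜.measure_increment_lt_top m _)
      (fun i j hij => hA hij)]
  congr 1
  refine Finset.sum_congr rfl fun i _ => ?_
  rw [measureReal_def, measureReal_def]
  change _ * ((m ((U i : Set T) \ V)).toReal : ℂ) = _
  rw [hUA]
  rfl

theorem tendstoInMeasure (h : HasExponent m P X ψ) (hX : ∀ U, Measurable (X U))
    (hψ : IsExponent ψ) (U : ℕ → 𝒜.sets) (A : 𝒜.sets)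
    (h1 : Tendsto (fun n => m ((U n : Set T) \ A)) atTop (𝓝 0))
    (h2 : Tendsto (fun n => m ((A : Set T) \ U n)) atTop (𝓝 0)) :
    TendstoInMeasure P (fun n => X (U n)) atTop (X A) := by
  have hY : ∀ n, Measurable (linearExtension X (Finsupp.single (U n) 1 - Finsupp.single A 1)) :=
    fun n => measurable_linearExtension hX _
  have h0 := tendstoInMeasure_zero_of_tendsto_charFun (P := P) hY fun z => ?_
  · rw [tendstoInMeasure_iff_norm] at h0 ⊢
    simpa [map_sub] using h0
  · have hr1 : Tendsto (fun n => (m.real ((U n : Set T) \ A) : ℂ)) atTop (𝓝 0) := by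
      have := (Complex.continuous_ofReal.tendsto 0).comp
        ((ENNReal.tendsto_toReal ENNReal.zero_ne_top).comp h1)
      simpa [Function.comp_def, measureReal_def] using this
    have hr2 : Tendsto (fun n => (m.real ((A : Set T) \ U n) : ℂ)) atTop (𝓝 0) := by
      have := (Complex.continuous_ofReal.tendsto 0).comp
        ((ENNReal.tendsto_toReal ENNReal.zero_ne_top).comp h2)
      simpa [Function.comp_def, measureReal_def] using this
    have hlim := (Complex.continuous_exp.tendsto _).comp
      ((hr1.mul_const (ψ z)).add (hr2.mul_const (ψ (-z))))
    simp only [zero_mul, add_zero, Complex.exp_zero] at hlim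
    refine hlim.congr fun n => ?_
    rw [h.charFun_linearExtension hX]
    simp only [Function.comp_apply]
    congr 1
    let E : Fin 2 → Set T := ![(U n : Set T) \ A, (A : Set T) \ U n]
    have hE := integral_comp_sum_indicator_of_disjoint (m := m) hψ.zero (E := E)
      (by
        intro i
        fin_cases i
        · exact (𝒜.measurableSet _).diff (𝒜.measurableSet _)
        · exact (𝒜.measurableSet _).diff (𝒜.measurableSet _))
      (by
        intro i
        fin_cases i
        · exact (measure_mono Set.sdiff_subset).trans_lt (𝒜.measure_lt_top m (U n))
        · exact (measure_mono Set.sdiff_subset).trans_lt (𝒜.measure_lt_top m A))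
      (by
        have hd : Disjoint ((U n : Set T) \ A) ((A : Set T) \ U n) :=
          disjoint_sdiff_sdiff
        intro i j hij
        fin_cases i <;> fin_cases j
        · exact absurd rfl hij
        · exact hd
        · exact hd.symm
        · exact absurd rfl hij)
      ![z, -z]
    rw [Fin.sum_univ_two] at hE
    simp only [E, Matrix.cons_val_zero, Matrix.cons_val_one] at hE
    rw [← hE]
    refine integral_congr_ae (ae_of_all _ fun x => ?_)
    simp only [Fin.sum_univ_two, Matrix.cons_val_zero, Matrix.cons_val_one, map_sub,
      indicatorSum_single, one_smul, Pi.sub_apply]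
    congr 1
    by_cases hU : x ∈ (U n : Set T) <;> by_cases hA : x ∈ (A : Set T) <;> simp [hU, hA]

theorem isLevy [LocallyCompactSpace T] (h : HasExponent m P X ψ) (hX : ∀ U, Measurable (X U))
    (hψ : IsExponent ψ) (hm₀ : m 𝒜.minimalSet = 0)
    (hm : ∀ A : ℕ → Set T, (∀ i, A i ∈ 𝒜.sets) → Monotone A →
      closure (⋃ i, A i) ∈ 𝒜.sets → m (closure (⋃ i, A i)) = m (⋃ i, A i)) :
    IsLevy m P X where
  definite := h.hasDefiniteIncrements hX hψ
  zero := ae_eq_zero_of_charFun_eq_one (hX _) fun z => by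
    rw [h.charFun_apply hX hψ, measureReal_def]
    simp only [hm₀]
    simp
  indep n C hC := h.iIndepFun_increment hX hψ C hC
  stationary := h.stationary hX hψ
  continuous U A h1 h2 := by
    have := 𝒜.tendsto_measure_symmDiff m hm U A h1 h2
    exact h.tendstoInMeasure hX hψ U A this.1 this.2

/-- The remainders `ΔX_D - ∑_{i < n} ΔX_{C i}` tend to `0` in probability since
`m (D \ ⋃_{i < n} C i)` tends to `0`. -/
theorem ae_tendsto_sum_increment (h : HasExponent m P X ψ) (hX : ∀ U, Measurable (X U))
    (hψ : IsExponent ψ) (C : ℕ → 𝒜.increments) (D : 𝒜.increments)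
    (hC : Pairwise (fun i j => Disjoint (C i : Set T) (C j : Set T)))
    (hD : (D : Set T) = ⋃ i, (C i : Set T)) :
    ∀ᵐ ω ∂P, Tendsto (fun n => ∑ i ∈ Finset.range n, increment X (C i) ω) atTop
      (𝓝 (increment X D ω)) := by
  refine ae_tendsto_of_tendstoInMeasure_of_iIndepFun (fun n => measurable_increment hX _)
    (h.iIndepFun_increment hX hψ C hC) ?_
  let c : ℕ → 𝒜.sets →₀ ℝ := fun n =>
    ∑ i ∈ Finset.range n, incrementCoeff (C i) - incrementCoeff D
  have hc : ∀ n ω, linearExtension X (c n) ω =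
      ∑ i ∈ Finset.range n, increment X (C i) ω - increment X D ω := fun n ω => by
    simp [c, map_sub, map_sum, linearExtension_incrementCoeff, Finset.sum_apply]
  let R : ℕ → Set T := fun n => (D : Set T) \ ⋃ i ∈ Finset.range n, (C i : Set T)
  have hind : ∀ n x, indicatorSum 𝒜 (c n) x = -(R n).indicator 1 x := by
    intro n x
    simp only [c, R, map_sub, map_sum, indicatorSum_incrementCoeff, Pi.sub_apply, Finset.sum_apply]
    by_cases hx : ∃ i, x ∈ (C i : Set T)
    · obtain ⟨i, hi⟩ := hx
      have hxD : x ∈ (D : Set T) := hD ▸ Set.mem_iUnion.2 ⟨i, hi⟩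
      have hne : ∀ j, j ≠ i → x ∉ (C j : Set T) := fun j hj hxj =>
        Set.disjoint_left.1 (hC hj) hxj hi
      by_cases hin : i < n
      · rw [Finset.sum_eq_single_of_mem i (Finset.mem_range.2 hin) fun j _ hj =>
            Set.indicator_of_notMem (hne j hj) _, Set.indicator_of_mem hi,
          Set.indicator_of_mem hxD, Set.indicator_of_notMem]
        · simp
        · exact fun hx => hx.2 (Set.mem_biUnion (Finset.mem_range.2 hin) hi)
      · have hnot : ∀ j ∈ Finset.range n, x ∉ (C j : Set T) := fun j hj =>
          hne j fun h => hin (h ▸ Finset.mem_range.1 hj)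
        rw [Finset.sum_eq_zero fun j hj => Set.indicator_of_notMem (hnot j hj) _,
          Set.indicator_of_mem hxD, Set.indicator_of_mem]
        · simp
        · exact ⟨hxD, fun hx => by
            obtain ⟨j, hj, hxj⟩ := Set.mem_iUnion₂.1 hx
            exact hnot j hj hxj⟩
    · have hxD : x ∉ (D : Set T) := fun hx' => hx (by rwa [hD, Set.mem_iUnion] at hx')
      push Not at hx
      simp [hx, hxD]
  have hRm : ∀ n, MeasurableSet (R n) := fun n => (𝒜.measurableSet_increment D).diff
    (Finset.measurableSet_biUnion _ fun i _ => 𝒜.measurableSet_increment _)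
  have hR : Tendsto (fun n => m.real (R n)) atTop (𝓝 0) := by
    have hlim := tendsto_measure_iInter_atTop (μ := m) (s := R)
      (fun n => (hRm n).nullMeasurableSet)
      (fun i j hij => Set.sdiff_subset_sdiff_right (Set.biUnion_subset_biUnion_left
        fun k hk => Finset.mem_coe.2 (Finset.mem_range.2 ((Finset.mem_range.1 hk).trans_le hij))))
      ⟨0, ((measure_mono Set.sdiff_subset).trans_lt (𝒜.measure_increment_lt_top m D)).ne⟩
    have hemp : ⋂ n, R n = ∅ := by
      rw [Set.eq_empty_iff_forall_notMem]
      intro x hx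
      rw [Set.mem_iInter] at hx
      have hxD := (hx 0).1
      rw [hD, Set.mem_iUnion] at hxD
      obtain ⟨i, hi⟩ := hxD
      exact (hx (i + 1)).2 (Set.mem_biUnion (Finset.self_mem_range_succ i) hi)
    rw [hemp, measure_empty] at hlim
    simpa [Function.comp_def, measureReal_def] using
      (ENNReal.tendsto_toReal ENNReal.zero_ne_top).comp hlim
  have h0 := tendstoInMeasure_zero_of_tendsto_charFun (P := P)
    (fun n => measurable_linearExtension hX (c n)) fun z => ?_
  · rw [tendstoInMeasure_iff_norm] at h0 ⊢
    simpa [hc] using h0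
  · have hlim := (Complex.continuous_exp.tendsto _).comp
      (((Complex.continuous_ofReal.tendsto 0).comp hR).mul_const (ψ (-z)))
    simp only [Complex.ofReal_zero, zero_mul, Complex.exp_zero] at hlim
    refine hlim.congr fun n => ?_
    rw [h.charFun_linearExtension hX]
    simp only [Function.comp_apply, hind]
    rw [← integral_comp_indicator hψ.zero (hRm n)]
    simp only [mul_neg, neg_mul]

theorem isIDScatteredMeasure (h : HasExponent m P X ψ) (hX : ∀ U, Measurable (X U))
    (hψ : IsExponent ψ) : IsIDScatteredMeasure P X where
  indep C hC := h.iIndepFun_increment hX hψ C hC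
  additive := h.ae_tendsto_sum_increment hX hψ
  infDiv C := by
    have : IsProbabilityMeasure (P.map (increment X C)) :=
      Measure.isProbabilityMeasure_map (measurable_increment hX C).aemeasurable
    exact hψ.isInfinitelyDivisible measureReal_nonneg (h.charFun_increment hX hψ C)

theorem hasCanonicalFDD (h : HasExponent m P X ψ) (hX : ∀ U, Measurable (X U))
    (hψ : IsExponent ψ) {μ : Measure ℝ} (hμ : ∀ z, charFun μ z = Complex.exp (ψ z)) :
    HasCanonicalFDD m P X μ := by
  intro n C B hB
  let D : {J : Finset (Fin (n + 1)) // J.Nonempty} → Set T := fun J =>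
    (⋂ j ∈ J.1, (C j : Set T)) \ overlap (fun i => (C i : Set T)) (J.1.card + 1)
  let ν : {J : Finset (Fin (n + 1)) // J.Nonempty} → Measure ℝ := fun J =>
    convRPow μ (m.real (D J))
  have hν : ∀ J, IsProbabilityMeasure (ν J) := fun J =>
    (hψ.convRPow_spec hμ measureReal_nonneg).1
  have hνc : ∀ J z, charFun (ν J) z = Complex.exp (m.real (D J) * ψ z) := fun J =>
    (hψ.convRPow_spec hμ measureReal_nonneg).2
  let Y : Ω → Fin (n + 1) → ℝ := fun ω i => increment X (C i) ω
  have hY : Measurable Y := measurable_pi_lambda _ fun i => measurable_increment hX _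
  let Φ : ({J : Finset (Fin (n + 1)) // J.Nonempty} → ℝ) → Fin (n + 1) → ℝ := fun ξ i =>
    ∑ J : {J : Finset (Fin (n + 1)) // J.Nonempty} with i ∈ J.1, ξ J
  have hΦ : Measurable Φ := measurable_pi_lambda _ fun i =>
    Finset.measurable_sum _ fun J _ => measurable_pi_apply J
  have hlaw : P.map Y = (Measure.pi ν).map Φ := by
    refine map_eq_of_charFun_sum_eq hY hΦ fun z => ?_
    rw [h.charFun_sum_increment]
    exact (charFun_sum_pi_atoms hψ.zero (fun i => 𝒜.measurableSet_increment _)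
      (fun i => 𝒜.measure_increment_lt_top m _) hνc z).symm
  have hset : {ω | ∀ i, increment X (C i) ω ∈ B i} = Y ⁻¹' Set.univ.pi B := by
    ext ω
    simp [Y]
  have hBm : MeasurableSet (Set.univ.pi B) := MeasurableSet.univ_pi hB
  rw [hset, ← Measure.map_apply hY hBm, hlaw, Measure.map_apply hΦ hBm,
    ← lintegral_indicator_one (hΦ hBm)]
  refine lintegral_congr fun ξ => ?_
  by_cases hξ : ∀ i, Φ ξ i ∈ B i
  · rw [Set.indicator_of_mem (show ξ ∈ Φ ⁻¹' Set.univ.pi B from fun i _ => hξ i)]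
    exact (Finset.prod_eq_one fun i _ => Set.indicator_of_mem (hξ i) _).symm
  · rw [Set.indicator_of_notMem (fun h : ξ ∈ Φ ⁻¹' Set.univ.pi B => hξ fun i => h i trivial)]
    push Not at hξ
    obtain ⟨i, hi⟩ := hξ
    exact (Finset.prod_eq_zero (Finset.mem_univ i) (Set.indicator_of_notMem hi _)).symm

end HasExponent

end Exponent

/-! ### Existence of the exponent -/

section Additivity

variable {T : Type u} [TopologicalSpace T] {𝒜 : IndexingCollection T}
  {Ω : Type v} [MeasurableSpace Ω] {P : Measure Ω} {X : 𝒜.sets → Ω → ℝ}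

theorem HasDefiniteIncrements.increment_toIncrement (hX : HasDefiniteIncrements P X)
    (U : 𝒜.sets) : increment X (𝒜.toIncrement U) =ᵐ[P] X U := by
  have := hX.linearExtension_ae_eq (c := incrementCoeff (𝒜.toIncrement U))
    (d := Finsupp.single U 1) (by
      rw [indicatorSum_incrementCoeff, indicatorSum_single, one_smul]; rfl)
  rwa [linearExtension_incrementCoeff, linearExtension_single, one_smul] at this

theorem HasDefiniteIncrements.increment_union (hX : HasDefiniteIncrements P X)
    {C C₁ C₂ : 𝒜.increments} (hd : Disjoint (C₁ : Set T) C₂)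
    (hC : (C : Set T) = (C₁ : Set T) ∪ (C₂ : Set T)) :
    increment X C =ᵐ[P] fun ω => increment X C₁ ω + increment X C₂ ω := by
  have := hX.linearExtension_ae_eq (c := incrementCoeff C)
    (d := incrementCoeff C₁ + incrementCoeff C₂) (by
      rw [map_add, indicatorSum_incrementCoeff, indicatorSum_incrementCoeff,
        indicatorSum_incrementCoeff, hC, Set.indicator_union_of_disjoint hd]
      rfl)
  rw [map_add, linearExtension_incrementCoeff, linearExtension_incrementCoeff,
    linearExtension_incrementCoeff] at this
  exact this

end Additivity

section Homogeneous

variable {T : Type u} [MetricSpace T] [MeasurableSpace T] {𝒜 : IndexingCollection T}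
  {Ω : Type v} [MeasurableSpace Ω]

/-- The properties shared by set-indexed Lévy processes and by processes whose increments form a
homogeneous independently scattered measure, from which the exponent is constructed: stationarity
is needed for one increment `U \ V` at a time only, and continuity for decreasing sequences. -/
structure IsHomogeneous (m : Measure T) (P : Measure Ω) (X : 𝒜.sets → Ω → ℝ) : Prop where
  definite : HasDefiniteIncrements P X
  indep : ∀ (n : ℕ) (C : Fin n → 𝒜.increments),
    Pairwise (fun i j => Disjoint (C i : Set T) (C j : Set T)) →
      iIndepFun (fun i => increment X (C i)) P
  law : ∀ U V A : 𝒜.sets, m ((U : Set T) \ V) = m (A : Set T) →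
    P.map (increment X (𝒜.sdiff U V)) = P.map (increment X (𝒜.toIncrement A))
  continuous : ∀ (U : ℕ → 𝒜.sets) (A : 𝒜.sets), Antitone (fun n => (U n : Set T)) →
    ⋂ n, (U n : Set T) = A → TendstoInMeasure P (fun n => X (U n)) atTop (X A)

variable {m : Measure T} {P : Measure Ω} {X : 𝒜.sets → Ω → ℝ}

theorem IsLevy.isHomogeneous (h : IsLevy m P X) : IsHomogeneous m P X where
  definite := h.definite
  indep := h.indep
  law U V A hUA := by
    have := h.stationary 1 V (fun _ => U) (fun _ => A) monotone_const monotone_const fun _ => hUA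
    exact (this.comp (measurable_pi_apply (0 : Fin 1))).map_eq
  continuous U A hU hA := by
    have hanti : ∀ n, ⋃ k ≥ n, (U k : Set T) = U n := fun n =>
      Set.Subset.antisymm (Set.iUnion₂_subset fun k hk => hU hk)
        (Set.subset_iUnion₂_of_subset n le_rfl subset_rfl)
    have hinf : ∀ n, ⋂ k ≥ n, (U k : Set T) = A := fun n => by
      rw [← hA]
      refine Set.Subset.antisymm (Set.subset_iInter fun k => ?_)
        (Set.subset_iInter₂ fun k _ => Set.iInter_subset _ k)
      exact (Set.iInter₂_subset (max n k) (le_max_left n k)).trans (hU (le_max_right n k))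
    refine h.continuous U A ?_ ?_
    · simp only [hinf, Set.iUnion_const]
      exact (𝒜.isCompact A A.2).isClosed.closure_eq
    · simp only [hanti]
      rw [← hA]
      exact Set.iInter_congr fun n => (𝒜.isCompact _ (U n).2).isClosed.closure_eq

/-- Continuity along decreasing sequences comes from summing the increments over the successive
differences. -/
theorem IsIDScatteredMeasure.isHomogeneous [IsProbabilityMeasure P] (h : IsIDScatteredMeasure P X)
    (hX : ∀ U, Measurable (X U)) (hdef : HasDefiniteIncrements P X)
    (hlaw : ∀ C₁ C₂ : 𝒜.increments, m (C₁ : Set T) = m (C₂ : Set T) →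
      IdentDistrib (increment X C₁) (increment X C₂) P P) : IsHomogeneous m P X where
  definite := hdef
  indep n C hC := by
    let E : 𝒜.increments := 𝒜.toIncrement ⟨∅, 𝒜.empty_mem⟩
    have hE : (E : Set T) = ∅ := rfl
    let D : ℕ → 𝒜.increments := fun k => if hk : k < n then C ⟨k, hk⟩ else E
    have hD : Pairwise fun i j => Disjoint (D i : Set T) (D j : Set T) := by
      intro i j hij
      by_cases hi : i < n
      · by_cases hj : j < n
        · simp only [D, dif_pos hi, dif_pos hj]
          exact hC fun h => hij (by simpa using h)
        · simp [D, hj, hE]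
      · simp [D, hi, hE]
    have := (h.indep D hD).precomp (g := fun i : Fin n => (i : ℕ)) Fin.val_injective
    convert! this using 2 with i
    simp [D]
  law U V A hUA := (hlaw _ _ hUA).map_eq
  continuous U A hU hA := by
    refine tendstoInMeasure_of_tendsto_ae (fun n => (hX _).aestronglyMeasurable) ?_
    let C : ℕ → 𝒜.increments := fun k => 𝒜.sdiff (U k) (U (k + 1))
    have hCd : ∀ i j, i < j → Disjoint (C i : Set T) (C j : Set T) := fun i j hij =>
      Set.disjoint_left.2 fun x hi hj => hi.2 (hU (Nat.succ_le_of_lt hij) hj.1)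
    have hC : Pairwise fun i j => Disjoint (C i : Set T) (C j : Set T) := by
      intro i j hij
      rcases lt_or_gt_of_ne hij with h | h
      · exact hCd i j h
      · exact (hCd j i h).symm
    have hD : ((𝒜.sdiff (U 0) A : 𝒜.increments) : Set T) = ⋃ i, (C i : Set T) := by
      ext x
      simp only [Set.mem_iUnion]
      constructor
      · rintro ⟨h0, hA'⟩
        rw [← hA, Set.mem_iInter, not_forall] at hA'
        classical
        obtain ⟨k, hk⟩ : ∃ k, Nat.find hA' = k + 1 := by
          refine Nat.exists_eq_succ_of_ne_zero fun h => ?_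
          have := Nat.find_spec hA'
          rw [h] at this
          exact this h0
        refine ⟨k, ?_, ?_⟩
        · have := Nat.find_min hA' (m := k) (by omega)
          simpa using this
        · have := Nat.find_spec hA'
          rwa [hk] at this
      · rintro ⟨k, h1, h2⟩
        refine ⟨hU (Nat.zero_le k) h1, fun hxA => h2 ?_⟩
        rw [← hA] at hxA
        exact Set.mem_iInter.1 hxA _
    have hAU : ∀ n, (A : Set T) ⊆ U n := fun n => hA ▸ Set.iInter_subset _ n
    have hinc : ∀ V W : 𝒜.sets, (V : Set T) ⊆ W →
        ∀ᵐ ω ∂P, increment X (𝒜.sdiff W V) ω = X W ω - X V ω := by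
      intro V W hVW
      have := hdef.increment_union (C := 𝒜.toIncrement W) (C₁ := 𝒜.sdiff W V)
        (C₂ := 𝒜.toIncrement V) Set.disjoint_sdiff_left (Set.sdiff_union_of_subset hVW).symm
      filter_upwards [this, hdef.increment_toIncrement W, hdef.increment_toIncrement V]
        with ω h1 h2 h3
      rw [← h2, ← h3, h1]
      ring
    filter_upwards [h.additive C _ hC hD, hinc A (U 0) (hAU 0),
      ae_all_iff.2 fun k => hinc (U (k + 1)) (U k) (hU k.le_succ)] with ω h1 h2 h3
    have hsum : ∀ n, ∑ i ∈ Finset.range n, increment X (C i) ω = X (U 0) ω - X (U n) ω := by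
      intro n
      simp only [C, h3]
      exact Finset.sum_range_sub' (fun k => X (U k) ω) n
    simp only [hsum, h2] at h1
    have := h1.const_sub (X (U 0) ω)
    simpa using this

namespace IsHomogeneous

theorem map_apply_eq (h : IsHomogeneous m P X) {U A : 𝒜.sets}
    (hUA : m (U : Set T) = m (A : Set T)) : P.map (X U) = P.map (X A) := by
  have h1 := h.law U ⟨∅, 𝒜.empty_mem⟩ A (by simpa using hUA)
  have h2 := h.law U ⟨∅, 𝒜.empty_mem⟩ U (by simp)
  rw [← Measure.map_congr (h.definite.increment_toIncrement U),
    ← Measure.map_congr (h.definite.increment_toIncrement A), ← h1, h2]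

variable [IsProbabilityMeasure P]

theorem charFun_union (h : IsHomogeneous m P X) (hX : ∀ U, Measurable (X U))
    {C C₁ C₂ : 𝒜.increments} (hd : Disjoint (C₁ : Set T) C₂)
    (hC : (C : Set T) = (C₁ : Set T) ∪ (C₂ : Set T)) (z : ℝ) :
    charFun (P.map (increment X C)) z =
      charFun (P.map (increment X C₁)) z * charFun (P.map (increment X C₂)) z := by
  have hind := h.indep 2 ![C₁, C₂] (by
    intro i j hij
    fin_cases i <;> fin_cases j
    · exact absurd rfl hij
    · exact hd
    · exact hd.symm
    · exact absurd rfl hij)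
  have h2 : IndepFun (increment X C₁) (increment X C₂) P :=
    hind.indepFun (i := 0) (j := 1) (by decide)
  rw [Measure.map_congr (h.definite.increment_union hd hC), h2.charFun_map_fun_add_eq_mul
    (measurable_increment hX _).aemeasurable (measurable_increment hX _).aemeasurable]
  rfl

variable [BorelSpace T] [m.Regular]

/-- The multiplicative functional equation in `m U`. -/
theorem charFun_mul (h : IsHomogeneous m P X) (hX : ∀ U, Measurable (X U))
    {U A A' : 𝒜.sets} (hAU : (A : Set T) ⊆ U)
    (hA' : m.real (A' : Set T) = m.real (U : Set T) - m.real (A : Set T)) (z : ℝ) :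
    charFun (P.map (X U)) z = charFun (P.map (X A)) z * charFun (P.map (X A')) z := by
  have h1 := h.charFun_union hX (C := 𝒜.toIncrement U) (C₁ := 𝒜.toIncrement A)
    (C₂ := 𝒜.sdiff U A) Set.disjoint_sdiff_right (Set.union_sdiff_cancel hAU).symm z
  have hmeas : m ((U : Set T) \ A) = m (A' : Set T) := by
    have hfin : ∀ V : 𝒜.sets, m (V : Set T) ≠ ⊤ := fun V => (𝒜.measure_lt_top m V).ne
    have hreal : m.real ((U : Set T) \ A) = m.real (A' : Set T) := by
      rw [hA', measureReal_sdiff hAU (𝒜.measurableSet A) (hfin U)]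
    exact (measureReal_eq_measureReal_iff
      ((measure_mono Set.sdiff_subset).trans_lt (𝒜.measure_lt_top m U)).ne (hfin A')).1 hreal
  rw [h.law U A A' hmeas, Measure.map_congr (h.definite.increment_toIncrement U),
    Measure.map_congr (h.definite.increment_toIncrement A),
    Measure.map_congr (h.definite.increment_toIncrement A')] at h1
  exact h1

end IsHomogeneous

end Homogeneous

section ExponentExistence

variable {T : Type u} [MetricSpace T] [MeasurableSpace T] {𝒜 : IndexingCollection T}
  {Ω : Type v} [MeasurableSpace Ω] {m : Measure T} {P : Measure Ω} {X : 𝒜.sets → Ω → ℝ}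

theorem IndexingCollection.exists_antitone_measure_eq
    (hflow : ∀ (U : 𝒜.sets) (t : ℝ), 0 ≤ t → t ≤ m.real (U : Set T) →
      ∃ A : 𝒜.sets, (A : Set T) ⊆ U ∧ m.real (A : Set T) = t)
    (U : 𝒜.sets) {d : ℕ → ℝ} (hd : Antitone d) (h0 : ∀ j, 0 ≤ d j)
    (hU : d 0 ≤ m.real (U : Set T)) :
    ∃ V : ℕ → 𝒜.sets, Antitone (fun j => (V j : Set T)) ∧ (∀ j, (V j : Set T) ⊆ U) ∧
      ∀ j, m.real (V j : Set T) = d j := by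
  choose f hf using hflow
  let V : (j : ℕ) → {W : 𝒜.sets // (W : Set T) ⊆ U ∧ m.real (W : Set T) = d j} := fun j =>
    Nat.rec (motive := fun j => {W : 𝒜.sets // (W : Set T) ⊆ U ∧ m.real (W : Set T) = d j})
      ⟨f U (d 0) (h0 0) hU, hf _ _ _ _⟩
      (fun j W => ⟨f W.1 (d (j + 1)) (h0 _) ((hd j.le_succ).trans_eq W.2.2.symm),
        (hf _ _ _ _).1.trans W.2.1, (hf _ _ _ _).2⟩) j
  exact ⟨fun j => (V j).1, antitone_nat_of_succ_le fun j => (hf _ _ _ _).1,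
    fun j => (V j).2.1, fun j => (V j).2.2⟩

namespace IsHomogeneous

theorem iIndepFun_of_fintype (h : IsHomogeneous m P X) {ι : Type*} [Fintype ι]
    (C : ι → 𝒜.increments) (hC : Pairwise fun i j => Disjoint (C i : Set T) (C j : Set T)) :
    iIndepFun (fun i => increment X (C i)) P := by
  let e := Fintype.equivFin ι
  have := (h.indep _ (fun k => C (e.symm k)) fun i j hij => hC (e.symm.injective.ne hij)).precomp
    (g := e) e.injective
  simpa using this

variable [IsProbabilityMeasure P] [m.Regular]

theorem charFun_of_measure_eq_zero (h : IsHomogeneous m P X) {A : 𝒜.sets}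
    (hA : m.real (A : Set T) = 0) (z : ℝ) : charFun (P.map (X A)) z = 1 := by
  have hA0 : m (A : Set T) = 0 :=
    (measureReal_eq_zero_iff (𝒜.measure_lt_top m A).ne).1 hA
  rw [h.map_apply_eq (U := A) (A := ⟨∅, 𝒜.empty_mem⟩) (by simpa using hA0)]
  have := h.definite.linearExtension_ae_eq_zero
    (c := Finsupp.single (⟨∅, 𝒜.empty_mem⟩ : 𝒜.sets) 1) (by ext; simp)
  rw [linearExtension_single, one_smul] at this
  rw [Measure.map_congr this]
  simp [Pi.zero_def, Measure.map_const, charFun_dirac]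

variable [BorelSpace T]

theorem charFun_pow (h : IsHomogeneous m P X) (hX : ∀ U, Measurable (X U))
    (hflow : ∀ (U : 𝒜.sets) (t : ℝ), 0 ≤ t → t ≤ m.real (U : Set T) →
      ∃ A : 𝒜.sets, (A : Set T) ⊆ U ∧ m.real (A : Set T) = t)
    {A₁ : 𝒜.sets} (k : ℕ) {A : 𝒜.sets} (hA : m.real (A : Set T) = k * m.real (A₁ : Set T))
    (z : ℝ) : charFun (P.map (X A)) z = charFun (P.map (X A₁)) z ^ k := by
  induction k generalizing A with
  | zero => rw [pow_zero, h.charFun_of_measure_eq_zero (by simpa using hA)]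
  | succ k ih =>
    have hpos : 0 ≤ m.real (A₁ : Set T) := measureReal_nonneg
    push_cast at hA
    obtain ⟨A', hA', hm'⟩ := hflow A (k * m.real (A₁ : Set T)) (by positivity) (by linarith)
    rw [h.charFun_mul hX hA' (A' := A₁) (by linarith), ih hm', pow_succ]

theorem isInfinitelyDivisible (h : IsHomogeneous m P X) (hX : ∀ U, Measurable (X U))
    (hflow : ∀ (U : 𝒜.sets) (t : ℝ), 0 ≤ t → t ≤ m.real (U : Set T) →
      ∃ A : 𝒜.sets, (A : Set T) ⊆ U ∧ m.real (A : Set T) = t) (U : 𝒜.sets) :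
    IsInfinitelyDivisible (P.map (X U)) := by
  have hprob : ∀ V, IsProbabilityMeasure (P.map (X V)) := fun V =>
    Measure.isProbabilityMeasure_map (hX V).aemeasurable
  refine ⟨hprob U, fun n hn => ?_⟩
  have hpos : 0 ≤ m.real (U : Set T) := measureReal_nonneg
  have hn' : (n : ℝ) ≠ 0 := by positivity
  obtain ⟨A, -, hA⟩ := hflow U (m.real (U : Set T) / n) (by positivity)
    (div_le_self hpos (by exact_mod_cast hn))
  refine ⟨P.map (X A), hprob A, Measure.ext_of_charFun (funext fun z => ?_)⟩
  rw [charFun_convNPow, h.charFun_pow hX hflow n (A := U) (A₁ := A) (by rw [hA]; field_simp)]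

/-- Rational multiples of `m U` come from roots of `P_{X_U}`; a general value of `m A` is
approximated from below by dyadic multiples, the remainders being carried by a decreasing
sequence of sets. -/
theorem charFun_eq_exp (h : IsHomogeneous m P X) (hX : ∀ U, Measurable (X U))
    (hflow : ∀ (U : 𝒜.sets) (t : ℝ), 0 ≤ t → t ≤ m.real (U : Set T) →
      ∃ A : 𝒜.sets, (A : Set T) ⊆ U ∧ m.real (A : Set T) = t)
    {U : 𝒜.sets} {ψ : ℝ → ℂ} (hψ : IsExponent ψ)
    (hU : ∀ z, charFun (P.map (X U)) z = Complex.exp (ψ z))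
    {r : ℝ} (hr : 0 ≤ r) {A : 𝒜.sets} (hA : m.real (A : Set T) = r * m.real (U : Set T)) (z : ℝ) :
    charFun (P.map (X A)) z = Complex.exp (r * ψ z) := by
  have hpos : 0 ≤ m.real (U : Set T) := measureReal_nonneg
  have hrat : ∀ (k n : ℕ), n ≠ 0 → ∀ {A : 𝒜.sets},
      m.real (A : Set T) = (k / n : ℝ) * m.real (U : Set T) →
      charFun (P.map (X A)) z = Complex.exp (((k / n : ℝ) : ℂ) * ψ z) := by
    intro k n hn A hA
    have hn' : (n : ℝ) ≠ 0 := by exact_mod_cast hn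
    have hnc : (n : ℂ) ≠ 0 := by exact_mod_cast hn
    obtain ⟨A₁, -, hA₁⟩ := hflow U (m.real (U : Set T) / n) (by positivity)
      (div_le_self hpos (by exact_mod_cast Nat.one_le_iff_ne_zero.2 hn))
    have : IsProbabilityMeasure (P.map (X A₁)) :=
      Measure.isProbabilityMeasure_map (hX A₁).aemeasurable
    rw [h.charFun_pow hX hflow k (A₁ := A₁) (by rw [hA, hA₁]; ring),
      charFun_eq_exp_div hψ.cont hψ.zero hn fun y => by
        rw [← hU, h.charFun_pow hX hflow n (A := U) (A₁ := A₁) (by rw [hA₁]; field_simp)],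
      ← Complex.exp_nat_mul]
    congr 1
    push_cast
    ring
  -- the dyadic approximations of `r` from below
  let q : ℕ → ℝ := fun j => (⌊r * 2 ^ j⌋₊ : ℝ) / 2 ^ j
  have hq0 : ∀ j, 0 ≤ q j := fun j => by positivity
  have hqr : ∀ j, q j ≤ r := fun j => by
    rw [div_le_iff₀ (by positivity)]
    exact Nat.floor_le (by positivity)
  have hqmono : Monotone q := monotone_nat_of_le_succ fun j => by
    have h1 : 2 * ⌊r * 2 ^ j⌋₊ ≤ ⌊r * 2 ^ (j + 1)⌋₊ := by
      refine Nat.le_floor ?_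
      push_cast
      have := Nat.floor_le (show 0 ≤ r * 2 ^ j by positivity)
      rw [pow_succ]
      linarith
    have h2 : (2 : ℝ) * ⌊r * 2 ^ j⌋₊ ≤ ⌊r * 2 ^ (j + 1)⌋₊ := by exact_mod_cast h1
    simp only [q]
    rw [pow_succ] at h2 ⊢
    rw [div_le_div_iff₀ (by positivity) (by positivity)]
    have h3 : (0 : ℝ) < 2 ^ j := by positivity
    nlinarith
  have hqlim : Tendsto q atTop (𝓝 r) :=
    (tendsto_nat_floor_mul_div_atTop hr).comp
      (tendsto_pow_atTop_atTop_of_one_lt (one_lt_two (α := ℝ)))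
  obtain ⟨V, hVanti, hVA, hVm⟩ := IndexingCollection.exists_antitone_measure_eq hflow A
    (d := fun j => (r - q j) * m.real (U : Set T))
    (fun i j hij => mul_le_mul_of_nonneg_right (sub_le_sub_left (hqmono hij) r) hpos)
    (fun j => mul_nonneg (sub_nonneg.2 (hqr j)) hpos)
    (by rw [hA]; exact mul_le_mul_of_nonneg_right (sub_le_self _ (hq0 0)) hpos)
  -- the remainders decrease to a null set, so that their contribution tends to `1`
  let W : 𝒜.sets := ⟨⋂ j, (V j : Set T), by
    have := 𝒜.sInter_mem (Set.range fun j => (V j : Set T)) (Set.range_nonempty _)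
      (by rintro _ ⟨j, rfl⟩; exact (V j).2)
    rwa [Set.sInter_range] at this⟩
  have hW : m.real (W : Set T) = 0 := by
    have hle : ∀ j, m.real (W : Set T) ≤ (r - q j) * m.real (U : Set T) := fun j => by
      rw [← hVm j]
      exact measureReal_mono (Set.iInter_subset _ j) (𝒜.measure_lt_top m _).ne
    have hlim : Tendsto (fun j => (r - q j) * m.real (U : Set T)) atTop (𝓝 0) := by
      simpa using (hqlim.const_sub r).mul_const (m.real (U : Set T))
    exact le_antisymm (ge_of_tendsto' hlim hle) measureReal_nonneg
  have hVlim := tendsto_charFun_of_tendstoInMeasure (fun j => hX (V j))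
    (h.continuous V W hVanti rfl) z
  rw [h.charFun_of_measure_eq_zero hW] at hVlim
  have hqexp : Tendsto (fun j => Complex.exp (q j * ψ z)) atTop (𝓝 (Complex.exp (r * ψ z))) :=
    (Complex.continuous_exp.tendsto _).comp
      (((Complex.continuous_ofReal.tendsto _).comp hqlim).mul_const _)
  have hprod : ∀ j, charFun (P.map (X A)) z =
      charFun (P.map (X (V j))) z * Complex.exp (q j * ψ z) := by
    intro j
    obtain ⟨B, -, hB⟩ := hflow A (q j * m.real (U : Set T)) (mul_nonneg (hq0 j) hpos)
      (by rw [hA]; exact mul_le_mul_of_nonneg_right (hqr j) hpos)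
    rw [h.charFun_mul hX (hVA j) (A' := B) (by rw [hB, hVm, hA]; ring)]
    congr 1
    have := hrat ⌊r * 2 ^ j⌋₊ (2 ^ j) (by positivity) (A := B) (by rw [hB]; push_cast; rfl)
    rw [this]
    push_cast
    simp [q]
  have hlim := hVlim.mul hqexp
  rw [one_mul] at hlim
  exact tendsto_nhds_unique (tendsto_const_nhds.congr hprod) hlim

theorem exists_isExponent (h : IsHomogeneous m P X) (hX : ∀ U, Measurable (X U))
    (hflow : ∀ (U : 𝒜.sets) (t : ℝ), 0 ≤ t → t ≤ m.real (U : Set T) →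
      ∃ A : 𝒜.sets, (A : Set T) ⊆ U ∧ m.real (A : Set T) = t) :
    ∃ ψ, IsExponent ψ ∧
      ∀ A z, charFun (P.map (X A)) z = Complex.exp (m.real (A : Set T) * ψ z) := by
  by_cases h0 : ∀ A : 𝒜.sets, m.real (A : Set T) = 0
  · exact ⟨0, isExponent_zero, fun A z => by simp [h.charFun_of_measure_eq_zero (h0 A)]⟩
  · push Not at h0
    obtain ⟨U, hU⟩ := h0
    have hpos : 0 ≤ m.real (U : Set T) := measureReal_nonneg
    obtain ⟨ψ, hψ, hψU⟩ := (h.isInfinitelyDivisible hX hflow U).exists_isExponent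
    refine ⟨_, hψ.smul (inv_nonneg.2 hpos), fun A z => ?_⟩
    rw [h.charFun_eq_exp hX hflow hψ hψU (r := m.real (A : Set T) / m.real (U : Set T))
      (div_nonneg measureReal_nonneg hpos) (by field_simp)]
    congr 1
    push_cast
    ring

/-- Induction on the number of sets removed: `U₀ \ ⋃_{i < n} U_i` splits into
`U₀ \ ⋃_{i ≤ n} U_i` and `(U₀ ∩ U_n) \ ⋃_{i < n} U_i`. -/
theorem charFun_increment (h : IsHomogeneous m P X) (hX : ∀ U, Measurable (X U)) {ψ : ℝ → ℂ}
    (hψ : ∀ A z, charFun (P.map (X A)) z = Complex.exp (m.real (A : Set T) * ψ z))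
    (C : 𝒜.increments) (z : ℝ) :
    charFun (P.map (increment X C)) z = Complex.exp (m.real (C : Set T) * ψ z) := by
  have key : ∀ (n : ℕ) (U₀ : 𝒜.sets) (U : Fin n → 𝒜.sets) (C : 𝒜.increments),
      (C : Set T) = (U₀ : Set T) \ ⋃ i, (U i : Set T) →
      charFun (P.map (increment X C)) z = Complex.exp (m.real (C : Set T) * ψ z) := by
    intro n
    induction n with
    | zero =>
      intro U₀ U C hC
      have hC' : C = 𝒜.toIncrement U₀ := Subtype.ext (by
        rw [hC, Set.iUnion_of_empty, Set.sdiff_empty]; rfl)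
      rw [hC', Measure.map_congr (h.definite.increment_toIncrement U₀), hψ]
      rfl
    | succ n ih =>
      intro U₀ U C hC
      let U' : Fin n → 𝒜.sets := fun i => U i.castSucc
      let V : 𝒜.sets := ⟨(U₀ : Set T) ∩ U (Fin.last n), 𝒜.inter_mem U₀.2 (U (Fin.last n)).2⟩
      let C' : 𝒜.increments := ⟨(U₀ : Set T) \ ⋃ i, (U' i : Set T), U₀, n, U', rfl⟩
      let C'' : 𝒜.increments := ⟨(V : Set T) \ ⋃ i, (U' i : Set T), V, n, U', rfl⟩
      have hmem : ∀ x, x ∈ (C : Set T) ↔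
          x ∈ (U₀ : Set T) ∧ x ∉ (U (Fin.last n) : Set T) ∧ ∀ i, x ∉ (U' i : Set T) := fun x => by
        rw [hC, Set.mem_sdiff, Set.mem_iUnion, not_exists, Fin.forall_fin_succ',
          and_comm (a := ∀ _, _)]
      have hd : Disjoint (C : Set T) (C'' : Set T) :=
        Set.disjoint_left.2 fun x hx hx' => ((hmem x).1 hx).2.1 hx'.1.2
      have hun : (C' : Set T) = (C : Set T) ∪ (C'' : Set T) := by
        ext x
        rw [Set.mem_union, hmem]
        simp only [C', C'', V, Set.mem_sdiff, Set.mem_iUnion, not_exists, Set.mem_inter_iff]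
        tauto
      have hmu := h.charFun_union hX hd hun z
      rw [ih U₀ U' C' rfl, ih V U' C'' rfl, hun, measureReal_union hd
        (𝒜.measurableSet_increment C'') (𝒜.measure_increment_lt_top m C).ne
        (𝒜.measure_increment_lt_top m C'').ne, Complex.ofReal_add, add_mul, Complex.exp_add] at hmu
      exact (mul_right_cancel₀ (Complex.exp_ne_zero _) hmu).symm
  obtain ⟨U₀, n, U, hC⟩ := C.2
  exact key n U₀ U C hC

end IsHomogeneous

theorem IndexingCollection.iInter_sdiff_overlap_mem_increments {T : Type u} [TopologicalSpace T]
    (𝒜 : IndexingCollection T) {ι : Type*} [Fintype ι] (U : ι → 𝒜.sets) {J : Finset ι}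
    (hJ : J.Nonempty) :
    ((⋂ j ∈ J, (U j : Set T)) \ overlap (fun i => (U i : Set T)) (J.card + 1)) ∈
      𝒜.increments := by
  classical
  let e := Fintype.equivFin {i // i ∉ J}
  have hmem : (⋂ j ∈ J, (U j : Set T)) ∈ 𝒜.sets := by
    have := 𝒜.sInter_mem ((fun j => (U j : Set T)) '' (J : Set ι)) (hJ.to_set.image _)
      (by rintro _ ⟨j, -, rfl⟩; exact (U j).2)
    rwa [Set.sInter_image] at this
  refine ⟨⟨_, hmem⟩, _, fun k => U (e.symm k), ?_⟩
  ext x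
  rw [mem_iInter_sdiff_overlap_iff, Set.mem_sdiff, Finset.ext_iff]
  simp only [Finset.mem_filter, Finset.mem_univ, true_and, Set.mem_iInter, Set.mem_iUnion,
    not_exists]
  constructor
  · exact fun hx => ⟨fun i hi => (hx i).1 hi, fun k hk => (e.symm k).2 ((hx _).2 hk)⟩
  · rintro ⟨h1, h2⟩ i
    refine ⟨h1 i, fun hi => by_contra fun hiJ => h2 (e ⟨i, hiJ⟩) ?_⟩
    simpa using hi

/-- A linear combination of indicators of elements of `𝒜` is one of indicators of disjoint
elements of `𝒞`, over which the increments are independent. -/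
theorem IsHomogeneous.exists_hasExponent [IsProbabilityMeasure P] [BorelSpace T] [m.Regular]
    (h : IsHomogeneous m P X) (hX : ∀ U, Measurable (X U))
    (hflow : ∀ (U : 𝒜.sets) (t : ℝ), 0 ≤ t → t ≤ m.real (U : Set T) →
      ∃ A : 𝒜.sets, (A : Set T) ⊆ U ∧ m.real (A : Set T) = t) :
    ∃ ψ, IsExponent ψ ∧ HasExponent m P X ψ := by
  classical
  obtain ⟨ψ, hψ, hA⟩ := h.exists_isExponent hX hflow
  refine ⟨ψ, hψ, fun c => ?_⟩
  let E : c.support → Set T := fun U => ((U : 𝒜.sets) : Set T)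
  let z : c.support → ℝ := fun U => c U
  have hind : ∀ x, indicatorSum 𝒜 c x = ∑ i, z i * (E i).indicator 1 x := fun x => by
    rw [indicatorSum_apply, Finsupp.sum, ← Finset.sum_coe_sort]
  let D : {J : Finset c.support // J.Nonempty} → 𝒜.increments := fun J =>
    ⟨_, 𝒜.iInter_sdiff_overlap_mem_increments (fun U : c.support => (U : 𝒜.sets)) J.2⟩
  let w : {J : Finset c.support // J.Nonempty} → ℝ := fun J => ∑ i ∈ J.1, z i
  have hD : Pairwise fun I J => Disjoint (D I : Set T) (D J : Set T) := by
    intro I J hIJ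
    refine Set.disjoint_left.2 fun x hx hx' => hIJ (Subtype.ext ?_)
    rw [mem_iInter_sdiff_overlap_iff.1 hx, mem_iInter_sdiff_overlap_iff.1 hx']
  have hsum : linearExtension X c =ᵐ[P] fun ω => ∑ J, w J * increment X (D J) ω := by
    have := h.definite.linearExtension_ae_eq (c := c) (d := ∑ J, w J • incrementCoeff (D J)) (by
      ext x
      rw [hind]
      simp only [map_sum, map_smul, indicatorSum_incrementCoeff, Finset.sum_apply, Pi.smul_apply]
      rw [show ∑ i, z i * (E i).indicator 1 x = id (∑ i, z i * (E i).indicator 1 x) from rfl,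
        comp_sum_indicator (ψ := id) rfl]
      refine Finset.sum_congr rfl fun J _ => ?_
      by_cases hx : x ∈ (D J : Set T)
      · rw [Set.indicator_of_mem hx, Set.indicator_of_mem hx]
        simp [w]
      · rw [Set.indicator_of_notMem hx, Set.indicator_of_notMem hx]
        simp)
    refine this.trans (ae_of_all _ fun ω => ?_)
    simp [map_sum, linearExtension_incrementCoeff, Finset.sum_apply]
  simp_rw [hind]
  rw [Measure.map_congr hsum, charFun_sum_of_iIndepFun (fun J => measurable_increment hX _)
    (h.iIndepFun_of_fintype D hD), integral_comp_sum_indicator hψ.zero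
    (fun i => 𝒜.measurableSet _) (fun i => 𝒜.measure_lt_top m _), Complex.exp_sum]
  exact Finset.prod_congr rfl fun J _ => h.charFun_increment hX hA _ _

end ExponentExistence

/-! ### Construction of the process with a given exponent -/

section Construction

variable {T : Type u} [MeasurableSpace T]

theorem IsExponent.exists_law_indicators {m : Measure T} {ψ : ℝ → ℂ} (hψ : IsExponent ψ)
    {ι : Type*} [Fintype ι] {E : ι → Set T} (hE : ∀ i, MeasurableSet (E i))
    (hfin : ∀ i, m (E i) < ⊤) :
    ∃ ρ : Measure (ι → ℝ), IsProbabilityMeasure ρ ∧ ∀ z : ι → ℝ,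
      charFun (ρ.map fun y => ∑ i, z i * y i) 1 =
        Complex.exp (∫ x, ψ (∑ i, z i * (E i).indicator 1 x) ∂m) := by
  classical
  choose ν hν hνc using fun J : {J : Finset ι // J.Nonempty} => hψ.exists_law
    (m.real ((⋂ j ∈ J.1, E j) \ overlap E (J.1.card + 1))) measureReal_nonneg
  let Φ : ({J : Finset ι // J.Nonempty} → ℝ) → ι → ℝ := fun ξ i =>
    ∑ J : {J : Finset ι // J.Nonempty} with i ∈ J.1, ξ J
  have hΦ : Measurable Φ := measurable_pi_lambda _ fun i =>
    Finset.measurable_sum _ fun J _ => measurable_pi_apply J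
  refine ⟨(Measure.pi ν).map Φ, Measure.isProbabilityMeasure_map hΦ.aemeasurable, fun z => ?_⟩
  rw [Measure.map_map (by fun_prop) hΦ]
  exact charFun_sum_pi_atoms hψ.zero hE hfin hνc z

/-- The process is the coordinate process under the Kolmogorov extension of its
finite-dimensional laws. -/
theorem IsExponent.exists_hasExponent [MetricSpace T] [BorelSpace T]
    (𝒜 : IndexingCollection T) (m : Measure T) [m.Regular] {ψ : ℝ → ℂ} (hψ : IsExponent ψ) :
    ∃ P : Measure (𝒜.sets → ℝ), IsProbabilityMeasure P ∧ HasExponent m P (fun U ω => ω U) ψ := by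
  choose ρ hρ hρc using fun I : Finset 𝒜.sets => hψ.exists_law_indicators (m := m)
    (E := fun U : I => ((U : 𝒜.sets) : Set T)) (fun _ => 𝒜.measurableSet _)
    (fun _ => 𝒜.measure_lt_top m _)
  have hproj : IsProjectiveMeasureFamily (α := fun _ : 𝒜.sets => ℝ) ρ := by
    intro I J hJI
    have := map_eq_of_charFun_sum_eq (P := ρ J) (P' := ρ I) measurable_id
      (Finset.measurable_restrict₂ (X := fun _ : 𝒜.sets => ℝ) hJI) fun z => ?_
    · rwa [Measure.map_id] at this
    · let e : J → I := fun U => ⟨U, hJI U.2⟩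
      have he : Function.Injective e := fun U V hUV => Subtype.ext (congrArg (fun W => W.1) hUV)
      have hsum : ∀ y : I → ℝ, ∑ U, z U * y (e U) = ∑ U, Function.extend e z 0 U * y U := fun y =>
        Fintype.sum_of_injective e he _ _
          (fun U hU => by
            rw [Function.extend_apply' _ _ _ fun ⟨a, ha⟩ => hU ⟨a, ha⟩]
            simp)
          (fun U => by rw [he.extend_apply])
      have h1 := hρc J z
      have h2 := hρc I (Function.extend e z 0)
      simp only [← hsum] at h2
      exact h1.trans h2.symm
  obtain ⟨Q, hQ⟩ := exists_isProjectiveLimit hproj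
  refine ⟨Q, hQ.isProbabilityMeasure, fun c => ?_⟩
  have hlin : linearExtension (fun (U : 𝒜.sets) (ω : 𝒜.sets → ℝ) => ω U) c =
      (fun y : c.support → ℝ => ∑ U : c.support, c U * y U) ∘ c.support.restrict := by
    ext ω
    rw [linearExtension_apply, Finsupp.sum, ← Finset.sum_coe_sort]
    rfl
  have hind : ∀ x, indicatorSum 𝒜 c x =
      ∑ U : c.support, c U * ((U : 𝒜.sets) : Set T).indicator 1 x := fun x => by
    rw [indicatorSum_apply, Finsupp.sum, ← Finset.sum_coe_sort]
  have hmap := Measure.map_map (μ := Q) (f := c.support.restrict (π := fun _ => ℝ))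
    (g := fun y : c.support → ℝ => ∑ U : c.support, c U * y U) (by fun_prop)
    (Finset.measurable_restrict _)
  rw [hlin, ← hmap, hQ c.support, hρc]
  simp_rw [hind]

end Construction

/-! ### The exponent of a Lévy process -/

section Levy

variable {T : Type u} [MetricSpace T] [MeasurableSpace T] {𝒜 : IndexingCollection T}
  {m : Measure T} {Ω : Type v} [MeasurableSpace Ω] {P : Measure Ω} {X : 𝒜.sets → Ω → ℝ}

theorem IndexingCollection.exists_subset_measureReal_eq [m.Regular] (hm₀ : m 𝒜.minimalSet = 0)
    (hm : ∀ A : ℕ → Set T, (∀ i, A i ∈ 𝒜.sets) → Monotone A →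
      closure (⋃ i, A i) ∈ 𝒜.sets → m (closure (⋃ i, A i)) = m (⋃ i, A i))
    (U : 𝒜.sets) (t : ℝ) (ht : 0 ≤ t) (htU : t ≤ m.real (U : Set T)) :
    ∃ A : 𝒜.sets, (A : Set T) ⊆ U ∧ m.real (A : Set T) = t := by
  obtain ⟨A, hAU, hA⟩ := 𝒜.exists_subset_measure_eq m hm₀ hm U (t := ENNReal.ofReal t)
    (ENNReal.ofReal_le_of_le_toReal htU)
  exact ⟨A, hAU, by rw [measureReal_def, hA, ENNReal.toReal_ofReal ht]⟩

/-- The law of `X_{U₀}` determines the exponent when `m U₀ ≠ 0`. -/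
theorem HasExponent.exponent_eq [BorelSpace T] {Ω' : Type w} [MeasurableSpace Ω'] {P' : Measure Ω'}
    {X' : 𝒜.sets → Ω' → ℝ} {ψ ψ' : ℝ → ℂ} (h : HasExponent m P X ψ)
    (hX : ∀ U, Measurable (X U)) (hψ : IsExponent ψ) (h' : HasExponent m P' X' ψ')
    (hX' : ∀ U, Measurable (X' U)) (hψ' : IsExponent ψ') {U₀ : 𝒜.sets}
    (hU₀ : m.real (U₀ : Set T) ≠ 0) (hlaw : P'.map (X' U₀) = P.map (X U₀)) : ψ' = ψ := by
  have hc : (m.real (U₀ : Set T) : ℂ) ≠ 0 := by exact_mod_cast hU₀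
  have := eq_of_exp_eq (ψ := fun z => m.real (U₀ : Set T) * ψ' z)
    (χ := fun z => m.real (U₀ : Set T) * ψ z) (continuous_const.mul hψ'.cont)
    (continuous_const.mul hψ.cont) (by simp [hψ.zero, hψ'.zero]) fun z => by
      rw [← h.charFun_apply hX hψ, ← h'.charFun_apply hX' hψ', hlaw]
  exact funext fun z => mul_left_cancel₀ hc (congrFun this z)

variable [BorelSpace T] [m.Regular] [IsProbabilityMeasure P]

theorem IsHomogeneous.isLevy [LocallyCompactSpace T]
    (h : IsHomogeneous m P X) (hX : ∀ U, Measurable (X U))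
    (hm₀ : m 𝒜.minimalSet = 0)
    (hm : ∀ A : ℕ → Set T, (∀ i, A i ∈ 𝒜.sets) → Monotone A →
      closure (⋃ i, A i) ∈ 𝒜.sets → m (closure (⋃ i, A i)) = m (⋃ i, A i)) :
    IsLevy m P X := by
  obtain ⟨ψ, hψ, hψX⟩ := h.exists_hasExponent hX
    (IndexingCollection.exists_subset_measureReal_eq hm₀ hm)
  exact hψX.isLevy hX hψ hm₀ hm

theorem IsLevy.exists_hasExponent (h : IsLevy m P X) (hX : ∀ U, Measurable (X U))
    (hm₀ : m 𝒜.minimalSet = 0)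
    (hm : ∀ A : ℕ → Set T, (∀ i, A i ∈ 𝒜.sets) → Monotone A →
      closure (⋃ i, A i) ∈ 𝒜.sets → m (closure (⋃ i, A i)) = m (⋃ i, A i)) :
    ∃ ψ, IsExponent ψ ∧ HasExponent m P X ψ :=
  h.isHomogeneous.exists_hasExponent hX (IndexingCollection.exists_subset_measureReal_eq hm₀ hm)

end Levy

end SetIndexed

open SetIndexed in
theorem theorem4p3 {T : Type u} [MetricSpace T] [LocallyCompactSpace T]
    [MeasurableSpace T] [BorelSpace T] (𝒜 : IndexingCollection T)
    (m : Measure T) [m.Regular] (hm₀ : m 𝒜.minimalSet = 0)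
    (hm : ∀ A : ℕ → Set T, (∀ i, A i ∈ 𝒜.sets) → Monotone A →
      closure (⋃ i, A i) ∈ 𝒜.sets → m (closure (⋃ i, A i)) = m (⋃ i, A i)) :
    -- (i)
    (∀ {Ω : Type v} [MeasurableSpace Ω] (P : Measure Ω) [IsProbabilityMeasure P]
      (X : 𝒜.sets → Ω → ℝ), (∀ U, Measurable (X U)) → IsLevy m P X →
      ∀ U₀ : 𝒜.sets, 0 < m (U₀ : Set T) →
        IsInfinitelyDivisible (P.map (X U₀)) ∧
        IsInfinitelyDivisible (convRPow (P.map (X U₀)) (1 / m.real (U₀ : Set T))) ∧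
        (∀ U : 𝒜.sets, P.map (X U) =
          convRPow (convRPow (P.map (X U₀)) (1 / m.real (U₀ : Set T))) (m.real (U : Set T))) ∧
        HasCanonicalFDD m P X (convRPow (P.map (X U₀)) (1 / m.real (U₀ : Set T))) ∧
        ∀ {Ω' : Type w} [MeasurableSpace Ω'] (P' : Measure Ω') [IsProbabilityMeasure P']
          (X' : 𝒜.sets → Ω' → ℝ), (∀ U, Measurable (X' U)) → IsLevy m P' X' →
          P'.map (X' U₀) = P.map (X U₀) →
            P'.map (fun ω U => X' U ω) = P.map (fun ω U => X U ω)) ∧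
    -- (ii)
    (∀ {Ω : Type v} [MeasurableSpace Ω] (P : Measure Ω) [IsProbabilityMeasure P]
      (X : 𝒜.sets → Ω → ℝ), (∀ U, Measurable (X U)) →
      (IsLevy m P X ↔
        HasDefiniteIncrements P X ∧ IsIDScatteredMeasure P X ∧
          ∀ C₁ C₂ : 𝒜.increments, m (C₁ : Set T) = m (C₂ : Set T) →
            IdentDistrib (increment X C₁) (increment X C₂) P P) ∧
      (IsLevy m P X → ∃ μ : Measure ℝ, IsInfinitelyDivisible μ ∧ HasCanonicalFDD m P X μ)) ∧
    -- (iii)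
    (∀ μ : Measure ℝ, IsInfinitelyDivisible μ →
      ∃ (Ω : Type u) (_ : MeasurableSpace Ω) (P : Measure Ω) (_ : IsProbabilityMeasure P)
        (X : 𝒜.sets → Ω → ℝ), (∀ U, Measurable (X U)) ∧ IsLevy m P X ∧
        (∀ U : 𝒜.sets, P.map (X U) = convRPow μ (m.real (U : Set T))) ∧
        HasCanonicalFDD m P X μ) := by
  refine ⟨?_, ?_, ?_⟩
  · intro Ω _ P _ X hX hL U₀ hU₀
    obtain ⟨ψ, hψ, hψX⟩ := hL.exists_hasExponent hX hm₀ hm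
    have hc : 0 < m.real (U₀ : Set T) := ENNReal.toReal_pos hU₀.ne' (𝒜.measure_lt_top m U₀).ne
    have hc' : (m.real (U₀ : Set T) : ℂ) ≠ 0 := by exact_mod_cast hc.ne'
    have hprob : IsProbabilityMeasure (P.map (X U₀)) :=
      Measure.isProbabilityMeasure_map (hX U₀).aemeasurable
    obtain ⟨hμp, hμ⟩ := (hψ.smul hc.le).convRPow_spec (μ := P.map (X U₀))
      (hψX.charFun_apply hX hψ U₀) (t := 1 / m.real (U₀ : Set T)) (by positivity)
    have hμ' : ∀ z, charFun (convRPow (P.map (X U₀)) (1 / m.real (U₀ : Set T))) z =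
        Complex.exp (ψ z) := fun z => by
      rw [hμ]
      congr 1
      push_cast
      field_simp
    refine ⟨hψ.isInfinitelyDivisible hc.le (hψX.charFun_apply hX hψ U₀),
      hψ.isInfinitelyDivisible zero_le_one fun z => by rw [hμ', Complex.ofReal_one, one_mul],
      hψX.map_eq_convRPow hX hψ hμ', hψX.hasCanonicalFDD hX hψ hμ', ?_⟩
    intro Ω' _ P' _ X' hX' hL' hlaw
    obtain ⟨ψ', hψ', hψX'⟩ := hL'.exists_hasExponent hX' hm₀ hm
    obtain rfl := hψX.exponent_eq hX hψ hψX' hX' hψ' hc.ne' hlaw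
    exact hψX.map_eq hX hψX' hX'
  · intro Ω _ P _ X hX
    refine ⟨⟨fun hL => ?_, fun ⟨hdef, hID, hlaw⟩ =>
      (hID.isHomogeneous hX hdef hlaw).isLevy hX hm₀ hm⟩, fun hL => ?_⟩
    · obtain ⟨ψ, hψ, hψX⟩ := hL.exists_hasExponent hX hm₀ hm
      exact ⟨hL.definite, hψX.isIDScatteredMeasure hX hψ,
        fun _ _ hC => hψX.map_increment_eq hX hψ hC⟩
    · obtain ⟨ψ, hψ, hψX⟩ := hL.exists_hasExponent hX hm₀ hm
      obtain ⟨μ, hμp, hμ⟩ := hψ.exists_law 1 zero_le_one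
      exact ⟨μ, hψ.isInfinitelyDivisible zero_le_one hμ,
        hψX.hasCanonicalFDD hX hψ fun z => by rw [hμ, Complex.ofReal_one, one_mul]⟩
  · intro μ hμ
    obtain ⟨ψ, hψ, hψμ⟩ := hμ.exists_isExponent
    obtain ⟨P, hP, hψX⟩ := hψ.exists_hasExponent 𝒜 m
    have hX : ∀ U : 𝒜.sets, Measurable fun ω : 𝒜.sets → ℝ => ω U := measurable_pi_apply
    exact ⟨𝒜.sets → ℝ, inferInstance, P, hP, fun U ω => ω U, hX, hψX.isLevy hX hψ hm₀ hm,
      hψX.map_eq_convRPow hX hψ hψμ, hψX.hasCanonicalFDD hX hψ hψμ⟩
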